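/- Let $I=(a,b)$ and $I'=(a',b')$ be bounded open intervals with $a<a'<b'<b$, let $\alpha>0$, $\beta\ge 0$ and $g\in L^\infty(I)$. For $u\in SBV(I)$ let $u'$ be the density of the absolutely continuous part of $Du$, let $u^l(x),u^r(x)$ be the left and right traces of $u$ at $x$, let $S_u=\{x\in I: u^l(x)\ne u^r(x)\}$, and let $$F(u)=\int_I |u'|^2\,dx+\beta\int_I|u-g|^2\,dx+\alpha\,\mathcal H^0(S_u)\in[0,+\infty].$$ A function $u\in SBV(I)$ is a *Dirichlet minimizer of $F$ in $I'$* if $F(u)\le F(v)$ for all $v\in SBV(I)$ with $v=u$ a.e. in $I\setminus I'$. For $u\in SBV(I)$ let $\Gamma_u$ also denote the $1$-dimensional rectifiable current on $I\times\mathbb R$ given by integration over the extended graph $\{(x,t)\in I\times\mathbb R: \min(u^l(x),u^r(x))\le t\le \max(u^l(x),u^r(x))\}$, oriented by the unit tangent $(1,u')/\sqrt{1+|u'|^2}$ off $S_u\times\mathbb R$ and by $(0,\operatorname{sign}(u^r-u^l))$ on $S_u\times\mathbb R$. Let $\hat C=\{\sum_{i=1}^k\lambda_i\Gamma_{u_i}: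 k\in\mathbb N,\ \lambda_i\in\mathbb R,\ u_i\in SBV(I)\}$, a real vector space of currents. Let $K$ be the set of Borel fields $\phi=(\phi^x,\phi^t):I\times\mathbb R\to\mathbb R^2$ such that, for all $x\in I$ and $t,t_1,t_2\in\mathbb R$, $\phi^t(x,t)\ge \frac{|\phi^x(x,t)|^2}{4}-\beta(t-g(x))^2$, and $\phi^x(x,\cdot)$ is locally integrable with $\left|\int_{t_1}^{t_2}\phi^x(x,s)\,ds\right|\le\alpha$. For a rectifiable current $T=(\mathcal M,\theta,\tau)$ (rectifiable set, positive multiplicity, unit orienting tangent) put $\nu_T=-\star\tau=(\tau^t,-\tau^x)$ and $$\hat G(T)=\sup_{\phi}\int_{\mathcal M}\theta\,\langle\phi,\nu_T\rangle\,d\mathcal H^1\in(-\infty,+\infty],$$ where the supremum is over all $\phi\in K$ for which the integral exists and is finite. **Theorem.** Let $u\in SBV(I)$ be a Dirichlet minimizer of $F$ in $I'$ with $F(u)<+\infty$. Then there is a linear map $\xi:\hat C\to\mathbb R$ that is a calibration for $\Gamma_u$, that is: 1. $\xi(\Gamma_u)=\hat G(\Gamma_u)=F(u)$; 2. $\xi(T)=0$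 for every $T\in\hat C$ whose restriction to $(I\setminus I')\times\mathbb R$ is zero; 3. $\xi(T)\le\hat G(T)$ for every $T\in\hat C$. -/

import Mathlib

open MeasureTheory Set Filter Topology
open scoped ENNReal ContDiff

noncomputable section

namespace MumfordShah

/-- The plane with its Euclidean metric; `p 0` is the variable `x`, `p 1` the variable `t`. -/
abbrev Plane : Type := EuclideanSpace ℝ (Fin 2)

/-- The open strip `(a, b) × ℝ`. -/
def strip (a b : ℝ) : TopologicalSpace.Opens Plane :=
  ⟨{p | p 0 ∈ Ioo a b}, isOpen_Ioo.preimage (by fun_prop)⟩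

/-! ### Special functions of bounded variation on an interval -/

/-- On `(a, b)` the distributional derivative of `u` is the finite measure
`v dx + ∑ₓ c(x) δₓ`, with `v` integrable and `c` absolutely summable. -/
def HasSBVDeriv (a b : ℝ) (u v c : ℝ → ℝ) : Prop :=
  IntegrableOn v (Ioo a b) ∧ Summable (fun x => |c x|) ∧
    ∀ η : ℝ → ℝ, ContDiff ℝ ∞ η → HasCompactSupport η → tsupport η ⊆ Ioo a b →
      ∫ x in Ioo a b, u x * deriv η x
        = -((∫ x in Ioo a b, v x * η x) + ∑' x, c x * η x)

/-- `u ∈ SBV((a, b))`: `u` is integrable and its distributional derivative is a finite measure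
that consists of an absolutely continuous part and of an atomic part (no Cantor part).
Functions are arbitrary representatives: everything below depends only on the
almost-everywhere class of `u` on `(a, b)`. -/
def IsSBV (a b : ℝ) (u : ℝ → ℝ) : Prop :=
  IntegrableOn u (Ioo a b) ∧ ∃ v c : ℝ → ℝ, HasSBVDeriv a b u v c

open Classical in
/-- `u'`, the density of the absolutely continuous part of `Du`
(unique up to a null set for `u ∈ SBV((a, b))`). -/
def grad (a b : ℝ) (u : ℝ → ℝ) : ℝ → ℝ :=
  if h : IsSBV a b u then h.2.choose else 0

/-- The left trace `uˡ(x)`. -/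
def leftTrace (u : ℝ → ℝ) (x : ℝ) : ℝ :=
  limUnder (𝓝[>] (0 : ℝ)) (fun r => ⨍ y in Ioo (x - r) x, u y)

/-- The right trace `uʳ(x)`. -/
def rightTrace (u : ℝ → ℝ) (x : ℝ) : ℝ :=
  limUnder (𝓝[>] (0 : ℝ)) (fun r => ⨍ y in Ioo x (x + r), u y)

/-- The singular (jump) set `S_u` of `u` in `(a, b)`. -/
def jumpSet (a b : ℝ) (u : ℝ → ℝ) : Set ℝ :=
  {x ∈ Ioo a b | leftTrace u x ≠ rightTrace u x}

/-- The Mumford-Shah functional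
`F(u) = ∫ |u'|² dx + β ∫ |u - g|² dx + α ℋ⁰(S_u)` on `(a, b)`. -/
def energy (a b α β : ℝ) (g u : ℝ → ℝ) : ℝ≥0∞ :=
  (∫⁻ x in Ioo a b, ENNReal.ofReal (grad a b u x ^ 2))
    + ENNReal.ofReal β * (∫⁻ x in Ioo a b, ENNReal.ofReal ((u x - g x) ^ 2))
    + ENNReal.ofReal α * ((jumpSet a b u).encard : ℝ≥0∞)

/-- `u` is a Dirichlet minimizer in `(a', b')` of the Mumford-Shah functional on `(a, b)`. -/
def IsDirichletMinimizer (a b a' b' α β : ℝ) (g u : ℝ → ℝ) : Prop :=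
  IsSBV a b u ∧ ∀ v : ℝ → ℝ, IsSBV a b v →
    (∀ᵐ x, x ∈ Ioo a b \ Ioo a' b' → u x = v x) →
      energy a b α β g u ≤ energy a b α β g v

/-! ### Currents -/

/-- Smooth 1-forms with compact support in `(a, b) × ℝ`. -/
abbrev Form (a b : ℝ) : Type := TestFunction (strip a b) (Plane →L[ℝ] ℝ) ⊤

/-- Functionals on 1-forms, with pointwise operations. The 1-dimensional currents on
`(a, b) × ℝ` are the linear continuous ones among them. -/
abbrev FormFunctional (a b : ℝ) : Type := Form a b → ℝ

/-- A triple `(M, θ, ξ)` that defines a 1-dimensional rectifiable current of finite mass with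
real multiplicity on `(a, b) × ℝ`. -/
structure RectTriple (a b : ℝ) where
  /-- the rectifiable set `M` -/
  carrier : Set Plane
  /-- the multiplicity `θ` -/
  mult : Plane → ℝ
  /-- the orientation `ξ` -/
  orient : Plane → Plane
  carrier_subset : carrier ⊆ strip a b
  measurableSet_carrier : MeasurableSet carrier
  measurable_mult : Measurable mult
  mult_pos : ∀ p ∈ carrier, 0 < mult p
  /-- the mass `∫_M θ dℋ¹` is finite -/
  integrableOn_mult : IntegrableOn mult carrier (μH[1])
  measurable_orient : Measurable orient
  norm_orient : ∀ p ∈ carrier, ‖orient p‖ = 1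
  /-- Up to an `ℋ¹`-null set, `M` is covered by countably many Lipschitz pieces `γₙ(Aₙ)`, to which
  `ξ` is tangent almost everywhere on `M`. -/
  rectifiable : ∃ (γ : ℕ → ℝ → Plane) (A : ℕ → Set ℝ),
    (∀ n, MeasurableSet (A n)) ∧ (∀ n, ∃ L, LipschitzWith L (γ n)) ∧
    μH[1] (carrier \ ⋃ n, γ n '' A n) = 0 ∧
    ∀ n, ∀ᵐ s, s ∈ A n → γ n s ∈ carrier → ∃ c : ℝ, deriv (γ n) s = c • orient (γ n s)

/-- The current `w ↦ ∫_M ⟨w, ξ⟩ θ dℋ¹` restricted to the set `A`,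
that is `(T ⌞ A)(w) = ∫_{M ∩ A} ⟨w, ξ⟩ θ dℋ¹`. -/
def RectTriple.restrict {a b : ℝ} (R : RectTriple a b) (A : Set Plane) : FormFunctional a b :=
  fun w => ∫ p in R.carrier ∩ A, w p (R.orient p) * R.mult p ∂(μH[1])

/-- The current `w ↦ ∫_M ⟨w, ξ⟩ θ dℋ¹`. -/
def RectTriple.toCurrent {a b : ℝ} (R : RectTriple a b) : FormFunctional a b :=
  fun w => ∫ p in R.carrier, w p (R.orient p) * R.mult p ∂(μH[1])

/-- `T ⌞ A = 0` for a rectifiable current `T`. The triple that defines `T` is unique up to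
`ℋ¹`-null sets, so that it does not matter which one is used. -/
def RestrictEqZero {a b : ℝ} (T : FormFunctional a b) (A : Set Plane) : Prop :=
  ∃ R : RectTriple a b, R.toCurrent = T ∧ R.restrict A = 0

/-- The extended graph `Γ_u = {(x, t) : u⁻(x) ≤ t ≤ u⁺(x)}`, where `u⁻` and `u⁺` are the smaller
and the larger one of the traces. -/
def extGraph (a b : ℝ) (u : ℝ → ℝ) : Set Plane :=
  {p | p 0 ∈ Ioo a b ∧ min (leftTrace u (p 0)) (rightTrace u (p 0)) ≤ p 1 ∧
    p 1 ≤ max (leftTrace u (p 0)) (rightTrace u (p 0))}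

open Classical in
/-- The unit tangent field that orients `Γ_u` in the direction of increasing `x`: it is
`(1, u') / √(1 + u'²)` off the jumps, and on the vertical segment over a jump point it points
from the left trace to the right trace. -/
def graphOrient (a b : ℝ) (u : ℝ → ℝ) (p : Plane) : Plane :=
  if leftTrace u (p 0) = rightTrace u (p 0) then
    (Real.sqrt (1 + grad a b u (p 0) ^ 2))⁻¹ • !₂[1, grad a b u (p 0)]
  else !₂[0, SignType.sign (rightTrace u (p 0) - leftTrace u (p 0))]

/-- The current `Γ_u` of integration over the oriented extended graph of `u`. -/
def graphCurrent (a b : ℝ) (u : ℝ → ℝ) : FormFunctional a b :=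
  fun w => ∫ p in extGraph a b u, w p (graphOrient a b u p) ∂(μH[1])

/-- The space `Ĉ` of finite real linear combinations of currents `Γ_u`, `u ∈ SBV((a, b))`. -/
def graphSpan (a b : ℝ) : Submodule ℝ (FormFunctional a b) :=
  Submodule.span ℝ {T | ∃ u, IsSBV a b u ∧ T = graphCurrent a b u}

/-- `Γ_u` as an element of `Ĉ`. -/
def graphElem (a b : ℝ) (u : ℝ → ℝ) (hu : IsSBV a b u) : graphSpan a b :=
  ⟨graphCurrent a b u, Submodule.subset_span ⟨u, hu, rfl⟩⟩

/-! ### The lifted functional and calibrations -/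

/-- The Hodge star on vectors of the plane. -/
def hodge (ξ : Plane) : Plane := !₂[-ξ 1, ξ 0]

/-- The class `K` of Borel fields `φ = (φˣ, φᵗ)` with
`φᵗ(x, t) ≥ |φˣ(x, t)|² / 4 - β (t - g(x))²` and `|∫_{t₁}^{t₂} φˣ(x, s) ds| ≤ α`, where the latter
integrals have to exist. -/
def Admissible (a b α β : ℝ) (g : ℝ → ℝ) (φ : Plane → Plane) : Prop :=
  Measurable φ ∧
  (∀ x ∈ Ioo a b, ∀ t : ℝ,
    φ !₂[x, t] 0 ^ 2 / 4 - β * (t - g x) ^ 2 ≤ φ !₂[x, t] 1) ∧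
  (∀ x ∈ Ioo a b, ∀ t₁ t₂ : ℝ,
    IntervalIntegrable (fun s => φ !₂[x, s] 0) volume t₁ t₂ ∧
    |∫ s in t₁..t₂, φ !₂[x, s] 0| ≤ α)

/-- The integrand `θ ⟨φ, ν_T⟩` with `ν_T = -⋆ξ`. -/
def RectTriple.flux {a b : ℝ} (R : RectTriple a b) (φ : Plane → Plane) (p : Plane) : ℝ :=
  R.mult p * inner ℝ (φ p) (-hodge (R.orient p))

/-- The lifted functional `G(T) = sup_{φ ∈ K} ∫_M θ ⟨φ, ν_T⟩ dℋ¹` for a rectifiable current `T`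
with triple `(M, θ, ξ)`; the supremum runs over the `φ` for which the integral exists. The triple
is unique up to `ℋ¹`-null sets, so the supremum over all triples of `T` changes nothing. -/
def lift (a b α β : ℝ) (g : ℝ → ℝ) (T : FormFunctional a b) : EReal :=
  ⨆ (R : RectTriple a b) (_ : R.toCurrent = T) (φ : Plane → Plane)
    (_ : Admissible a b α β g φ) (_ : IntegrableOn (R.flux φ) R.carrier (μH[1])),
    ((∫ p in R.carrier, R.flux φ p ∂(μH[1]) : ℝ) : EReal)

/-- The linear functional `ξ` on `Ĉ` is a calibration for `Γ_u` in `(a', b')`. -/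
def IsCalibration (a b a' b' α β : ℝ) (g u : ℝ → ℝ) (hu : IsSBV a b u)
    (ξ : graphSpan a b →ₗ[ℝ] ℝ) : Prop :=
  (((ξ (graphElem a b u hu) : ℝ) : EReal) = lift a b α β g (graphCurrent a b u) ∧
    lift a b α β g (graphCurrent a b u) = (energy a b α β g u : EReal)) ∧
  (∀ T : graphSpan a b,
    RestrictEqZero (T : FormFunctional a b) {p | p 0 ∈ Ioo a b \ Ioo a' b'} → ξ T = 0) ∧
  (∀ T : graphSpan a b, ((ξ T : ℝ) : EReal) ≤ lift a b α β g (T : FormFunctional a b))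

end MumfordShah

end

/-! Inside `I'` the calibration comes from a value function, not from one fixed vector field. Let
`W(x, t)` be the least energy of a path with finitely many jumps that leads from `(a', uʳ(a'))` to
`(x, t)`. On a graph `Γ_v` the functional `ξ` is the flux over `I \ I'` of a field that calibrates
`u` there, plus `W(b', vˡ(b')) - W(a', vʳ(a'))`; it is extended linearly (`calib`).

The value at `Γ_u`. Gluing a path into `u` gives a competitor, so minimality bounds `W(b', uˡ(b'))`
from below by the energy of `u` in `I'` (`Reach.energy_le`), whence `F(u) ≤ ξ(Γ_u)`
(`energy_le_calib`). The pointwise inequality `φˣ p - φᵗ ≤ p² + β (t - g)²`, together with the bound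
`α` on vertical fluxes, gives `Ĝ(Γ_u) ≤ F(u)` (`IsRep.lift_le_energy`). With `ξ ≤ Ĝ` all three
numbers agree.

The inequality `ξ(T) ≤ Ĝ(T)` is the core. The class `K` consists of Borel fields, and `φˣ(x, ·)` may
live on a countable set of `t`, where the integral constraint is void although the graphs of a given
chain charge that set. A field may thus be adapted to the chain `T = ∑ λᵢ Γ_{uᵢ}`. If `Ĝ(T)` is
finite, then the slices `∑ λᵢ δ_{uᵢ(x)}` are positive measures, as `φᵗ` has no upper bound
(`Chain.ae_sliceL_nonneg`); they jump at finitely many points only (`Chain.finite_trueJumps`); and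
slopes are square integrable where the multiplicity is positive (`Chain.integrableOn_posSlope_sq`).
The total mass of the slices is constant in `x`. Between jumps their quantiles are therefore
absolutely continuous functions that pick values of the `uᵢ` (`Chain.exists_strand`), and finitely
many quantiles with weights recover the slices (`exists_levels`). The growth of `W` along each
strand is at most its energy, and `W(y, ·)` oscillates by at most `α`, so that its increments are
the fluxes of an admissible vertical field. Summation (`Chain.transport`) bounds `ξ(T)` by the flux
of a field of `K` (`Chain.sum_calib_le`).

That `ξ` depends on the current alone follows from the same inequality: a combination that
represents `0` has `ξ ≤ Ĝ(0) ≤ 0`, and so has its opposite. If `T` vanishes over `I \ I'`, so do its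
slices there, including the one-sided ones at `a'` and `b'`, and every term of `ξ(T)` is zero
(`Chain.sum_calib_eq_zero`). -/

noncomputable section

namespace MumfordShah

/-! ### Data of a special function of bounded variation -/

/-- The data of a special function of bounded variation on the line: its value at `-∞`, the density
of the absolutely continuous part and the atoms of its derivative. -/
structure SBVData where
  base : ℝ
  slope : ℝ → ℝ
  jump : ℝ → ℝ
  measurable_slope : Measurable slope
  integrable_slope : Integrable slope
  summable_jump : Summable fun x => |jump x|

namespace SBVData

variable (D : SBVData)

/-- The derivative of the function with data `D`, as a set function. -/
def inc (s : Set ℝ) : ℝ := (∫ y in s, D.slope y) + ∑' y, s.indicator D.jump y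

/-- The left-continuous representative. -/
def L (x : ℝ) : ℝ := D.base + D.inc (Iio x)

/-- The right-continuous representative. -/
def R (x : ℝ) : ℝ := D.base + D.inc (Iic x)

/-- The atomic part of the total variation. -/
def atoms : Measure ℝ := Measure.sum fun y => ENNReal.ofReal |D.jump y| • Measure.dirac y

/-- The total variation measure. -/
def mass : Measure ℝ := volume.withDensity (fun y => ENNReal.ofReal |D.slope y|) + D.atoms

/-- The set of jump points. -/
def jumps : Set ℝ := {x | D.jump x ≠ 0}

theorem summable_indicator (s : Set ℝ) : Summable fun y => s.indicator D.jump y :=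
  D.summable_jump.of_abs.indicator s

theorem countable_jumps : D.jumps.Countable := by
  have := D.summable_jump.countable_support
  simpa [jumps, Function.support] using this

theorem inc_union {s t : Set ℝ} (hst : Disjoint s t) (ht : MeasurableSet t) :
    D.inc (s ∪ t) = D.inc s + D.inc t := by
  unfold inc
  rw [setIntegral_union hst ht D.integrable_slope.integrableOn D.integrable_slope.integrableOn,
    indicator_union_of_disjoint hst, (D.summable_indicator s).tsum_add (D.summable_indicator t)]
  ring

theorem inc_singleton (x : ℝ) : D.inc {x} = D.jump x := by
  unfold inc
  rw [tsum_eq_single x (by intro y hy; simp [hy])]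
  simp

theorem R_eq (x : ℝ) : D.R x = D.L x + D.jump x := by
  have h : Iic x = Iio x ∪ {x} := by ext y; simp [le_iff_lt_or_eq]
  rw [R, L, h, D.inc_union (by simp) (measurableSet_singleton x), inc_singleton]
  ring

theorem L_sub_L {x y : ℝ} (h : x ≤ y) : D.L y - D.L x = D.inc (Ico x y) := by
  rw [L, L, ← Iio_union_Ico_eq_Iio h,
    D.inc_union (by rw [Set.disjoint_left]; intro z hz hz'; exact absurd hz'.1 (not_le.2 hz))
      measurableSet_Ico]
  ring

theorem L_sub_R {x y : ℝ} (h : x < y) : D.L y - D.R x = D.inc (Ioo x y) := by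
  rw [L, R, ← Iic_union_Ioo_eq_Iio h,
    D.inc_union (by rw [Set.disjoint_left]; intro z hz hz'; exact absurd hz'.1 (not_lt.2 hz))
      measurableSet_Ioo]
  ring

theorem R_sub_R {x y : ℝ} (h : x ≤ y) : D.R y - D.R x = D.inc (Ioc x y) := by
  rw [R, R, ← Iic_union_Ioc_eq_Iic h,
    D.inc_union (by rw [Set.disjoint_left]; intro z hz hz'; exact absurd hz'.1 (not_lt.2 hz))
      measurableSet_Ioc]
  ring

theorem atoms_apply {s : Set ℝ} (hs : MeasurableSet s) :
    D.atoms s = ENNReal.ofReal (∑' y, s.indicator (fun y => |D.jump y|) y) := by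
  rw [atoms, Measure.sum_apply _ hs, ENNReal.ofReal_tsum_of_nonneg
    (fun y => indicator_nonneg (fun _ _ => abs_nonneg _) y) (D.summable_jump.indicator s)]
  congr 1
  ext y
  by_cases hy : y ∈ s <;> simp [hy]

instance : IsFiniteMeasure D.atoms := ⟨by
  rw [D.atoms_apply MeasurableSet.univ]; exact ENNReal.ofReal_lt_top⟩

instance : IsFiniteMeasure (volume.withDensity (fun y => ENNReal.ofReal |D.slope y|)) :=
  isFiniteMeasure_withDensity_ofReal D.integrable_slope.abs.2

instance : IsFiniteMeasure D.mass := by unfold mass; infer_instance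

theorem abs_tsum_le {s : Set ℝ} (hs : MeasurableSet s) :
    |∑' y, s.indicator D.jump y| ≤ D.atoms.real s := by
  rw [measureReal_def, D.atoms_apply hs, ENNReal.toReal_ofReal
    (tsum_nonneg fun y => indicator_nonneg (fun _ _ => abs_nonneg _) y)]
  have h2 : (fun y => ‖s.indicator D.jump y‖) = s.indicator (fun y => |D.jump y|) := by
    ext y; by_cases hy : y ∈ s <;> simp [hy]
  have h1 : Summable fun y => ‖s.indicator D.jump y‖ := by
    rw [h2]; exact D.summable_jump.indicator s
  have h3 := norm_tsum_le_tsum_norm h1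
  rw [h2] at h3
  exact h3

/-- The triangle inequality, separately for the two parts. The one-sided limits of `L` and the
length of its graph are controlled by this finite measure. -/
theorem abs_inc_le {s : Set ℝ} (hs : MeasurableSet s) : |D.inc s| ≤ D.mass.real s := by
  have h1 : |∫ y in s, D.slope y| ≤
      (volume.withDensity (fun y => ENNReal.ofReal |D.slope y|)).real s := by
    rw [measureReal_def, withDensity_apply _ hs, ← ofReal_integral_eq_lintegral_ofReal
      D.integrable_slope.abs.integrableOn (Eventually.of_forall fun _ => abs_nonneg _),
      ENNReal.toReal_ofReal (integral_nonneg fun _ => abs_nonneg _)]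
    exact abs_integral_le_integral_abs
  rw [mass, measureReal_add_apply]
  exact (abs_add_le _ _).trans (add_le_add h1 (D.abs_tsum_le hs))

end SBVData

/-- The intervals `(x, y]` decrease to the empty set as `y` decreases to `x`. -/
theorem tendsto_measureReal_Ioc (μ : Measure ℝ) [IsFiniteMeasure μ] (x : ℝ) :
    Tendsto (fun y => μ.real (Ioc x y)) (𝓝[>] x) (𝓝 0) := by
  have h : Tendsto (fun y => μ (Ioc x y)) (𝓝[>] x) (𝓝 (μ (⋂ y > x, Ioc x y))) := by
    refine tendsto_measure_biInter_gt (fun i _ => measurableSet_Ioc.nullMeasurableSet)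
      (fun i j _ hij => Ioc_subset_Ioc_right hij) ⟨x + 1, by simp, measure_ne_top _ _⟩
  have h0 : (⋂ y > x, Ioc x y) = ∅ := by
    ext z
    simp only [mem_iInter, mem_Ioc, mem_empty_iff_false, iff_false, not_forall]
    by_cases hz : x < z
    · exact ⟨(x + z) / 2, by simp only [gt_iff_lt]; linarith, by intro h; linarith [h.2]⟩
    · exact ⟨x + 1, by simp, fun h => hz h.1⟩
  rw [h0, measure_empty] at h
  exact (ENNReal.tendsto_toReal ENNReal.zero_ne_top).comp h

theorem tendsto_measureReal_Ico (μ : Measure ℝ) [IsFiniteMeasure μ] (x : ℝ) :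
    Tendsto (fun y => μ.real (Ico y x)) (𝓝[<] x) (𝓝 0) := by
  have h1 := tendsto_measureReal_Ioc (μ.map Neg.neg) (-x)
  have h2 : Tendsto (fun y : ℝ => -y) (𝓝[<] x) (𝓝[>] (-x)) :=
    tendsto_nhdsWithin_of_tendsto_nhds_of_eventually_within _
      ((continuous_neg.tendsto x).mono_left nhdsWithin_le_nhds)
      (by filter_upwards [self_mem_nhdsWithin] with y hy; simpa using hy)
  refine (h1.comp h2).congr fun y => ?_
  simp only [Function.comp, measureReal_def]
  rw [Measure.map_apply measurable_neg measurableSet_Ioc]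
  simp

theorem setIntegral_Iio_eq {f : ℝ → ℝ} (hf : Integrable f) :
    (fun x => ∫ y in Iio x, f y) = fun x =>
      (∫ y in Iic (0 : ℝ), f y) + ∫ y in (0 : ℝ)..x, f y := by
  ext x
  rw [← integral_Iic_eq_integral_Iio,
    ← intervalIntegral.integral_Iic_sub_Iic hf.integrableOn hf.integrableOn]
  ring

theorem continuous_setIntegral_Iio {f : ℝ → ℝ} (hf : Integrable f) :
    Continuous fun x => ∫ y in Iio x, f y := by
  rw [setIntegral_Iio_eq hf]
  exact continuous_const.add (intervalIntegral.continuous_primitive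
    (fun _ _ => hf.intervalIntegrable) 0)

/-! ### One-sided limits, measurability and derivative of the representatives -/

namespace SBVData

variable (D : SBVData)

theorem tendsto_L_left (x : ℝ) : Tendsto D.L (𝓝[<] x) (𝓝 (D.L x)) := by
  rw [tendsto_iff_norm_sub_tendsto_zero]
  refine squeeze_zero' (Eventually.of_forall fun _ => norm_nonneg _) ?_
    (tendsto_measureReal_Ico D.mass x)
  filter_upwards [self_mem_nhdsWithin] with y hy
  rw [norm_sub_rev, D.L_sub_L (le_of_lt hy)]
  exact D.abs_inc_le measurableSet_Ico

theorem tendsto_L_right (x : ℝ) : Tendsto D.L (𝓝[>] x) (𝓝 (D.R x)) := by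
  rw [tendsto_iff_norm_sub_tendsto_zero]
  refine squeeze_zero' (Eventually.of_forall fun _ => norm_nonneg _) ?_
    (tendsto_measureReal_Ioc D.mass x)
  filter_upwards [self_mem_nhdsWithin] with y hy
  rw [D.L_sub_R hy]
  exact (D.abs_inc_le measurableSet_Ioo).trans (measureReal_mono Ioo_subset_Ioc_self)

theorem jump_eq (x : ℝ) : D.jump x = D.R x - D.L x := by rw [D.R_eq]; ring

theorem L_eq_R_iff {x : ℝ} : D.L x = D.R x ↔ x ∉ D.jumps := by
  rw [D.R_eq, jumps]; simp

theorem measurable_L : Measurable D.L := by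
  -- For nonnegative atoms the sum over `Iio x` is monotone in `x`, hence measurable; the signed sum
  -- is a difference of two such functions.
  have hJ : ∀ f : ℝ → ℝ, (∀ y, 0 ≤ f y) → Summable f →
      Measurable fun x => ∑' y, (Iio x).indicator f y := by
    intro f hf hs
    refine Monotone.measurable fun x y hxy => ?_
    exact (hs.indicator _).tsum_le_tsum
      (fun z => indicator_le_indicator_of_subset (Iio_subset_Iio hxy) hf z) (hs.indicator _)
  have h1 := (continuous_setIntegral_Iio D.integrable_slope).measurable
  have h2 : (fun x => ∑' y, (Iio x).indicator D.jump y) = fun x =>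
      (∑' y, (Iio x).indicator (fun y => max (D.jump y) 0) y) -
        ∑' y, (Iio x).indicator (fun y => max (-D.jump y) 0) y := by
    ext x
    have hp : Summable fun y => max (D.jump y) 0 :=
      D.summable_jump.of_nonneg_of_le (fun _ => le_max_right _ _)
        (fun y => max_le (le_abs_self _) (abs_nonneg _))
    have hn : Summable fun y => max (-D.jump y) 0 :=
      D.summable_jump.of_nonneg_of_le (fun _ => le_max_right _ _)
        (fun y => max_le (neg_le_abs _) (abs_nonneg _))
    rw [← (hp.indicator _).tsum_sub (hn.indicator _)]
    congr 1
    ext y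
    by_cases hy : y ∈ Iio x
    · simp only [hy, indicator_of_mem]
      rcases le_total (D.jump y) 0 with h | h
      · rw [max_eq_right h, max_eq_left (by linarith)]; ring
      · rw [max_eq_left h, max_eq_right (by linarith)]; ring
    · simp [hy]
  have hp : Summable fun y => max (D.jump y) 0 :=
    D.summable_jump.of_nonneg_of_le (fun _ => le_max_right _ _)
      (fun y => max_le (le_abs_self _) (abs_nonneg _))
  have hn : Summable fun y => max (-D.jump y) 0 :=
    D.summable_jump.of_nonneg_of_le (fun _ => le_max_right _ _)
      (fun y => max_le (neg_le_abs _) (abs_nonneg _))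
  unfold L inc
  refine measurable_const.add (h1.add ?_)
  rw [h2]
  exact (hJ _ (fun _ => le_max_right _ _) hp).sub (hJ _ (fun _ => le_max_right _ _) hn)

/-- Every preimage is a countable set, together with the whole complement of `jumps` if it contains
`0`. -/
theorem measurable_jump : Measurable D.jump := by
  intro s _
  have h1 : (D.jump ⁻¹' s ∩ D.jumps).Countable := D.countable_jumps.mono inter_subset_right
  have h2 : D.jump ⁻¹' s = (D.jump ⁻¹' s ∩ D.jumps) ∪ (D.jumpsᶜ ∩ {_x | (0 : ℝ) ∈ s}) := by
    ext x
    by_cases hx : D.jump x = 0 <;> simp [jumps, hx]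
  rw [h2]
  exact h1.measurableSet.union
    (D.countable_jumps.measurableSet.compl.inter (MeasurableSet.const _))

theorem abs_L_le (x : ℝ) : |D.L x| ≤ |D.base| + D.mass.real univ :=
  (abs_add_le _ _).trans (add_le_add le_rfl
    ((D.abs_inc_le measurableSet_Iio).trans (measureReal_mono (subset_univ _))))

theorem atoms_mutuallySingular : D.atoms ⟂ₘ volume := by
  refine ⟨D.jumpsᶜ, D.countable_jumps.measurableSet.compl, ?_, ?_⟩
  · rw [D.atoms_apply D.countable_jumps.measurableSet.compl]
    have : ∀ y, (D.jumpsᶜ).indicator (fun y => |D.jump y|) y = 0 := by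
      intro y
      by_cases hy : D.jump y = 0 <;> simp [jumps, indicator, hy]
    simp [this]
  · rw [compl_compl]; exact D.countable_jumps.measure_zero _

/-- The absolutely continuous part is Lebesgue's differentiation theorem. The atoms form a measure
singular to `volume`, whose density on shrinking balls is zero almost everywhere; the increments of
the jump part are bounded by the mass of such balls, so they are `o(|y - x|)`. -/
theorem ae_hasDerivAt : ∀ᵐ x, HasDerivAt D.L (D.slope x) x := by
  have h1 := LocallyIntegrable.ae_hasDerivAt_integral D.integrable_slope.locallyIntegrable
  have h2 := Besicovitch.ae_tendsto_rnDeriv D.atoms (volume : Measure ℝ)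
  have h3 := D.atoms_mutuallySingular.rnDeriv_ae_eq_zero
  filter_upwards [h1, h2, h3] with x hx1 hx2 hx3
  rw [hx3] at hx2
  have d1 : HasDerivAt (fun x => ∫ y in Iio x, D.slope y) (D.slope x) x := by
    rw [setIntegral_Iio_eq D.integrable_slope]; exact (hx1 0).const_add _
  have d2 : HasDerivAt (fun x => ∑' y, (Iio x).indicator D.jump y) 0 x := by
    rw [hasDerivAt_iff_isLittleO]
    simp only [smul_zero, sub_zero]
    have hb : ∀ y, |(∑' z, (Iio y).indicator D.jump z) - ∑' z, (Iio x).indicator D.jump z| ≤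
        D.atoms.real (Metric.closedBall x |y - x|) := by
      have key : ∀ p q, p ≤ q → (∑' z, (Iio q).indicator D.jump z) -
          ∑' z, (Iio p).indicator D.jump z = ∑' z, (Ico p q).indicator D.jump z := by
        intro p q hpq
        rw [← Iio_union_Ico_eq_Iio hpq, indicator_union_of_disjoint
          (by rw [Set.disjoint_left]; intro z hz hz'; exact absurd hz'.1 (not_le.2 hz)),
          (D.summable_indicator _).tsum_add (D.summable_indicator _)]
        ring
      intro y
      rcases le_total x y with h | h
      · rw [key x y h]
        refine (D.abs_tsum_le measurableSet_Ico).trans (measureReal_mono ?_)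
        intro z hz
        rw [Metric.mem_closedBall, Real.dist_eq, abs_of_nonneg (by linarith [hz.1]),
          abs_of_nonneg (by linarith)]
        linarith [hz.2]
      · rw [abs_sub_comm, key y x h]
        refine (D.abs_tsum_le measurableSet_Ico).trans (measureReal_mono ?_)
        intro z hz
        rw [Metric.mem_closedBall, Real.dist_eq, abs_of_nonpos (by linarith [hz.2]),
          abs_of_nonpos (by linarith)]
        linarith [hz.1]
    rw [Asymptotics.isLittleO_iff]
    intro c hc
    have hev : ∀ᶠ r in 𝓝[>] (0 : ℝ), D.atoms.real (Metric.closedBall x r) ≤ c * r := by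
      -- A ball of radius `r` has length `2 * r`, hence the factor `1 / 2`.
      have := hx2.eventually_lt_const (u := ENNReal.ofReal (c / 2))
        (by simpa using hc)
      filter_upwards [this, self_mem_nhdsWithin] with r hr hr0
      have hr0' : 0 < r := hr0
      rw [Real.volume_closedBall] at hr
      rw [ENNReal.div_lt_iff (by left; simpa using hr0') (by left; exact ENNReal.ofReal_ne_top),
        ← ENNReal.ofReal_mul (by positivity)] at hr
      rw [measureReal_def]
      refine ENNReal.toReal_le_of_le_ofReal (by positivity) (hr.le.trans ?_)
      apply le_of_eq; congr 1; ring
    rw [eventually_nhdsWithin_iff] at hev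
    have ht : Tendsto (fun y => |y - x|) (𝓝 x) (𝓝 0) := by
      have : Continuous fun y : ℝ => |y - x| := by fun_prop
      simpa using this.tendsto x
    filter_upwards [ht.eventually hev] with y hy
    rw [Real.norm_eq_abs, Real.norm_eq_abs]
    by_cases hyx : y = x
    · subst hyx; simp
    · exact (hb y).trans (hy (by simpa using sub_ne_zero.2 hyx))
  have := (d1.add d2).const_add D.base
  rw [add_zero] at this
  exact this

end SBVData

/-! ### Functions and their data -/

/-- Integration by parts by Fubini: in the integral of `(∫_{y<x} f(y) dy) η'(x)` the inner
integration over `x > y` gives `-η(y)`. The atoms are treated in the same way with a sum in place of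
`dy`. -/
theorem SBVData.hasSBVDeriv (D : SBVData) (a b : ℝ) : HasSBVDeriv a b D.L D.slope D.jump := by
  refine ⟨D.integrable_slope.integrableOn, D.summable_jump, fun η hη hc hs => ?_⟩
  have hd0 : ∀ x, x ∉ Ioo a b → deriv η x = 0 := fun x hx => by
    by_contra h
    exact hx (hs (support_deriv_subset h))
  have hη0 : ∀ x, x ∉ Ioo a b → η x = 0 := fun x hx => by
    by_contra h
    exact hx (hs (subset_tsupport _ h))
  rw [setIntegral_eq_integral_of_forall_compl_eq_zero (by intro x hx; rw [hd0 x hx, mul_zero]),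
    setIntegral_eq_integral_of_forall_compl_eq_zero (by intro x hx; rw [hη0 x hx, mul_zero])]
  have hη1 : ContDiff ℝ 1 η := hη.of_le (by simp)
  have hdc : Continuous (deriv η) := hη1.continuous_deriv le_rfl
  have hdi : Integrable (deriv η) := hdc.integrable_of_hasCompactSupport hc.deriv
  have hIoi : ∀ y, ∫ x in Ioi y, deriv η x = -η y := fun y =>
    HasCompactSupport.integral_Ioi_deriv_eq hη1 hc y
  have hbase : ∫ x, deriv η x = 0 := by
    have := integral_eq_zero_of_hasDerivAt_of_integrable (f := η) (f' := deriv η)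
      (fun x => (hη1.differentiable one_ne_zero x).hasDerivAt) hdi
      (hη1.continuous.integrable_of_hasCompactSupport hc)
    exact this
  -- the absolutely continuous part
  have hprod : Integrable (fun p : ℝ × ℝ => {p : ℝ × ℝ | p.2 < p.1}.indicator
      (fun p => deriv η p.1 * D.slope p.2) p) (volume.prod volume) :=
    (hdi.mul_prod D.integrable_slope).indicator (measurableSet_lt measurable_snd measurable_fst)
  have e1 : ∀ x, (∫ y in Iio x, D.slope y) * deriv η x =
      ∫ y, {p : ℝ × ℝ | p.2 < p.1}.indicator (fun p => deriv η p.1 * D.slope p.2) (x, y) := by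
    intro x
    rw [mul_comm, ← integral_const_mul, ← integral_indicator measurableSet_Iio]
    congr 1
  have e2 : ∀ y, ∫ x, {p : ℝ × ℝ | p.2 < p.1}.indicator
      (fun p => deriv η p.1 * D.slope p.2) (x, y) = -(D.slope y * η y) := by
    intro y
    have : ∀ x, {p : ℝ × ℝ | p.2 < p.1}.indicator (fun p => deriv η p.1 * D.slope p.2) (x, y) =
        (Ioi y).indicator (fun x => deriv η x * D.slope y) x := fun x => rfl
    simp_rw [this]
    rw [integral_indicator measurableSet_Ioi, integral_mul_const, hIoi]
    ring
  have i1 : Integrable fun x => (∫ y in Iio x, D.slope y) * deriv η x := by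
    simp_rw [e1]; exact hprod.integral_prod_left
  have s1 : ∫ x, (∫ y in Iio x, D.slope y) * deriv η x = -∫ y, D.slope y * η y := by
    simp_rw [e1]
    rw [integral_integral_swap hprod]
    simp_rw [e2]
    rw [integral_neg]
  -- the atomic part
  have hcount : Countable D.jumps := D.countable_jumps.to_subtype
  -- The sum is restricted to the countable set `jumps`, where it may be exchanged with the
  -- integral.
  let F : D.jumps → ℝ → ℝ := fun y x => D.jump y * (Ioi (y : ℝ)).indicator (deriv η) x
  have hF : ∀ y, Integrable (F y) := fun y =>
    (hdi.indicator measurableSet_Ioi).const_mul _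
  have hFs : Summable fun y => ∫ x, ‖F y x‖ := by
    have : Summable fun y : D.jumps => |D.jump y| * ∫ x, ‖deriv η x‖ :=
      (D.summable_jump.subtype _).mul_right _
    refine this.of_nonneg_of_le (fun y => integral_nonneg fun _ => norm_nonneg _) fun y => ?_
    rw [← integral_const_mul]
    refine integral_mono (hF y).norm (hdi.norm.const_mul _) fun x => ?_
    simp only [F, norm_mul, Real.norm_eq_abs]
    refine mul_le_mul_of_nonneg_left ?_ (abs_nonneg _)
    by_cases hx : x ∈ Ioi (y : ℝ) <;> simp [hx]
  have e3 : ∀ x, (∑' y, (Iio x).indicator D.jump y) * deriv η x = ∑' y, F y x := by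
    intro x
    rw [← tsum_mul_right, ← tsum_subtype_eq_of_support_subset (s := D.jumps)]
    · congr 1
      ext y
      by_cases hy : (y : ℝ) < x <;> simp [F, hy, indicator]
    · intro y hy
      simp only [jumps, mem_ofPred_eq]
      intro h
      apply hy
      simp [indicator, h]
  have i3 : Integrable fun x => (∑' y, (Iio x).indicator D.jump y) * deriv η x := by
    have hb : ∀ x, ‖∑' y, (Iio x).indicator D.jump y‖ ≤ D.atoms.real univ := fun x =>
      (D.abs_tsum_le measurableSet_Iio).trans (measureReal_mono (subset_univ _))
    refine hdi.bdd_mul (c := D.atoms.real univ) ?_ (Eventually.of_forall hb)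
    have : (fun x => ∑' y, (Iio x).indicator D.jump y) =
        fun x => D.L x - D.base - ∫ y in Iio x, D.slope y := by
      ext x; simp [SBVData.L, SBVData.inc]
    rw [this]
    exact (D.measurable_L.sub_const _).aestronglyMeasurable.sub
      (continuous_setIntegral_Iio D.integrable_slope).aestronglyMeasurable
  have s3 : ∫ x, (∑' y, (Iio x).indicator D.jump y) * deriv η x = -∑' y, D.jump y * η y := by
    simp_rw [e3]
    rw [← integral_tsum_of_summable_integral_norm hF hFs]
    have : ∀ y : D.jumps, ∫ x, F y x = -(D.jump y * η y) := by
      intro y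
      simp only [F]
      rw [integral_const_mul, integral_indicator measurableSet_Ioi, hIoi]; ring
    simp_rw [this]
    rw [tsum_neg, neg_inj]
    refine tsum_subtype_eq_of_support_subset (f := fun y => D.jump y * η y) ?_
    intro y hy h
    exact hy (by simp [h])
  have : ∀ x, D.L x * deriv η x = D.base * deriv η x + ((∫ y in Iio x, D.slope y) * deriv η x +
      (∑' y, (Iio x).indicator D.jump y) * deriv η x) := by
    intro x; simp only [SBVData.L, SBVData.inc]; ring
  simp_rw [this]
  have i13 : Integrable fun x => (∫ y in Iio x, D.slope y) * deriv η x +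
      (∑' y, (Iio x).indicator D.jump y) * deriv η x := i1.add i3
  rw [integral_add (hdi.const_mul _) i13, integral_add i1 i3, integral_const_mul, hbase,
    s1, s3]
  ring

/-- A function with vanishing distributional derivative on an interval is constant. -/
theorem ae_eq_const_of_integral_mul_deriv_eq_zero {a b : ℝ} {f : ℝ → ℝ}
    (hf : IntegrableOn f (Ioo a b))
    (h : ∀ η : ℝ → ℝ, ContDiff ℝ ∞ η → HasCompactSupport η → tsupport η ⊆ Ioo a b →
      ∫ x in Ioo a b, f x * deriv η x = 0) :
    ∃ k, ∀ᵐ x, x ∈ Ioo a b → f x = k := by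
  rcases le_or_gt b a with hab | hab
  · exact ⟨0, Eventually.of_forall fun x hx => by simp [Ioo_eq_empty (not_lt.2 hab)] at hx⟩
  -- A bump of integral one supported inside `(a, b)`; the constant is the mean of `f` with this
  -- weight.
  let ψb : ContDiffBump ((a + b) / 2) := ⟨(b - a) / 8, (b - a) / 4, by linarith, by linarith⟩
  let ψ₀ : ℝ → ℝ := ψb.normed volume
  have h0c : ContDiff ℝ ∞ ψ₀ := ψb.contDiff_normed
  have h0s : HasCompactSupport ψ₀ := ψb.hasCompactSupport_normed
  have h0t : tsupport ψ₀ ⊆ Ioo a b := by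
    rw [ψb.tsupport_normed_eq, Real.closedBall_eq_Icc]
    intro x hx
    simp only [ψb, mem_Icc] at hx
    exact ⟨by linarith [hx.1], by linarith [hx.2]⟩
  have h0i : ∫ x, ψ₀ x = 1 := ψb.integral_normed
  refine ⟨∫ x in Ioo a b, f x * ψ₀ x, ?_⟩
  set k := ∫ x in Ioo a b, f x * ψ₀ x with hk
  have key : ∀ᵐ x, x ∈ Ioo a b → f x - k = 0 := by
    refine isOpen_Ioo.ae_eq_zero_of_integral_contDiff_smul_eq_zero
      ((hf.sub (integrableOn_const (by simp))).locallyIntegrableOn) fun ψ hψ hψs hψt => ?_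
    have hψ0 : ∀ x, x ∉ Ioo a b → ψ x = 0 := fun x hx => by
      by_contra h
      exact hx (hψt (subset_tsupport _ h))
    have hψi : Integrable ψ := hψ.continuous.integrable_of_hasCompactSupport hψs
    have h0i' : Integrable ψ₀ := h0c.continuous.integrable_of_hasCompactSupport h0s
    let m := ∫ x, ψ x
    -- Subtracting the right multiple of `ψ₀` makes the integral zero, so that the primitive of `q`
    -- has compact support and is an admissible test function.
    let q : ℝ → ℝ := fun x => ψ x - m * ψ₀ x
    have hq : ContDiff ℝ ∞ q := hψ.sub (contDiff_const.mul h0c)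
    have hqi : ∫ x, q x = 0 := by
      simp only [q]
      rw [integral_sub hψi (h0i'.const_mul _), integral_const_mul, h0i]; simp [m]
    let η : ℝ → ℝ := fun x => ∫ y in a..x, q y
    have hder : deriv η = q := by
      ext x
      exact (intervalIntegral.integral_hasDerivAt_right
        (hq.continuous.intervalIntegrable _ _)
        hq.continuous.stronglyMeasurable.stronglyMeasurableAtFilter hq.continuous.continuousAt).deriv
    have hηd : Differentiable ℝ η := fun x => (intervalIntegral.integral_hasDerivAt_right
        (hq.continuous.intervalIntegrable _ _)
        hq.continuous.stronglyMeasurable.stronglyMeasurableAtFilter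
        hq.continuous.continuousAt).differentiableAt
    have hηc : ContDiff ℝ ∞ η := by
      rw [contDiff_infty_iff_deriv, hder]; exact ⟨hηd, hq⟩
    -- the support of `q`
    let K : Set ℝ := insert ((a + b) / 2) (tsupport ψ ∪ tsupport ψ₀)
    have hK : IsCompact K := (hψs.isCompact.union h0s.isCompact).insert _
    have hKs : K ⊆ Ioo a b :=
      insert_subset ⟨by linarith, by linarith⟩ (union_subset hψt h0t)
    -- The midpoint was put into `K` only for this: `sInf K` and `sSup K` then belong to `K`.
    have hKn : K.Nonempty := ⟨_, mem_insert _ _⟩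
    have hp := hKs (hK.sInf_mem hKn)
    have hq' := hKs (hK.sSup_mem hKn)
    have hqK : ∀ x, x ∉ K → q x = 0 := by
      intro x hx
      have h1 : ψ x = 0 := by
        by_contra h; exact hx (mem_insert_of_mem _ (Or.inl (subset_tsupport _ h)))
      have h2 : ψ₀ x = 0 := by
        by_contra h; exact hx (mem_insert_of_mem _ (Or.inr (subset_tsupport _ h)))
      simp [q, h1, h2]
    have hη0 : ∀ x, x ∉ Icc (sInf K) (sSup K) → η x = 0 := by
      intro x hx
      rw [mem_Icc, not_and_or, not_le, not_le] at hx
      rcases hx with hx | hx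
      · refine intervalIntegral.integral_zero_ae (Eventually.of_forall fun y hy => hqK y fun hyK => ?_)
        have h1 := csInf_le hK.bddBelow hyK
        have h2 := hy.2
        rcases max_choice a x with h | h <;> rw [h] at h2 <;> linarith [hp.1]
      · have : Function.support q ⊆ Ioc a x := by
          intro y hy
          have hyK : y ∈ K := by by_contra h; exact hy (hqK y h)
          exact ⟨(hKs hyK).1, (le_csSup hK.bddAbove hyK).trans hx.le⟩
        simp only [η]
        rw [intervalIntegral.integral_eq_integral_of_support_subset this, hqi]
    have hηsub : tsupport η ⊆ Icc (sInf K) (sSup K) :=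
      closure_minimal (fun x hx => by by_contra h; exact hx (hη0 x h)) isClosed_Icc
    have hηs : HasCompactSupport η :=
      isCompact_Icc.of_isClosed_subset (isClosed_tsupport _) hηsub
    have := h η hηc hηs (hηsub.trans fun x hx => ⟨hp.1.trans_le hx.1, hx.2.trans_lt hq'.2⟩)
    rw [hder] at this
    have hb1 : IntegrableOn (fun x => f x * ψ x) (Ioo a b) := by
      obtain ⟨C, hC⟩ := hψ.continuous.bounded_above_of_compact_support hψs
      exact hf.mul_bdd (c := C) hψ.continuous.aestronglyMeasurable (Eventually.of_forall hC)
    have hb2 : IntegrableOn (fun x => f x * ψ₀ x) (Ioo a b) := by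
      obtain ⟨C, hC⟩ := h0c.continuous.bounded_above_of_compact_support h0s
      exact hf.mul_bdd (c := C) h0c.continuous.aestronglyMeasurable (Eventually.of_forall hC)
    have e : ∀ x, f x * q x = f x * ψ x - m * (f x * ψ₀ x) := fun x => by simp only [q]; ring
    simp_rw [e] at this
    rw [integral_sub hb1 (hb2.const_mul _), integral_const_mul, ← hk] at this
    rw [← setIntegral_eq_integral_of_forall_compl_eq_zero (s := Ioo a b)
      (by intro x hx; simp [hψ0 x hx])]
    have e' : ∀ x, ψ x • (f x - k) = f x * ψ x - k * ψ x := fun x => by simp only [smul_eq_mul]; ring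
    simp_rw [e']
    rw [integral_sub hb1 (hψi.integrableOn.const_mul _), integral_const_mul,
      setIntegral_eq_integral_of_forall_compl_eq_zero (f := ψ) hψ0]
    simp only [m] at this
    linarith
  filter_upwards [key] with x hx hxI
  linarith [hx hxI]

/-- The function with data `D` is a representative of `u` on `(a, b)`. -/
def IsRep (a b : ℝ) (u : ℝ → ℝ) (D : SBVData) : Prop := ∀ᵐ x, x ∈ Ioo a b → u x = D.L x

theorem SBVData.integrableOn_L (D : SBVData) (a b : ℝ) : IntegrableOn D.L (Ioo a b) :=
  Measure.integrableOn_of_bounded (by simp) D.measurable_L.aestronglyMeasurable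
    (Eventually.of_forall D.abs_L_le)

/-- The function with base `0` and the same slope and jumps has the same distributional derivative
on `(a, b)`. The difference is a constant, which becomes the base; atoms outside `(a, b)` only
contribute to that constant. -/
theorem exists_isRep_of_hasSBVDeriv {a b : ℝ} {u v c : ℝ → ℝ} (hu : IntegrableOn u (Ioo a b))
    (h : HasSBVDeriv a b u v c) :
    ∃ D : SBVData, IsRep a b u D ∧ ∀ᵐ x, x ∈ Ioo a b → v x = D.slope x := by
  obtain ⟨hv, hc, h⟩ := h
  have hv' : Integrable ((Ioo a b).indicator v) := (integrable_indicator_iff measurableSet_Ioo).2 hv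
  obtain ⟨v', hv'm, hvv'⟩ := hv'.1
  have hvae : ∀ᵐ x, x ∈ Ioo a b → v x = v' x := by
    filter_upwards [hvv'] with x hx hxI
    rw [← hx, indicator_of_mem hxI]
  let D₀ : SBVData := ⟨0, v', c, hv'm.measurable, hv'.congr hvv', hc⟩
  obtain ⟨k, hk⟩ := ae_eq_const_of_integral_mul_deriv_eq_zero (a := a) (b := b)
    (f := fun x => u x - D₀.L x) (hu.sub (D₀.integrableOn_L a b)) (by
      intro η hη hs ht
      have hdc : Continuous (deriv η) := (hη.of_le (by simp) : ContDiff ℝ 1 η).continuous_deriv le_rfl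
      obtain ⟨C, hC⟩ := hdc.bounded_above_of_compact_support hs.deriv
      have e : ∀ x, (u x - D₀.L x) * deriv η x = u x * deriv η x - D₀.L x * deriv η x :=
        fun x => by ring
      simp_rw [e]
      rw [integral_sub (hu.mul_bdd (c := C) hdc.aestronglyMeasurable (Eventually.of_forall hC))
        ((D₀.integrableOn_L a b).mul_bdd (c := C) hdc.aestronglyMeasurable (Eventually.of_forall hC)),
        h η hη hs ht, (D₀.hasSBVDeriv a b).2.2 η hη hs ht]
      have : ∫ x in Ioo a b, v x * η x = ∫ x in Ioo a b, D₀.slope x * η x := by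
        refine setIntegral_congr_ae measurableSet_Ioo ?_
        filter_upwards [hvae] with x hx hxI
        rw [hx hxI]
      rw [this]
      simp [D₀])
  refine ⟨⟨k, v', c, hv'm.measurable, hv'.congr hvv', hc⟩, ?_, hvae⟩
  filter_upwards [hk] with x hx hxI
  have := hx hxI
  simp only [SBVData.L, SBVData.inc, D₀] at this ⊢
  linarith

theorem IsSBV.exists_isRep {a b : ℝ} {u : ℝ → ℝ} (hu : IsSBV a b u) :
    ∃ D : SBVData, IsRep a b u D ∧ ∀ᵐ x, x ∈ Ioo a b → grad a b u x = D.slope x := by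
  have : HasSBVDeriv a b u (grad a b u) hu.2.choose_spec.choose := by
    rw [grad, dif_pos hu]; exact hu.2.choose_spec.choose_spec
  exact exists_isRep_of_hasSBVDeriv hu.1 this

/-! ### Traces, gradient, jump set and energy in terms of the data -/

namespace IsRep

variable {a b : ℝ} {u : ℝ → ℝ} {D : SBVData}

theorem isSBV (h : IsRep a b u D) : IsSBV a b u := by
  have hae : D.L =ᵐ[volume.restrict (Ioo a b)] u := by
    rw [EventuallyEq, ae_restrict_iff' measurableSet_Ioo]
    filter_upwards [h] with x hx hxI
    exact (hx hxI).symm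
  refine ⟨(D.integrableOn_L a b).congr hae, D.slope, D.jump, D.integrable_slope.integrableOn,
    D.summable_jump, fun η hη hs ht => ?_⟩
  rw [← (D.hasSBVDeriv a b).2.2 η hη hs ht]
  refine setIntegral_congr_ae measurableSet_Ioo ?_
  filter_upwards [h] with x hx hxI
  rw [hx hxI]

/-- Just to the left of `x` the values of `L` lie in a small closed ball around `L x`, and by
convexity so does their mean. -/
theorem leftTrace_eq (h : IsRep a b u D) {x : ℝ} (hx : x ∈ Ioo a b) : leftTrace u x = D.L x := by
  refine Tendsto.limUnder_eq ?_
  rw [Metric.tendsto_nhds]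
  intro ε hε
  have h1 := Metric.tendsto_nhds.1 (D.tendsto_L_left x) (ε / 2) (half_pos hε)
  rw [eventually_nhdsWithin_iff, Metric.eventually_nhds_iff] at h1
  obtain ⟨δ, hδ, h1⟩ := h1
  have hmem : Ioo 0 (min δ (x - a)) ∈ 𝓝[>] (0 : ℝ) :=
    Ioo_mem_nhdsGT (lt_min hδ (by linarith [hx.1]))
  filter_upwards [hmem] with r hr
  have hr1 : r < δ := hr.2.trans_le (min_le_left _ _)
  have hr2 : r < x - a := hr.2.trans_le (min_le_right _ _)
  have hr0 : 0 < r := hr.1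
  have hsub : Ioo (x - r) x ⊆ Ioo a b := fun y hy => ⟨by linarith [hy.1], hy.2.trans hx.2⟩
  have he : ⨍ y in Ioo (x - r) x, u y = ⨍ y in Ioo (x - r) x, D.L y := by
    refine setAverage_congr_fun measurableSet_Ioo ?_
    filter_upwards [h] with y hy hyI
    exact hy (hsub hyI)
  rw [he]
  have hmem := (convex_closedBall (D.L x) (ε / 2)).set_average_mem Metric.isClosed_closedBall
    (μ := volume) (t := Ioo (x - r) x) (f := D.L) (by simp [hr0]) (by simp)
    (by
      rw [ae_restrict_iff' measurableSet_Ioo]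
      refine Eventually.of_forall fun y hy => ?_
      rw [Metric.mem_closedBall]
      refine (h1 ?_ hy.2).le
      rw [Real.dist_eq, abs_lt]; constructor <;> linarith [hy.1, hy.2])
    (D.integrableOn_L _ _)
  rw [Metric.mem_closedBall] at hmem
  linarith

theorem rightTrace_eq (h : IsRep a b u D) {x : ℝ} (hx : x ∈ Ioo a b) :
    rightTrace u x = D.R x := by
  refine Tendsto.limUnder_eq ?_
  rw [Metric.tendsto_nhds]
  intro ε hε
  have h1 := Metric.tendsto_nhds.1 (D.tendsto_L_right x) (ε / 2) (half_pos hε)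
  rw [eventually_nhdsWithin_iff, Metric.eventually_nhds_iff] at h1
  obtain ⟨δ, hδ, h1⟩ := h1
  have hmem : Ioo 0 (min δ (b - x)) ∈ 𝓝[>] (0 : ℝ) :=
    Ioo_mem_nhdsGT (lt_min hδ (by linarith [hx.2]))
  filter_upwards [hmem] with r hr
  have hr1 : r < δ := hr.2.trans_le (min_le_left _ _)
  have hr2 : r < b - x := hr.2.trans_le (min_le_right _ _)
  have hr0 : 0 < r := hr.1
  have hsub : Ioo x (x + r) ⊆ Ioo a b := fun y hy => ⟨hx.1.trans hy.1, by linarith [hy.2]⟩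
  have he : ⨍ y in Ioo x (x + r), u y = ⨍ y in Ioo x (x + r), D.L y := by
    refine setAverage_congr_fun measurableSet_Ioo ?_
    filter_upwards [h] with y hy hyI
    exact hy (hsub hyI)
  rw [he]
  have hmem := (convex_closedBall (D.R x) (ε / 2)).set_average_mem Metric.isClosed_closedBall
    (μ := volume) (t := Ioo x (x + r)) (f := D.L) (by simp [hr0]) (by simp)
    (by
      rw [ae_restrict_iff' measurableSet_Ioo]
      refine Eventually.of_forall fun y hy => ?_
      rw [Metric.mem_closedBall]
      refine (h1 ?_ hy.1).le
      rw [Real.dist_eq, abs_lt]; constructor <;> linarith [hy.1, hy.2])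
    (D.integrableOn_L _ _)
  rw [Metric.mem_closedBall] at hmem
  linarith

/-- `grad` is chosen along with data `E` that may differ from `D`. On `(a, b)` both functions `L`
are the left trace of `u`, hence equal, and so are their derivatives almost everywhere. -/
theorem grad_eq (h : IsRep a b u D) : ∀ᵐ x, x ∈ Ioo a b → grad a b u x = D.slope x := by
  obtain ⟨E, hE, hgrad⟩ := h.isSBV.exists_isRep
  have hL : ∀ x ∈ Ioo a b, D.L x = E.L x := fun x hx => by
    rw [← h.leftTrace_eq hx, hE.leftTrace_eq hx]
  filter_upwards [hgrad, D.ae_hasDerivAt, E.ae_hasDerivAt] with x h1 h2 h3 hx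
  rw [h1 hx]
  refine h3.unique (h2.congr_of_eventuallyEq ?_)
  filter_upwards [isOpen_Ioo.mem_nhds hx] with y hy
  exact (hL y hy).symm

theorem jumpSet_eq (h : IsRep a b u D) : jumpSet a b u = D.jumps ∩ Ioo a b := by
  ext x
  constructor
  · rintro ⟨hx, hne⟩
    rw [h.leftTrace_eq hx, h.rightTrace_eq hx, Ne, D.L_eq_R_iff, not_not] at hne
    exact ⟨hne, hx⟩
  · rintro ⟨hj, hx⟩
    refine ⟨hx, ?_⟩
    rw [h.leftTrace_eq hx, h.rightTrace_eq hx, Ne, D.L_eq_R_iff, not_not]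
    exact hj

theorem energy_eq (h : IsRep a b u D) (α β : ℝ) (g : ℝ → ℝ) :
    energy a b α β g u = (∫⁻ x in Ioo a b, ENNReal.ofReal (D.slope x ^ 2))
    + ENNReal.ofReal β * (∫⁻ x in Ioo a b, ENNReal.ofReal ((D.L x - g x) ^ 2))
    + ENNReal.ofReal α * ((D.jumps ∩ Ioo a b).encard : ℝ≥0∞) := by
  rw [energy, h.jumpSet_eq]
  congr 2
  · refine setLIntegral_congr_fun_ae measurableSet_Ioo ?_
    filter_upwards [h.grad_eq] with x hx hxI
    rw [hx hxI]
  · congr 1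
    refine setLIntegral_congr_fun_ae measurableSet_Ioo ?_
    filter_upwards [h] with x hx hxI
    rw [hx hxI]

end IsRep

/-! ### The length of graphs -/

theorem dist_plane (p q : Plane) : dist p q = √((p 0 - q 0) ^ 2 + (p 1 - q 1) ^ 2) := by
  rw [EuclideanSpace.dist_eq]; simp [Real.dist_eq]

theorem plane_eta (p : Plane) : !₂[p 0, p 1] = p := by ext i; fin_cases i <;> simp

theorem measurable_plane_mk {X : Type*} [MeasurableSpace X] {f g : X → ℝ} (hf : Measurable f)
    (hg : Measurable g) : Measurable fun x => (!₂[f x, g x] : Plane) := by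
  have : Measurable (fun q : ℝ × ℝ => (!₂[q.1, q.2] : Plane)) := by fun_prop
  exact this.comp (hf.prodMk hg)

theorem abs_snd_sub_le_dist (p q : Plane) : |p 1 - q 1| ≤ dist p q := by
  rw [dist_plane]
  exact Real.abs_le_sqrt (by nlinarith [sq_nonneg (p 0 - q 0)])

instance : NullSingletonClass (μH[1] : Measure Plane) :=
  Measure.nullSingletonClass_hausdorff Plane one_pos

/-- If `f` is a monotone function that dominates the increments of a curve `γ`, then the length of
the image of `γ` is dominated by the Stieltjes measure of `f`. -/
theorem hausdorffMeasure_image_le_stieltjes (f : StieltjesFunction ℝ) (γ : ℝ → Plane)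
    (h : ∀ x y, x ≤ y → dist (γ x) (γ y) ≤ f y - f x) (s : Set ℝ) :
    μH[1] (γ '' s) ≤ f.measure s := by
  -- The outer measure of `f` is generated by the lengths of half-open intervals and is the largest
  -- one below them, so it suffices to compare on subsets of such intervals.
  have key : OuterMeasure.comap γ (μH[1] : Measure Plane).toOuterMeasure ≤ f.outer := by
    rw [StieltjesFunction.outer, OuterMeasure.le_ofFunction]
    intro s
    rw [StieltjesFunction.length_eq, OuterMeasure.comap_apply]
    refine le_iInf fun x => le_iInf fun y => le_iInf fun hs => ?_
    have hs' : s ⊆ Ioc x y := fun z hz => hs ⟨hz, notMem_botSet_of_lt (sub_one_lt z)⟩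
    -- Reparametrized by the values of `f`, the curve is 1-Lipschitz. The choice of preimages does
    -- not matter, as points with the same value of `f` have the same image under `γ`.
    have hlip : LipschitzOnWith 1 (γ ∘ Function.invFun f) (f '' s) := by
      refine LipschitzOnWith.of_dist_le_mul ?_
      have haux : ∀ p q, dist (γ (Function.invFun f (f p))) (γ (Function.invFun f (f q))) ≤
          |f p - f q| := by
        intro p q
        have hp : f (Function.invFun f (f p)) = f p := Function.invFun_eq ⟨p, rfl⟩
        have hq : f (Function.invFun f (f q)) = f q := Function.invFun_eq ⟨q, rfl⟩
        rw [← hp, ← hq]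
        simp only [hp, hq]
        rcases le_total (Function.invFun f (f p)) (Function.invFun f (f q)) with hle | hle
        · refine (h _ _ hle).trans ?_
          rw [hp, hq, abs_sub_comm]; exact le_abs_self _
        · rw [dist_comm]
          refine (h _ _ hle).trans ?_
          rw [hp, hq]; exact le_abs_self _
      rintro _ ⟨p, _, rfl⟩ _ ⟨q, _, rfl⟩
      simpa [Real.dist_eq] using haux p q
    have himg : γ '' s = (γ ∘ Function.invFun f) '' (f '' s) := by
      rw [image_image]
      refine image_congr fun p _ => ?_
      have hp : f (Function.invFun f (f p)) = f p := Function.invFun_eq ⟨p, rfl⟩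
      rw [← dist_eq_zero]
      refine le_antisymm ?_ dist_nonneg
      rcases le_total p (Function.invFun f (f p)) with hle | hle
      · exact (h _ _ hle).trans (by rw [hp, sub_self])
      · rw [dist_comm]; exact (h _ _ hle).trans (by rw [hp, sub_self])
    have h1 := hlip.hausdorffMeasure_image_le (d := 1) zero_le_one
    change μH[1] (γ '' s) ≤ _
    rw [himg]
    refine h1.trans ?_
    rw [hausdorffMeasure_real]
    simp only [ENNReal.coe_one, ENNReal.one_rpow, one_mul]
    calc volume (f '' s) ≤ volume (Icc (f x) (f y)) := by
          refine measure_mono ?_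
          rintro _ ⟨p, hp, rfl⟩
          exact ⟨f.mono (hs' hp).1.le, f.mono (hs' hp).2⟩
      _ = _ := Real.volume_Icc
  have h2 := key s
  rw [OuterMeasure.comap_apply] at h2
  refine le_trans h2 ?_
  rw [StieltjesFunction.measure]
  exact le_rfl

/-- Elementary estimates for the length of nearly linear graphs. -/
theorem sqrt_one_add_sq_sub_le (m n : ℝ) : |√(1 + m ^ 2) - √(1 + n ^ 2)| ≤ |m - n| := by
  have h : ∀ m n : ℝ, √(1 + m ^ 2) ≤ √(1 + n ^ 2) + |m - n| := by
    intro m n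
    rw [Real.sqrt_le_left (by positivity)]
    have h1 := Real.sq_sqrt (show 0 ≤ 1 + n ^ 2 by positivity)
    have h2 : |n| ≤ √(1 + n ^ 2) := Real.abs_le_sqrt (by linarith)
    have h3 : n * (m - n) ≤ √(1 + n ^ 2) * |m - n| := by
      calc n * (m - n) ≤ |n * (m - n)| := le_abs_self _
        _ = |n| * |m - n| := abs_mul _ _
        _ ≤ _ := mul_le_mul_of_nonneg_right h2 (abs_nonneg _)
    nlinarith [sq_abs (m - n)]
  rw [abs_le]
  constructor
  · have := h n m
    rw [abs_sub_comm] at this; linarith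
  · linarith [h m n]

theorem abs_sqrt_sub_le {x y m ε : ℝ} (h : |y - m * x| ≤ ε * |x|) :
    |(√(x ^ 2 + y ^ 2) - √(1 + m ^ 2) * |x|)| ≤ ε * |x| := by
  rcases eq_or_ne x 0 with rfl | hx
  · have : y = 0 := by simpa using h
    simp [this]
  · have hx' : 0 < |x| := abs_pos.2 hx
    have e1 : √(x ^ 2 + y ^ 2) = √(1 + (y / x) ^ 2) * |x| := by
      rw [← Real.sqrt_sq_eq_abs x, ← Real.sqrt_mul (by positivity)]
      congr 1; field_simp
    rw [e1, ← sub_mul, abs_mul, abs_abs]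
    refine mul_le_mul_of_nonneg_right ((sqrt_one_add_sq_sub_le _ _).trans ?_) hx'.le
    rw [show y / x - m = (y - m * x) / x by field_simp, abs_div, div_le_iff₀ hx']
    exact h

/-- The parametrization of the graph of a function. -/
def graphMap (f : ℝ → ℝ) (x : ℝ) : Plane := !₂[x, f x]

@[simp] theorem graphMap_zero (f : ℝ → ℝ) (x : ℝ) : graphMap f x 0 = x := by simp [graphMap]

@[simp] theorem graphMap_one (f : ℝ → ℝ) (x : ℝ) : graphMap f x 1 = f x := by simp [graphMap]

theorem graphMap_injective (f : ℝ → ℝ) : Function.Injective (graphMap f) := fun x y h => by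
  simpa using congrArg (fun p : Plane => p 0) h

theorem measurable_graphMap {f : ℝ → ℝ} (hf : Measurable f) : Measurable (graphMap f) :=
  measurable_plane_mk measurable_id hf

theorem mem_graphMap_image {f : ℝ → ℝ} {s : Set ℝ} {p : Plane} :
    p ∈ graphMap f '' s ↔ p 0 ∈ s ∧ p 1 = f (p 0) := by
  constructor
  · rintro ⟨x, hx, rfl⟩; simpa using hx
  · rintro ⟨h1, h2⟩
    exact ⟨p 0, h1, by rw [graphMap, ← h2, plane_eta]⟩

theorem measurableSet_graphMap_image {f : ℝ → ℝ} (hf : Measurable f) {s : Set ℝ}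
    (hs : MeasurableSet s) : MeasurableSet (graphMap f '' s) := by
  have h0 : Measurable fun p : Plane => p 0 := by fun_prop
  have h1 : Measurable fun p : Plane => p 1 := by fun_prop
  have : graphMap f '' s = {p | p 0 ∈ s} ∩ {p | p 1 = f (p 0)} := by
    ext p; exact mem_graphMap_image
  rw [this]
  exact (h0 hs).inter (measurableSet_eq_fun h1 (hf.comp h0))

/-- Over a set where `f` is `ε`-close to linear with slope `m`, the graph map stretches distances by
a factor between `√(1 + m²) - ε` and `√(1 + m²) + ε`. The upper bound is the Lipschitz estimate for
the graph map, the lower one that for the projection back to the axis. -/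
theorem hausdorffMeasure_graphMap_image_bounds {f : ℝ → ℝ} {s : Set ℝ} {m ε : ℝ}
    (hε0 : 0 ≤ ε) (hε : ε < 1)
    (h : ∀ x ∈ s, ∀ y ∈ s, |f x - f y - m * (x - y)| ≤ ε * |x - y|) :
    μH[1] (graphMap f '' s) ≤ ENNReal.ofReal (√(1 + m ^ 2) + ε) * volume s ∧
      ENNReal.ofReal (√(1 + m ^ 2) - ε) * volume s ≤ μH[1] (graphMap f '' s) := by
  have hd : ∀ x ∈ s, ∀ y ∈ s,
      |(dist (graphMap f x) (graphMap f y) - √(1 + m ^ 2) * |x - y|)| ≤ ε * |x - y| := by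
    intro x hx y hy
    rw [dist_plane]
    simpa using abs_sqrt_sub_le (h x hx y hy)
  have h1 : 1 ≤ √(1 + m ^ 2) := by
    rw [Real.one_le_sqrt]; nlinarith [sq_nonneg m]
  constructor
  · have hl : LipschitzOnWith (√(1 + m ^ 2) + ε).toNNReal (graphMap f) s := by
      refine LipschitzOnWith.of_dist_le_mul fun x hx y hy => ?_
      rw [Real.coe_toNNReal _ (by positivity), Real.dist_eq]
      have := (abs_le.1 (hd x hx y hy)).2
      nlinarith
    have := hl.hausdorffMeasure_image_le (d := 1) zero_le_one
    rw [hausdorffMeasure_real, ENNReal.rpow_one] at this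
    exact this
  · have hpos : 0 < √(1 + m ^ 2) - ε := by linarith
    have hl : LipschitzOnWith ((√(1 + m ^ 2) - ε)⁻¹).toNNReal (fun p : Plane => p 0)
        (graphMap f '' s) := by
      refine LipschitzOnWith.of_dist_le_mul ?_
      rintro _ ⟨x, hx, rfl⟩ _ ⟨y, hy, rfl⟩
      rw [Real.coe_toNNReal _ (by positivity), graphMap_zero, graphMap_zero, Real.dist_eq,
        inv_mul_eq_div, le_div_iff₀ hpos]
      have := (abs_le.1 (hd x hx y hy)).1
      nlinarith
    have := hl.hausdorffMeasure_image_le (d := 1) zero_le_one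
    rw [hausdorffMeasure_real, ENNReal.rpow_one, image_image] at this
    simp only [graphMap_zero, image_id'] at this
    calc ENNReal.ofReal (√(1 + m ^ 2) - ε) * volume s
        ≤ ENNReal.ofReal (√(1 + m ^ 2) - ε) *
          (ENNReal.ofReal ((√(1 + m ^ 2) - ε)⁻¹) * μH[1] (graphMap f '' s)) := by gcongr; exact this
      _ = μH[1] (graphMap f '' s) := by
          rw [← mul_assoc, ← ENNReal.ofReal_mul hpos.le, mul_inv_cancel₀ hpos.ne',
            ENNReal.ofReal_one, one_mul]

/-- The area formula for the graph of a function that is differentiable on a set. -/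
theorem hausdorffMeasure_graphMap_image_of_hasDerivAt {f f' : ℝ → ℝ} (hf : Measurable f)
    {s : Set ℝ} (hs : MeasurableSet s) (hsv : volume s ≠ ⊤)
    (h : ∀ x ∈ s, HasDerivAt f (f' x) x) :
    μH[1] (graphMap f '' s) = ∫⁻ x in s, ENNReal.ofReal √(1 + f' x ^ 2) := by
  -- The set is cut into countably many pieces on which `f` is `ε`-close to linear. One `ε` of the
  -- error is due to the length bounds, the other one to replacing the slope of the piece by `f'`.
  have main : ∀ ε : ℝ, 0 < ε → ε < 1 →
      μH[1] (graphMap f '' s) ≤ (∫⁻ x in s, ENNReal.ofReal √(1 + f' x ^ 2)) +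
        ENNReal.ofReal (2 * ε) * volume s ∧
      (∫⁻ x in s, ENNReal.ofReal √(1 + f' x ^ 2)) ≤ μH[1] (graphMap f '' s) +
        ENNReal.ofReal (2 * ε) * volume s := by
    intro ε hε0 hε1
    obtain ⟨t, A, htd, htm, hst, hA, -⟩ :=
      exists_partition_approximatesLinearOn_of_hasFDerivWithinAt f s
        (fun x => ContinuousLinearMap.toSpanSingleton ℝ (f' x))
        (fun x hx => ((h x hx).hasFDerivAt).hasFDerivWithinAt)
        (fun _ => ε.toNNReal) (fun _ => by simpa using hε0)
    have hAlin : ∀ n z, A n z = A n 1 * z := by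
      intro n z
      have : A n (z • (1 : ℝ)) = z • A n 1 := map_smul _ _ _
      simp only [smul_eq_mul, mul_one] at this
      rw [this, mul_comm]
    have hsm : ∀ n, MeasurableSet (s ∩ t n) := fun n => hs.inter (htm n)
    have hbd := fun n => hausdorffMeasure_graphMap_image_bounds (f := f) (s := s ∩ t n)
      (m := A n 1) hε0.le hε1 (by
        intro x hx y hy
        have := hA n x hx y hy
        rw [hAlin, Real.norm_eq_abs, Real.norm_eq_abs, Real.coe_toNNReal _ hε0.le] at this
        exact this)
    have hder : ∀ n, ∀ᵐ x ∂volume.restrict (s ∩ t n), |f' x - A n 1| ≤ ε := by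
      intro n
      have := (hA n).norm_fderiv_sub_le volume (hsm n)
        (fun x => ContinuousLinearMap.toSpanSingleton ℝ (f' x))
        (fun x hx => ((h x hx.1).hasFDerivAt).hasFDerivWithinAt)
      filter_upwards [this] with x hx
      have h1 := (ContinuousLinearMap.toSpanSingleton ℝ (f' x) - A n).le_opNorm 1
      have h2 : ‖ContinuousLinearMap.toSpanSingleton ℝ (f' x) - A n‖ ≤ ε := by
        have : (‖ContinuousLinearMap.toSpanSingleton ℝ (f' x) - A n‖₊ : ℝ) ≤ ε.toNNReal := hx
        rwa [Real.coe_toNNReal _ hε0.le] at this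
      simp only [sub_apply, ContinuousLinearMap.toSpanSingleton_apply,
        one_smul, norm_one, mul_one] at h1
      exact h1.trans h2
    have hs_eq : s = ⋃ n, s ∩ t n := by
      rw [← inter_iUnion]; exact (inter_eq_left.2 hst).symm
    have hd : Pairwise (Function.onFun Disjoint fun n => s ∩ t n) := fun i j hij =>
      (htd hij).mono inter_subset_right inter_subset_right
    have hH : μH[1] (graphMap f '' s) = ∑' n, μH[1] (graphMap f '' (s ∩ t n)) := by
      conv_lhs => rw [hs_eq, image_iUnion]
      refine measure_iUnion (fun i j hij => ?_) fun n => measurableSet_graphMap_image hf (hsm n)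
      exact (disjoint_image_iff (graphMap_injective f)).2 (hd hij)
    have hV : volume s = ∑' n, volume (s ∩ t n) := by
      conv_lhs => rw [hs_eq]
      exact measure_iUnion hd hsm
    have hI : (∫⁻ x in s, ENNReal.ofReal √(1 + f' x ^ 2)) =
        ∑' n, ∫⁻ x in s ∩ t n, ENNReal.ofReal √(1 + f' x ^ 2) := by
      conv_lhs => rw [hs_eq]
      exact lintegral_iUnion hsm hd _
    rw [hH, hI, hV, ← ENNReal.tsum_mul_left]
    constructor
    · rw [← ENNReal.tsum_add]
      refine ENNReal.tsum_le_tsum fun n => (hbd n).1.trans ?_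
      rw [← setLIntegral_const, ← setLIntegral_const, ← lintegral_add_right _ measurable_const]
      refine lintegral_mono_ae ?_
      filter_upwards [hder n] with x hx
      rw [← ENNReal.ofReal_add (by positivity) (by positivity)]
      refine ENNReal.ofReal_le_ofReal ?_
      have := (abs_le.1 ((sqrt_one_add_sq_sub_le (f' x) (A n 1)).trans hx)).1
      linarith
    · rw [← ENNReal.tsum_add]
      refine ENNReal.tsum_le_tsum fun n => le_trans ?_ (add_le_add_left (hbd n).2 _)
      rw [← setLIntegral_const, ← setLIntegral_const, ← lintegral_add_right _ measurable_const]
      refine lintegral_mono_ae ?_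
      filter_upwards [hder n] with x hx
      have h1 : 1 ≤ √(1 + (A n 1) ^ 2) := by
        rw [Real.one_le_sqrt]; nlinarith [sq_nonneg (A n 1)]
      rw [← ENNReal.ofReal_add (by linarith) (by positivity)]
      refine ENNReal.ofReal_le_ofReal ?_
      have := (abs_le.1 ((sqrt_one_add_sq_sub_le (f' x) (A n 1)).trans hx)).2
      linarith
  have hlim : Tendsto (fun ε : ℝ => ENNReal.ofReal (2 * ε) * volume s) (𝓝[>] 0) (𝓝 0) := by
    have h1 : Tendsto (fun ε : ℝ => ENNReal.ofReal (2 * ε)) (𝓝[>] 0) (𝓝 0) := by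
      have : Continuous fun ε : ℝ => ENNReal.ofReal (2 * ε) :=
        ENNReal.continuous_ofReal.comp (by fun_prop)
      simpa using (this.tendsto 0).mono_left nhdsWithin_le_nhds
    simpa using ENNReal.Tendsto.mul_const h1 (Or.inr hsv)
  have hev : ∀ᶠ ε in 𝓝[>] (0 : ℝ), 0 < ε ∧ ε < 1 := by
    filter_upwards [Ioo_mem_nhdsGT one_pos] with ε hε using hε
  refine le_antisymm ?_ ?_
  · have := hlim.const_add (∫⁻ x in s, ENNReal.ofReal √(1 + f' x ^ 2))
    rw [add_zero] at this
    refine ge_of_tendsto this ?_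
    filter_upwards [hev] with ε hε using (main ε hε.1 hε.2).1
  · have := hlim.const_add (μH[1] (graphMap f '' s))
    rw [add_zero] at this
    refine ge_of_tendsto this ?_
    filter_upwards [hev] with ε hε using (main ε hε.1 hε.2).2

/-! ### The length measure on the graph of an SBV function -/

namespace SBVData

variable (D : SBVData)

/-- The Stieltjes function of the measure `dx + |Du|`. -/
def arc : StieltjesFunction ℝ where
  toFun x := x + D.mass.real (Iic x)
  mono' x y h := add_le_add h (measureReal_mono (Iic_subset_Iic.2 h))
  right_continuous' x := by
    rw [continuousWithinAt_Ioi_iff_Ici.symm, ContinuousWithinAt]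
    have h1 := tendsto_measureReal_Ioc D.mass x
    have h2 : Tendsto (fun y : ℝ => y) (𝓝[>] x) (𝓝 x) := tendsto_id.mono_left nhdsWithin_le_nhds
    have h3 := h2.add (h1.const_add (D.mass.real (Iic x)))
    rw [add_zero] at h3
    refine h3.congr' ?_
    filter_upwards [self_mem_nhdsWithin] with y hy
    rw [← Iic_union_Ioc_eq_Iic (le_of_lt (mem_Ioi.1 hy)), measureReal_union _ measurableSet_Ioc]
    rw [Set.disjoint_left]; intro z hz hz'; exact absurd hz'.1 (not_lt.2 hz)

theorem arc_sub {x y : ℝ} (h : x ≤ y) : D.arc y - D.arc x = y - x + D.mass.real (Ioc x y) := by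
  change y + D.mass.real (Iic y) - (x + D.mass.real (Iic x)) = _
  rw [← Iic_union_Ioc_eq_Iic h, measureReal_union _ measurableSet_Ioc]
  · ring
  · rw [Set.disjoint_left]; intro z hz hz'; exact absurd hz'.1 (not_lt.2 hz)

theorem measure_arc : D.arc.measure = volume + D.mass := by
  refine Measure.ext_of_Ioc _ _ fun x y h => ?_
  rw [StieltjesFunction.measure_Ioc, D.arc_sub h.le, Measure.add_apply, Real.volume_Ioc,
    ENNReal.ofReal_add (by linarith) measureReal_nonneg, ofReal_measureReal]

theorem mass_eq_zero {s : Set ℝ} (hs : volume s = 0) (hj : Disjoint s D.jumps) :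
    D.mass s = 0 := by
  rw [mass, Measure.add_apply, withDensity_absolutelyContinuous _ _ hs, zero_add]
  refine measure_mono_null (subset_compl_iff_disjoint_right.2 hj) ?_
  rw [D.atoms_apply D.countable_jumps.measurableSet.compl]
  have : ∀ y, (D.jumpsᶜ).indicator (fun y => |D.jump y|) y = 0 := by
    intro y
    by_cases hy : D.jump y = 0 <;> simp [jumps, indicator, hy]
  simp [this]

/-- The jumps contribute countably many points. Elsewhere `L = R`, and the length of the graph of
`R` is at most the measure `dx + |Du|`, which has no Cantor part and so vanishes on null sets
without atoms. The function `R` is the one whose increments are measures of intervals `(x, y]`, as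
in a Stieltjes function. -/
theorem hausdorffMeasure_graphMap_image_null {s : Set ℝ} (hs : volume s = 0) :
    μH[1] (graphMap D.L '' s) = 0 := by
  have h1 : μH[1] (graphMap D.L '' (s ∩ D.jumps)) = 0 :=
    ((D.countable_jumps.mono inter_subset_right).image _).measure_zero _
  have h2 : μH[1] (graphMap D.L '' (s \ D.jumps)) = 0 := by
    have e : graphMap D.L '' (s \ D.jumps) = graphMap D.R '' (s \ D.jumps) :=
      image_congr fun x hx => by rw [graphMap, graphMap, D.L_eq_R_iff.2 hx.2]
    rw [e]
    have := hausdorffMeasure_image_le_stieltjes D.arc (graphMap D.R) (fun x y hxy => by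
      rw [D.arc_sub hxy, dist_plane]
      simp only [graphMap_zero, graphMap_one]
      refine (Real.sqrt_le_sqrt (y := (|x - y| + |D.R x - D.R y|) ^ 2) ?_).trans ?_
      · rw [← sq_abs (x - y), ← sq_abs (D.R x - D.R y)]
        nlinarith [abs_nonneg (x - y), abs_nonneg (D.R x - D.R y)]
      · rw [Real.sqrt_sq (by positivity)]
        refine add_le_add ?_ ?_
        · rw [abs_of_nonpos (by linarith)]; linarith
        · rw [abs_sub_comm, D.R_sub_R hxy]; exact D.abs_inc_le measurableSet_Ioc) (s \ D.jumps)
    refine le_antisymm (this.trans ?_) bot_le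
    rw [measure_arc, Measure.add_apply, measure_mono_null sdiff_subset hs,
      D.mass_eq_zero (measure_mono_null sdiff_subset hs) disjoint_sdiff_left, add_zero]
  rw [← inter_union_sdiff s D.jumps, image_union]
  exact measure_union_null h1 h2

/-- The length element of the graph. -/
def speed (x : ℝ) : ℝ≥0∞ := ENNReal.ofReal √(1 + D.slope x ^ 2)

theorem measurable_speed : Measurable D.speed := by
  unfold speed
  exact ENNReal.measurable_ofReal.comp
    (measurable_const.add (D.measurable_slope.pow_const 2)).sqrt

/-- The area formula applies where `L` is differentiable with derivative `slope`; the rest of the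
graph lies over a null set and has no length. -/
theorem hausdorffMeasure_graphMap_image {s : Set ℝ} (hs : MeasurableSet s) (hsv : volume s ≠ ⊤) :
    μH[1] (graphMap D.L '' s) = ∫⁻ x in s, D.speed x := by
  let t : Set ℝ := {x | DifferentiableAt ℝ D.L x} ∩ {x | deriv D.L x = D.slope x}
  have ht : MeasurableSet t := (measurableSet_of_differentiableAt ℝ D.L).inter
    (measurableSet_eq_fun (measurable_deriv _) D.measurable_slope)
  have ht0 : volume tᶜ = 0 := by
    filter_upwards [D.ae_hasDerivAt] with x hx
    exact ⟨hx.differentiableAt, hx.deriv⟩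
  have h1 : μH[1] (graphMap D.L '' s) = μH[1] (graphMap D.L '' (s ∩ t)) := by
    refine le_antisymm ?_ (measure_mono (image_mono inter_subset_left))
    have h0 := D.hausdorffMeasure_graphMap_image_null
      (measure_mono_null (fun x hx => hx.2 : s \ t ⊆ tᶜ) ht0)
    conv_lhs => rw [← inter_union_sdiff s t, image_union]
    refine (measure_union_le _ _).trans ?_
    rw [h0, add_zero]
  rw [h1, hausdorffMeasure_graphMap_image_of_hasDerivAt D.measurable_L (hs.inter ht)
    (ne_top_of_le_ne_top hsv (measure_mono inter_subset_left))
    (f' := D.slope) (fun x hx => by rw [← hx.2.2]; exact hx.2.1.hasDerivAt)]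
  refine setLIntegral_congr ?_
  refine ae_eq_set.2 ⟨?_, ?_⟩
  · rw [sdiff_eq_empty.2 inter_subset_left, measure_empty]
  · rw [sdiff_self_inter]
    exact measure_mono_null (fun x hx => hx.2 : s \ t ⊆ tᶜ) ht0

theorem restrict_graphMap_image (a b : ℝ) :
    (μH[1] : Measure Plane).restrict (graphMap D.L '' Ioo a b) =
      ((volume.restrict (Ioo a b)).withDensity D.speed).map (graphMap D.L) := by
  have hG := measurable_graphMap D.measurable_L
  refine Measure.ext fun s hs => ?_
  rw [Measure.restrict_apply hs, Measure.map_apply hG hs, withDensity_apply _ (hG hs),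
    Measure.restrict_restrict (hG hs)]
  have : s ∩ graphMap D.L '' Ioo a b = graphMap D.L '' (graphMap D.L ⁻¹' s ∩ Ioo a b) := by
    rw [image_preimage_inter]
  rw [this, D.hausdorffMeasure_graphMap_image ((hG hs).inter measurableSet_Ioo)
    (ne_top_of_le_ne_top (by simp) (measure_mono inter_subset_right))]

/-- The extended graph over `(a, b)`. -/
def ext (a b : ℝ) : Set Plane := {p | p 0 ∈ Ioo a b ∧ p 1 ∈ uIcc (D.L (p 0)) (D.R (p 0))}

end SBVData

/-- The vertical line over `x`. -/
def vert (x t : ℝ) : Plane := !₂[x, t]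

@[simp] theorem vert_zero (x t : ℝ) : vert x t 0 = x := by simp [vert]

@[simp] theorem vert_one (x t : ℝ) : vert x t 1 = t := by simp [vert]

theorem isometry_vert (x : ℝ) : Isometry (vert x) := by
  refine Isometry.of_dist_eq fun s t => ?_
  rw [dist_plane]
  simp [Real.dist_eq, Real.sqrt_sq_eq_abs]

theorem measurable_vert (x : ℝ) : Measurable (vert x) := (isometry_vert x).continuous.measurable

theorem mem_vert_image {x : ℝ} {s : Set ℝ} {p : Plane} : p ∈ vert x '' s ↔ p 0 = x ∧ p 1 ∈ s := by
  constructor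
  · rintro ⟨t, ht, rfl⟩; simpa using ht
  · rintro ⟨h1, h2⟩
    exact ⟨p 1, h2, by rw [vert, ← h1, plane_eta]⟩

theorem restrict_vert_image (x : ℝ) {s : Set ℝ} (hs : MeasurableSet s) :
    (μH[1] : Measure Plane).restrict (vert x '' s) = (volume.restrict s).map (vert x) := by
  have h := (isometry_vert x).map_hausdorffMeasure (d := 1) (Or.inl zero_le_one)
  rw [hausdorffMeasure_real] at h
  have hemb := (isometry_vert x).isClosedEmbedding.measurableEmbedding
  rw [show vert x '' s = vert x '' s ∩ range (vert x) from
    (inter_eq_left.2 (image_subset_range _ _)).symm,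
    ← Measure.restrict_restrict (hemb.measurableSet_image.2 hs), ← h, hemb.restrict_map,
    preimage_image_eq _ (isometry_vert x).injective]

namespace SBVData

variable (D : SBVData)

theorem ext_eq_union (a b : ℝ) : D.ext a b = graphMap D.L '' (Ioo a b \ D.jumps) ∪
    ⋃ x : ↥(D.jumps ∩ Ioo a b), vert x '' uIcc (D.L x) (D.R x) := by
  ext p
  simp only [mem_union, mem_iUnion, mem_graphMap_image, mem_vert_image, ext, mem_ofPred_eq]
  constructor
  · rintro ⟨h1, h2⟩
    by_cases hj : p 0 ∈ D.jumps
    · exact Or.inr ⟨⟨p 0, hj, h1⟩, rfl, h2⟩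
    · rw [← D.L_eq_R_iff.2 hj, uIcc_self] at h2
      exact Or.inl ⟨⟨h1, hj⟩, h2⟩
  · rintro (⟨⟨h1, hj⟩, h2⟩ | ⟨⟨x, hx⟩, h1, h2⟩)
    · exact ⟨h1, by rw [h2]; exact left_mem_uIcc⟩
    · simp only at h1 h2
      rw [h1]; exact ⟨hx.2, h2⟩

theorem measurableSet_ext (a b : ℝ) : MeasurableSet (D.ext a b) := by
  have : Countable ↥(D.jumps ∩ Ioo a b) := (D.countable_jumps.mono inter_subset_left).to_subtype
  rw [ext_eq_union]
  exact (measurableSet_graphMap_image D.measurable_L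
    (measurableSet_Ioo.diff D.countable_jumps.measurableSet)).union
    (MeasurableSet.iUnion fun x => (isometry_vert x).isClosedEmbedding.measurableEmbedding
      |>.measurableSet_image.2 measurableSet_uIcc)

/-- The structure of the length measure on an extended graph. -/
theorem restrict_ext (a b : ℝ) : (μH[1] : Measure Plane).restrict (D.ext a b) =
    ((volume.restrict (Ioo a b)).withDensity D.speed).map (graphMap D.L) +
      Measure.sum fun x : ↥(D.jumps ∩ Ioo a b) =>
        (volume.restrict (uIcc (D.L x) (D.R x))).map (vert x) := by
  have : Countable ↥(D.jumps ∩ Ioo a b) := (D.countable_jumps.mono inter_subset_left).to_subtype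
  have hm : ∀ x : ↥(D.jumps ∩ Ioo a b), MeasurableSet (vert x '' uIcc (D.L x) (D.R x)) :=
    fun x => (isometry_vert x).isClosedEmbedding.measurableEmbedding
      |>.measurableSet_image.2 measurableSet_uIcc
  rw [ext_eq_union, Measure.restrict_union _ (MeasurableSet.iUnion hm),
    Measure.restrict_iUnion _ hm]
  · congr 1
    · rw [← D.restrict_graphMap_image]
      -- Putting back the points of the graph of `L` over the jumps adds a countable set only.
      refine Measure.restrict_congr_set ?_
      refine (ae_eq_set.2 ⟨?_, ?_⟩)
      · rw [sdiff_eq_empty.2 (image_mono sdiff_subset), measure_empty]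
      · rw [← image_sdiff (graphMap_injective _), sdiff_sdiff_right_self]
        exact ((D.countable_jumps.mono inter_subset_right).image _).measure_zero _
    · congr 1
      ext1 x
      exact restrict_vert_image x measurableSet_uIcc
  · intro x y hxy
    rw [Function.onFun, Set.disjoint_left]
    intro p hp hq
    rw [mem_vert_image] at hp hq
    exact hxy (Subtype.ext (hp.1.symm.trans hq.1))
  · rw [Set.disjoint_left]
    intro p hp hq
    simp only [mem_iUnion, mem_graphMap_image, mem_vert_image] at hp hq
    obtain ⟨x, hx, -⟩ := hq
    rw [hx] at hp
    exact hp.1.2 x.2.1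

end SBVData

/-! ### Fluxes through extended graphs -/

/-- The determinant `q ∧ v`, that is, the scalar product of `q` with `-⋆v`. -/
def cross (q v : Plane) : ℝ := q 0 * v 1 - q 1 * v 0

theorem inner_neg_hodge (q v : Plane) : inner ℝ q (-hodge v) = cross q v := by
  simp [hodge, cross, PiLp.inner_apply]
  ring

theorem cross_sum {ι : Type*} (s : Finset ι) (c : ι → ℝ) (q : Plane) (v : ι → Plane) :
    cross q (∑ i ∈ s, c i • v i) = ∑ i ∈ s, c i * cross q (v i) := by
  simp only [cross, WithLp.ofLp_sum, WithLp.ofLp_smul, Finset.sum_apply, Pi.smul_apply, smul_eq_mul,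
    Finset.mul_sum, ← Finset.sum_sub_distrib]
  refine Finset.sum_congr rfl fun i _ => ?_
  ring

theorem cross_zero (q : Plane) : cross q 0 = 0 := by simp [cross]

theorem measurable_cross {X : Type*} [MeasurableSpace X] {f g : X → Plane} (hf : Measurable f)
    (hg : Measurable g) : Measurable fun x => cross (f x) (g x) := by
  have h : ∀ i : Fin 2, Measurable fun p : Plane => p i := fun i => by fun_prop
  unfold cross
  exact (((h 0).comp hf).mul ((h 1).comp hg)).sub (((h 1).comp hf).mul ((h 0).comp hg))

namespace SBVData

variable (D : SBVData)

open Classical in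
/-- The unit tangent to the extended graph. -/
def tangent (p : Plane) : Plane :=
  if p 0 ∈ D.jumps then !₂[0, SignType.sign (D.jump (p 0))]
  else (√(1 + D.slope (p 0) ^ 2))⁻¹ • !₂[1, D.slope (p 0)]

/-- The density of the current of integration over the extended graph. -/
def density (a b : ℝ) : Plane → Plane := (D.ext a b).indicator D.tangent

theorem measurable_tangent : Measurable D.tangent := by
  have h0 : Measurable fun p : Plane => p 0 := by fun_prop
  unfold tangent
  refine Measurable.ite (h0 D.countable_jumps.measurableSet) ?_ ?_
  · refine measurable_plane_mk measurable_const ?_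
    have : Measurable fun x : ℝ => ((SignType.sign x : SignType) : ℝ) := by
      have : (fun x : ℝ => ((SignType.sign x : SignType) : ℝ)) = fun x =>
          if 0 < x then 1 else if x < 0 then -1 else 0 := by
        ext x
        rcases lt_trichotomy x 0 with h | h | h
        · simp [h, h.not_gt]
        · simp [h]
        · simp [h]
      rw [this]
      exact Measurable.ite measurableSet_Ioi measurable_const
        (Measurable.ite measurableSet_Iio measurable_const measurable_const)
    exact this.comp (D.measurable_jump.comp h0)
  · refine Measurable.fun_smul (M := ℝ) ?_
      (measurable_plane_mk measurable_const (D.measurable_slope.comp h0))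
    exact (measurable_const.add ((D.measurable_slope.comp h0).pow_const 2)).sqrt.inv

theorem measurable_density (a b : ℝ) : Measurable (D.density a b) :=
  D.measurable_tangent.indicator (D.measurableSet_ext a b)

theorem norm_tangent (p : Plane) : ‖D.tangent p‖ = 1 := by
  unfold tangent
  split_ifs with h
  · rw [EuclideanSpace.norm_eq]
    rcases lt_or_gt_of_ne (show D.jump (p 0) ≠ 0 from h) with h | h <;> simp [h]
  · rw [norm_smul, EuclideanSpace.norm_eq]
    have : (0 : ℝ) < √(1 + D.slope (p 0) ^ 2) := Real.sqrt_pos.2 (by positivity)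
    simp [abs_of_pos this, this.ne']

theorem lintegral_speed_lt_top (a b : ℝ) : ∫⁻ x in Ioo a b, D.speed x < ⊤ := by
  calc ∫⁻ x in Ioo a b, D.speed x ≤ ∫⁻ x in Ioo a b, (1 + ENNReal.ofReal |D.slope x|) := by
        refine lintegral_mono fun x => ?_
        rw [speed, ← ENNReal.ofReal_one, ← ENNReal.ofReal_add zero_le_one (abs_nonneg _)]
        refine ENNReal.ofReal_le_ofReal ?_
        rw [Real.sqrt_le_left (by positivity), ← sq_abs (D.slope x)]
        nlinarith [abs_nonneg (D.slope x)]
    _ = volume (Ioo a b) + ∫⁻ x in Ioo a b, ENNReal.ofReal |D.slope x| := by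
        rw [lintegral_add_left measurable_const]; simp
    _ < ⊤ := by
        refine ENNReal.add_lt_top.2 ⟨by simp, ?_⟩
        have := D.integrable_slope.abs.integrableOn (s := Ioo a b) |>.2
        rw [hasFiniteIntegral_iff_ofReal (Eventually.of_forall fun _ => abs_nonneg _)] at this
        exact this

theorem hausdorffMeasure_ext_lt_top (a b : ℝ) : μH[1] (D.ext a b) < ⊤ := by
  rw [← Measure.restrict_apply_univ, D.restrict_ext, Measure.add_apply,
    Measure.map_apply (measurable_graphMap D.measurable_L) MeasurableSet.univ, preimage_univ,
    withDensity_apply _ MeasurableSet.univ, Measure.restrict_univ, Measure.sum_apply _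
    MeasurableSet.univ]
  refine ENNReal.add_lt_top.2 ⟨D.lintegral_speed_lt_top a b, ?_⟩
  have : ∀ x : ↥(D.jumps ∩ Ioo a b), (Measure.map (vert x) (volume.restrict (uIcc (D.L x) (D.R x))))
      univ = ENNReal.ofReal |D.jump x| := by
    intro x
    rw [Measure.map_apply (measurable_vert _) MeasurableSet.univ, preimage_univ,
      Measure.restrict_apply_univ, uIcc, Real.volume_Icc, max_sub_min_eq_abs, D.jump_eq]
  simp_rw [this]
  rw [← ENNReal.ofReal_tsum_of_nonneg (fun _ => abs_nonneg _) (D.summable_jump.subtype _)]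
  exact ENNReal.ofReal_lt_top

theorem integrable_density (a b : ℝ) : Integrable (D.density a b) μH[1] := by
  rw [density, integrable_indicator_iff (D.measurableSet_ext a b)]
  exact Measure.integrableOn_of_bounded (D.hausdorffMeasure_ext_lt_top a b).ne
    D.measurable_tangent.aestronglyMeasurable
    (Eventually.of_forall fun p => (D.norm_tangent p).le)

theorem cross_density (a b : ℝ) (φ : Plane → Plane) :
    (fun p => cross (φ p) (D.density a b p)) =
      (D.ext a b).indicator fun p => cross (φ p) (D.tangent p) := by
  ext p
  by_cases hp : p ∈ D.ext a b <;> simp [density, hp, cross_zero]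

/-- The length element cancels the normalization of the tangent, so that the flux through the graph
is an integral of `φˣ u' - φᵗ` over `x`. -/
theorem speed_smul_cross (φ : Plane → Plane) {x : ℝ} (hx : x ∉ D.jumps) :
    (D.speed x).toReal • cross (φ (graphMap D.L x)) (D.tangent (graphMap D.L x)) =
      φ (graphMap D.L x) 0 * D.slope x - φ (graphMap D.L x) 1 := by
  have : (0 : ℝ) < √(1 + D.slope x ^ 2) := Real.sqrt_pos.2 (by positivity)
  rw [speed, ENNReal.toReal_ofReal this.le, tangent, graphMap_zero, if_neg hx]
  simp only [cross, smul_eq_mul, PiLp.smul_apply]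
  simp
  field_simp

theorem ae_notMem_jumps (a b : ℝ) : ∀ᵐ x ∂volume.restrict (Ioo a b), x ∉ D.jumps :=
  ae_restrict_of_ae (measure_eq_zero_iff_ae_notMem.1 (D.countable_jumps.measure_zero volume))

/-- The sign in the vertical tangent is that of an oriented integral from the left to the right
value. -/
theorem setIntegral_cross_vert (φ : Plane → Plane) {x : ℝ} (hx : x ∈ D.jumps) :
    ∫ t in uIcc (D.L x) (D.R x), cross (φ (vert x t)) (D.tangent (vert x t)) =
      ∫ t in D.L x..D.R x, φ (vert x t) 0 := by
  have e : ∀ t, cross (φ (vert x t)) (D.tangent (vert x t)) =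
      φ (vert x t) 0 * SignType.sign (D.jump x) := by
    intro t
    rw [tangent, vert_zero, if_pos hx]
    simp [cross]
  simp_rw [e]
  rcases lt_or_gt_of_ne (show D.jump x ≠ 0 from hx) with h | h
  · have hle : D.R x ≤ D.L x := by rw [D.jump_eq] at h; linarith
    rw [intervalIntegral.integral_of_ge hle, uIcc_of_ge hle, integral_Icc_eq_integral_Ioc]
    simp [h, integral_neg]
  · have hle : D.L x ≤ D.R x := by rw [D.jump_eq] at h; linarith
    rw [intervalIntegral.integral_of_le hle, uIcc_of_le hle, integral_Icc_eq_integral_Ioc]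
    simp [h]

theorem integrable_cross_iff (a b : ℝ) {φ : Plane → Plane} (hφ : Measurable φ) :
    Integrable (fun p => cross (φ p) (D.density a b p)) μH[1] ↔
      IntegrableOn (fun x => φ (graphMap D.L x) 0 * D.slope x - φ (graphMap D.L x) 1) (Ioo a b) ∧
      Integrable (fun p => cross (φ p) (D.tangent p)) (Measure.sum
        fun x : ↥(D.jumps ∩ Ioo a b) => (volume.restrict (uIcc (D.L x) (D.R x))).map (vert x)) := by
  have hm := measurable_cross hφ D.measurable_tangent
  have hG := measurable_graphMap D.measurable_L
  rw [cross_density, integrable_indicator_iff (D.measurableSet_ext a b), IntegrableOn,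
    D.restrict_ext, integrable_add_measure, integrable_map_measure hm.aestronglyMeasurable
    hG.aemeasurable, integrable_withDensity_iff_integrable_smul' D.measurable_speed
    (Eventually.of_forall fun _ => ENNReal.ofReal_lt_top)]
  refine and_congr_left fun _ => integrable_congr ?_
  filter_upwards [D.ae_notMem_jumps a b] with x hx
  exact D.speed_smul_cross φ hx

theorem integral_cross (a b : ℝ) {φ : Plane → Plane} (hφ : Measurable φ)
    (h : Integrable (fun p => cross (φ p) (D.density a b p)) μH[1]) :
    ∫ p, cross (φ p) (D.density a b p) ∂μH[1] =
      (∫ x in Ioo a b, (φ (graphMap D.L x) 0 * D.slope x - φ (graphMap D.L x) 1)) +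
      ∑' x : ↥(D.jumps ∩ Ioo a b), ∫ t in D.L x..D.R x, φ (vert x t) 0 := by
  have hm := measurable_cross hφ D.measurable_tangent
  have hG := measurable_graphMap D.measurable_L
  have h2 := h
  rw [cross_density, integrable_indicator_iff (D.measurableSet_ext a b), IntegrableOn,
    D.restrict_ext, integrable_add_measure] at h2
  rw [cross_density, integral_indicator (D.measurableSet_ext a b), D.restrict_ext,
    integral_add_measure h2.1 h2.2, integral_map hG.aemeasurable hm.aestronglyMeasurable,
    integral_withDensity_eq_integral_toReal_smul D.measurable_speed
    (Eventually.of_forall fun _ => ENNReal.ofReal_lt_top)]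
  congr 1
  · refine integral_congr_ae ?_
    filter_upwards [D.ae_notMem_jumps a b] with x hx
    exact D.speed_smul_cross φ hx
  · rw [← (hasSum_integral_measure h2.2).tsum_eq]
    congr 1
    ext x
    rw [integral_map (measurable_vert _).aemeasurable hm.aestronglyMeasurable]
    exact D.setIntegral_cross_vert φ x.2.1

/-- A field whose first component vanishes over all but finitely many jump points has an integrable
flux as soon as it has one through the graph. -/
theorem integrable_cross_of_finite (a b : ℝ) {φ : Plane → Plane} (hφ : Measurable φ)
    (h1 : IntegrableOn (fun x => φ (graphMap D.L x) 0 * D.slope x - φ (graphMap D.L x) 1)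
      (Ioo a b)) (P : Finset ℝ) (hP : ∀ x ∈ D.jumps, x ∉ P → ∀ t, φ (vert x t) 0 = 0)
    (hP' : ∀ x ∈ P, ∀ s t, IntervalIntegrable (fun t => φ (vert x t) 0) volume s t) :
    Integrable (fun p => cross (φ p) (D.density a b p)) μH[1] := by
  rw [D.integrable_cross_iff a b hφ]
  refine ⟨h1, (measurable_cross hφ D.measurable_tangent).aestronglyMeasurable, ?_⟩
  have hm := measurable_cross hφ D.measurable_tangent
  rw [hasFiniteIntegral_iff_enorm, lintegral_sum_measure]
  have hfin : (Subtype.val ⁻¹' (P : Set ℝ) : Set ↥(D.jumps ∩ Ioo a b)).Finite :=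
    P.finite_toSet.preimage Subtype.val_injective.injOn
  have e : ∀ x : ↥(D.jumps ∩ Ioo a b), ∀ t, ‖cross (φ (vert x t)) (D.tangent (vert x t))‖ₑ =
      ‖φ (vert x t) 0‖ₑ := by
    intro x t
    rw [tangent, vert_zero, if_pos x.2.1]
    rcases lt_or_gt_of_ne (show D.jump x ≠ 0 from x.2.1) with h | h <;> simp [cross, h]
  have e2 : ∀ x : ↥(D.jumps ∩ Ioo a b), ∫⁻ p, ‖cross (φ p) (D.tangent p)‖ₑ
      ∂(volume.restrict (uIcc (D.L x) (D.R x))).map (vert x) =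
      ∫⁻ t in uIcc (D.L x) (D.R x), ‖φ (vert x t) 0‖ₑ := by
    intro x
    rw [lintegral_map hm.enorm (measurable_vert _)]
    simp_rw [e]
  simp_rw [e2]
  rw [tsum_eq_sum (s := hfin.toFinset)]
  · refine ENNReal.sum_lt_top.2 fun x hx => ?_
    have hxP : (x : ℝ) ∈ P := by simpa using hx
    have := hP' x hxP (D.L x) (D.R x)
    rw [intervalIntegrable_iff] at this
    have h3 := this.2
    rw [hasFiniteIntegral_iff_enorm] at h3
    rwa [uIcc, ← setLIntegral_congr Ioc_ae_eq_Icc]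
  · intro x hx
    have hxP : (x : ℝ) ∉ P := by simpa using hx
    simp [hP x x.2.1 hxP]

end SBVData

/-! ### Coincidence of derivatives -/

/-- Functions that agree on a set have the same derivative at almost every point of it. -/
theorem ae_hasDerivAt_eq_of_eqOn {f g : ℝ → ℝ} {s : Set ℝ} (h : EqOn f g s) :
    ∀ᵐ x, x ∈ s → ∀ m n, HasDerivAt f m x → HasDerivAt g n x → m = n := by
  -- Only countably many points of `s` are isolated in `s` from the right. Any other point is an
  -- accumulation point of `s`, where a derivative within `s` is unique.
  have hc : {x ∈ s | 𝓝[s ∩ Ioi x] x = ⊥}.Countable := countable_setOfPred_isolated_right_within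
  filter_upwards [measure_eq_zero_iff_ae_notMem.1 (hc.measure_zero volume)] with x hx hxs m n hm hn
  have hne : 𝓝[s ∩ Ioi x] x ≠ ⊥ := fun h => hx ⟨hxs, h⟩
  have hu : UniqueDiffWithinAt ℝ s x := by
    rw [uniqueDiffWithinAt_iff_accPt, accPt_principal_iff_nhdsWithin]
    have : (𝓝[s ∩ Ioi x] x).NeBot := ⟨hne⟩
    refine this.mono (nhdsWithin_mono _ fun y hy => ⟨hy.1, ?_⟩)
    exact (ne_of_gt hy.2 : y ≠ x)
  exact hu.eq_deriv s hm.hasDerivWithinAt (hn.hasDerivWithinAt.congr h (h hxs))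

/-- This gives graphs that meet a common tangent at almost every abscissa, so that a linear
combination of graphs has a well-defined slope. -/
theorem SBVData.ae_slope_eq (D E : SBVData) : ∀ᵐ x, D.L x = E.L x → D.slope x = E.slope x := by
  filter_upwards [ae_hasDerivAt_eq_of_eqOn (f := D.L) (g := E.L) (s := {x | D.L x = E.L x})
    (fun x hx => hx), D.ae_hasDerivAt, E.ae_hasDerivAt] with x h h1 h2 hx
  exact h hx _ _ h1 h2

/-- On each piece where `L` is nearly linear it is Lipschitz and extends to the line; the extension
has the derivative of `L` almost everywhere on the piece by coincidence. These curves show that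
graphs are rectifiable. -/
theorem SBVData.exists_lipschitz_cover (D : SBVData) : ∃ (f : ℕ → ℝ → ℝ) (t : ℕ → Set ℝ),
    (∀ n, MeasurableSet (t n)) ∧ (∀ n, ∃ K, LipschitzWith K (f n)) ∧ volume (⋃ n, t n)ᶜ = 0 ∧
    (∀ n, EqOn D.L (f n) (t n)) ∧ ∀ n, ∀ᵐ x, x ∈ t n → HasDerivAt (f n) (D.slope x) x := by
  let s : Set ℝ := {x | DifferentiableAt ℝ D.L x} ∩ {x | deriv D.L x = D.slope x}
  have hs : MeasurableSet s := (measurableSet_of_differentiableAt ℝ D.L).inter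
    (measurableSet_eq_fun (measurable_deriv _) D.measurable_slope)
  have hs0 : volume sᶜ = 0 := by
    filter_upwards [D.ae_hasDerivAt] with x hx
    exact ⟨hx.differentiableAt, hx.deriv⟩
  have hder : ∀ x ∈ s, HasDerivAt D.L (D.slope x) x := fun x hx => by
    rw [← hx.2]; exact hx.1.hasDerivAt
  obtain ⟨t, A, -, htm, hst, hA, -⟩ :=
    exists_partition_approximatesLinearOn_of_hasFDerivWithinAt D.L s
      (fun x => ContinuousLinearMap.toSpanSingleton ℝ (D.slope x))
      (fun x hx => ((hder x hx).hasFDerivAt).hasFDerivWithinAt)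
      (fun _ => 1) (fun _ => one_ne_zero)
  have hext : ∀ n, ∃ g : ℝ → ℝ, LipschitzWith (‖A n‖₊ + 1) g ∧ EqOn D.L g (s ∩ t n) := fun n =>
    (lipschitzOnWith_iff_restrict.2 (hA n).lipschitz).extend_real
  choose g hg1 hg2 using hext
  refine ⟨g, fun n => s ∩ t n, fun n => hs.inter (htm n), fun n => ⟨_, hg1 n⟩, ?_, hg2, fun n => ?_⟩
  · rw [← inter_iUnion, inter_eq_left.2 hst]; exact hs0
  · filter_upwards [ae_hasDerivAt_eq_of_eqOn (hg2 n), (hg1 n).ae_differentiableAt_real] with x h1 h2 hx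
    rw [h1 hx _ _ (hder x hx.1) h2.hasDerivAt]
    exact h2.hasDerivAt

/-! ### Currents and their densities -/

theorem apply_eq_add {E : Type*} [AddCommGroup E] [Module ℝ E] [TopologicalSpace E]
    (l : Plane →L[ℝ] E) (v : Plane) :
    l v = v 0 • l (EuclideanSpace.single 0 1) + v 1 • l (EuclideanSpace.single 1 1) := by
  conv_lhs => rw [show v = v 0 • EuclideanSpace.single 0 1 + v 1 • EuclideanSpace.single 1 1 by
    ext i; fin_cases i <;> simp]
  rw [map_add, map_smul, map_smul]

theorem integrable_form_apply {a b : ℝ} (w : Form a b) {f : Plane → Plane} {μ : Measure Plane}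
    (hf : Integrable f μ) : Integrable (fun p => w p (f p)) μ := by
  obtain ⟨C, hC⟩ := w.continuous.bounded_above_of_compact_support w.hasCompactSupport
  have hcoord : ∀ i : Fin 2, Integrable (fun p => f p i) μ := fun i =>
    (EuclideanSpace.proj (𝕜 := ℝ) i).integrable_comp hf
  simp_rw [fun p => apply_eq_add (w p) (f p)]
  have hb : ∀ e : Plane, Continuous fun p => w p e := fun e =>
    (ContinuousLinearMap.apply ℝ ℝ e).continuous.comp w.continuous
  have hb' : ∀ e p, ‖w p e‖ ≤ C * ‖e‖ := fun e p =>
    ((w p).le_opNorm e).trans (mul_le_mul_of_nonneg_right (hC p) (norm_nonneg _))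
  exact ((hcoord 0).mul_bdd (hb _).aestronglyMeasurable (Eventually.of_forall (hb' _))).add
    ((hcoord 1).mul_bdd (hb _).aestronglyMeasurable (Eventually.of_forall (hb' _)))

/-- A density supported in the strip is determined by its current. -/
theorem ae_eq_of_forall_form {a b : ℝ} {f g : Plane → Plane} (hf : Integrable f μH[1])
    (hg : Integrable g μH[1]) (hf0 : ∀ p, p ∉ strip a b → f p = 0)
    (hg0 : ∀ p, p ∉ strip a b → g p = 0)
    (h : ∀ w : Form a b, ∫ p, w p (f p) ∂μH[1] = ∫ p, w p (g p) ∂μH[1]) :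
    ∀ᵐ p ∂(μH[1] : Measure Plane), f p = g p := by
  have hcoord : ∀ (i : Fin 2) (f : Plane → Plane), Integrable f μH[1] →
      Integrable (fun p => f p i) μH[1] := fun i f hf =>
    (EuclideanSpace.proj (𝕜 := ℝ) i).integrable_comp hf
  have key : ∀ i : Fin 2, ∀ᵐ p ∂(μH[1] : Measure Plane), p ∈ (strip a b : Set Plane) →
      f p i - g p i = 0 := by
    intro i
    have hi : Integrable (fun p => f p i - g p i) μH[1] := (hcoord i f hf).sub (hcoord i g hg)
    refine (strip a b).isOpen.ae_eq_zero_of_integral_contDiff_smul_eq_zero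
      (hi.locallyIntegrable.locallyIntegrableOn _)
      fun η hη hc hs => ?_
    have hsupp : Function.support (fun p => η p • (EuclideanSpace.proj (𝕜 := ℝ) i :
        Plane →L[ℝ] ℝ)) ⊆ Function.support η := fun p hp h0 => hp (by simp [h0])
    -- The form `η dxᵢ` tests the coordinate `i` of the density against `η`.
    let w : Form a b := ⟨fun p => η p • (EuclideanSpace.proj (𝕜 := ℝ) i : Plane →L[ℝ] ℝ),
      hη.smul contDiff_const, hc.mono hsupp, (closure_mono hsupp).trans hs⟩
    have hw : ∀ p v, w p v = η p * v i := fun p v => by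
      change (η p • (EuclideanSpace.proj (𝕜 := ℝ) i : Plane →L[ℝ] ℝ)) v = _
      simp
    have h1 := h w
    have i1 := integrable_form_apply w hf
    have i2 := integrable_form_apply w hg
    simp_rw [hw] at h1 i1 i2
    simp_rw [smul_eq_mul, mul_sub]
    rw [integral_sub i1 i2, h1, sub_self]
  filter_upwards [key 0, key 1] with p h0 h1
  by_cases hp : p ∈ strip a b
  · ext i
    fin_cases i
    · exact sub_eq_zero.1 (h0 hp)
    · exact sub_eq_zero.1 (h1 hp)
  · rw [hf0 p hp, hg0 p hp]

theorem IsRep.extGraph_eq {a b : ℝ} {u : ℝ → ℝ} {D : SBVData} (h : IsRep a b u D) :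
    extGraph a b u = D.ext a b := by
  ext p
  constructor
  · rintro ⟨h0, h1, h2⟩
    rw [h.leftTrace_eq h0, h.rightTrace_eq h0] at h1 h2
    exact ⟨h0, h1, h2⟩
  · rintro ⟨h0, h1, h2⟩
    refine ⟨h0, ?_⟩
    rw [h.leftTrace_eq h0, h.rightTrace_eq h0]
    exact ⟨h1, h2⟩

/-- `grad` and `slope` differ on a null set of abscissas, and the part of the graph over it has no
length. -/
theorem IsRep.graphCurrent_eq {a b : ℝ} {u : ℝ → ℝ} {D : SBVData} (h : IsRep a b u D)
    (w : Form a b) : graphCurrent a b u w = ∫ p, w p (D.density a b p) ∂μH[1] := by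
  have e : (fun p => w p (D.density a b p)) =
      (D.ext a b).indicator fun p => w p (D.tangent p) := by
    ext p
    by_cases hp : p ∈ D.ext a b <;> simp [SBVData.density, hp]
  rw [e, integral_indicator (D.measurableSet_ext a b), graphCurrent, h.extGraph_eq]
  refine setIntegral_congr_ae (D.measurableSet_ext a b) ?_
  have h0 := D.hausdorffMeasure_graphMap_image_null
    (s := {x | ¬ (x ∈ Ioo a b → grad a b u x = D.slope x)}) h.grad_eq
  filter_upwards [measure_eq_zero_iff_ae_notMem.1 h0] with p hp hpe
  congr 1
  have hI := hpe.1
  rw [graphOrient, h.leftTrace_eq hI, h.rightTrace_eq hI, SBVData.tangent]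
  by_cases hj : p 0 ∈ D.jumps
  · have hne : ¬ D.L (p 0) = D.R (p 0) := fun h => D.L_eq_R_iff.1 h hj
    rw [if_neg hne, if_pos hj, ← D.jump_eq]
  · have heq := D.L_eq_R_iff.2 hj
    rw [if_pos heq, if_neg hj]
    have : grad a b u (p 0) = D.slope (p 0) := by
      by_contra hne
      refine hp (mem_graphMap_image.2 ⟨fun hh => hne (hh hI), ?_⟩)
      have := hpe.2
      rw [← heq, uIcc_self] at this
      exact this
    rw [this]

theorem SBVData.density_of_notMem_strip (D : SBVData) {a b : ℝ} {p : Plane} (hp : p ∉ strip a b) :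
    D.density a b p = 0 :=
  indicator_of_notMem (fun h => hp h.1) _

theorem hasDerivAt_plane_mk {f g : ℝ → ℝ} {m n x : ℝ} (hf : HasDerivAt f m x)
    (hg : HasDerivAt g n x) : HasDerivAt (fun x => (!₂[f x, g x] : Plane)) !₂[m, n] x := by
  have e : ∀ s t : ℝ, (!₂[s, t] : Plane) =
      s • EuclideanSpace.single 0 1 + t • EuclideanSpace.single 1 1 := by
    intro s t; ext i; fin_cases i <;> simp
  simp only [e]
  exact (hf.smul_const _).add (hg.smul_const _)

/-- A finite linear combination of extended graphs. -/
structure Chain (ι : Type*) where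
  coeff : ι → ℝ
  data : ι → SBVData

/-! ### Finite combinations of graphs as rectifiable currents -/

namespace Chain

variable {ι : Type*} [Fintype ι] (C : Chain ι)

/-- The density of the current that is associated to a chain. -/
def density (a b : ℝ) (p : Plane) : Plane := ∑ i, C.coeff i • (C.data i).density a b p

/-- The chain `C` represents the current `T`. -/
def Represents {a b : ℝ} (T : FormFunctional a b) : Prop :=
  ∀ w, T w = ∫ p, w p (C.density a b p) ∂μH[1]

theorem measurable_density (a b : ℝ) : Measurable (C.density a b) :=
  Finset.measurable_fun_sum _ fun i _ => by
    have := ((C.data i).measurable_density a b).const_smul (C.coeff i)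
    exact this

theorem integrable_density (a b : ℝ) : Integrable (C.density a b) μH[1] :=
  integrable_finsetSum _ fun i _ => by
    have := ((C.data i).integrable_density a b).smul (C.coeff i)
    exact this

theorem density_of_notMem_strip {a b : ℝ} {p : Plane} (hp : p ∉ strip a b) :
    C.density a b p = 0 := by
  simp [density, SBVData.density_of_notMem_strip _ hp]

theorem represents_sum {a b : ℝ} {u : ι → ℝ → ℝ} (h : ∀ i, IsRep a b (u i) (C.data i)) :
    C.Represents (∑ i, C.coeff i • graphCurrent a b (u i)) := by
  intro w
  have e : ∀ p, w p (C.density a b p) = ∑ i, C.coeff i * w p ((C.data i).density a b p) := by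
    intro p
    simp [density, map_sum, map_smul]
  simp_rw [e]
  rw [integral_finsetSum _ fun i _ =>
    (integrable_form_apply w ((C.data i).integrable_density a b)).const_mul _, Finset.sum_apply]
  refine Finset.sum_congr rfl fun i _ => ?_
  rw [integral_const_mul, ← (h i).graphCurrent_eq]
  rfl

theorem ae_slope_eq : ∀ᵐ x, ∀ i j, (C.data i).L x = (C.data j).L x →
    (C.data i).slope x = (C.data j).slope x := by
  rw [ae_all_iff]; intro i
  rw [ae_all_iff]; intro j
  exact (C.data i).ae_slope_eq (C.data j)

/-- The jump points of the graphs of a chain. -/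
def jumps : Set ℝ := ⋃ i, (C.data i).jumps

theorem countable_jumps : C.jumps.Countable := countable_iUnion fun i => (C.data i).countable_jumps

theorem notMem_jumps {x : ℝ} (hx : x ∉ C.jumps) (i : ι) : x ∉ (C.data i).jumps :=
  fun h => hx (mem_iUnion.2 ⟨i, h⟩)

theorem ae_notMem_jumps : ∀ᵐ x, x ∉ C.jumps :=
  measure_eq_zero_iff_ae_notMem.1 (C.countable_jumps.measure_zero volume)

/-- Away from jumps every graph of the chain through the point has the same slope, so all the
tangents that are added are parallel. -/
theorem density_graphMap {a b x : ℝ} (hx : x ∉ C.jumps) (i : ι)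
    (hs : ∀ j, (C.data i).L x = (C.data j).L x → (C.data i).slope x = (C.data j).slope x) :
    ∃ k : ℝ, C.density a b (graphMap (C.data i).L x) = k • !₂[1, (C.data i).slope x] := by
  have : ∀ j, ∃ k : ℝ, (C.data j).density a b (graphMap (C.data i).L x) =
      k • !₂[1, (C.data i).slope x] := by
    intro j
    by_cases hm : graphMap (C.data i).L x ∈ (C.data j).ext a b
    · have h2 := hm.2
      rw [graphMap_zero, ← (C.data j).L_eq_R_iff.2 (C.notMem_jumps hx j), uIcc_self,
        graphMap_one] at h2
      rw [SBVData.density, indicator_of_mem hm, SBVData.tangent, graphMap_zero,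
        if_neg (C.notMem_jumps hx j), ← hs j h2]
      exact ⟨_, rfl⟩
    · exact ⟨0, by rw [SBVData.density, indicator_of_notMem hm, zero_smul]⟩
  choose k hk using this
  refine ⟨∑ j, C.coeff j * k j, ?_⟩
  simp only [density, hk, smul_smul, Finset.sum_smul]

theorem density_vert {a b x t : ℝ} (ht : ∀ i, t ≠ (C.data i).L x) :
    ∃ k : ℝ, C.density a b (vert x t) = k • !₂[0, 1] := by
  have : ∀ j, ∃ k : ℝ, (C.data j).density a b (vert x t) = k • !₂[(0 : ℝ), 1] := by
    intro j
    by_cases hm : vert x t ∈ (C.data j).ext a b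
    · by_cases hj : x ∈ (C.data j).jumps
      · rw [SBVData.density, indicator_of_mem hm, SBVData.tangent, vert_zero, if_pos hj]
        refine ⟨SignType.sign ((C.data j).jump x), ?_⟩
        ext i; fin_cases i <;> simp
      · have h2 := hm.2
        rw [vert_zero, ← (C.data j).L_eq_R_iff.2 hj, uIcc_self, vert_one] at h2
        exact absurd h2 (ht j)
    · exact ⟨0, by rw [SBVData.density, indicator_of_notMem hm, zero_smul]⟩
  choose k hk using this
  refine ⟨∑ j, C.coeff j * k j, ?_⟩
  simp only [density, hk, smul_smul, Finset.sum_smul]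

/-- Countably many Lipschitz curves that are tangent to the density cover a chain. -/
theorem exists_curves (a b : ℝ) : ∃ (κ : Type) (_ : Countable κ) (γ : κ → ℝ → Plane)
    (A : κ → Set ℝ), (∀ n, MeasurableSet (A n)) ∧ (∀ n, ∃ K, LipschitzWith K (γ n)) ∧
    (∀ n, ∀ᵐ s, s ∈ A n → ∃ k : ℝ, C.density a b (γ n s) = k • deriv (γ n) s) ∧
    μH[1] ({p | C.density a b p ≠ 0} \ ⋃ n, γ n '' A n) = 0 := by
  choose f t htm hf hcov hEq hder using fun i => (C.data i).exists_lipschitz_cover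
  let e := Fintype.equivFin ι
  -- Two kinds of curves: Lipschitz pieces of the graphs, and a whole vertical line over each jump
  -- point.
  refine ⟨(Fin (Fintype.card ι) × ℕ) ⊕ C.jumps, ?_,
    Sum.elim (fun q => graphMap (f (e.symm q.1) q.2)) (fun x => vert x),
    Sum.elim (fun q => t (e.symm q.1) q.2) (fun _ => univ), ?_, ?_, ?_, ?_⟩
  · have : Countable C.jumps := C.countable_jumps.to_subtype
    infer_instance
  · rintro (q | x)
    · exact htm _ _
    · exact MeasurableSet.univ
  · rintro (q | x)
    · obtain ⟨K, hK⟩ := hf (e.symm q.1) q.2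
      refine ⟨1 + K, LipschitzWith.of_dist_le_mul fun x y => ?_⟩
      change dist (graphMap _ x) (graphMap _ y) ≤ _
      rw [dist_plane, graphMap_zero, graphMap_zero, graphMap_one, graphMap_one]
      have h1 := hK.dist_le_mul x y
      rw [Real.dist_eq, Real.dist_eq] at h1
      rw [Real.dist_eq, Real.sqrt_le_left (by positivity)]
      push_cast
      rw [← sq_abs (x - y), ← sq_abs (f _ _ x - f _ _ y)]
      nlinarith [abs_nonneg (x - y), abs_nonneg (f (e.symm q.1) q.2 x - f (e.symm q.1) q.2 y),
        K.2, mul_nonneg (K.2 : (0 : ℝ) ≤ K) (sq_nonneg |x - y|)]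
    · exact ⟨1, (isometry_vert x).lipschitz⟩
  · rintro (q | x)
    · filter_upwards [C.ae_slope_eq, C.ae_notMem_jumps, hder (e.symm q.1) q.2] with s h1 h2 h3 hs
      simp only [Sum.elim_inl] at hs ⊢
      have hg : graphMap (f (e.symm q.1) q.2) s = graphMap (C.data (e.symm q.1)).L s := by
        rw [graphMap, graphMap, hEq _ _ hs]
      have hd : deriv (graphMap (f (e.symm q.1) q.2)) s =
          !₂[1, (C.data (e.symm q.1)).slope s] := by
        exact (hasDerivAt_plane_mk (hasDerivAt_id s) (h3 hs)).deriv
      rw [hg, hd]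
      exact C.density_graphMap h2 _ (h1 _)
    · have : ∀ᵐ s : ℝ, ∀ i, s ≠ (C.data i).L x := by
        rw [ae_all_iff]; intro i
        exact Measure.ae_ne _ _
      filter_upwards [this] with s hs _
      have hd : deriv (vert x) s = !₂[0, 1] := by
        exact (hasDerivAt_plane_mk (hasDerivAt_const s (x : ℝ)) (hasDerivAt_id s)).deriv
      simp only [Sum.elim_inr]
      rw [hd]
      exact C.density_vert hs
  · have hN : μH[1] (⋃ i, graphMap (C.data i).L '' (⋃ n, t i n)ᶜ) = 0 :=
      measure_iUnion_null fun i => (C.data i).hausdorffMeasure_graphMap_image_null (hcov i)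
    refine measure_mono_null ?_ hN
    rintro p ⟨hp, hp'⟩
    obtain ⟨i, hi⟩ : ∃ i, (C.data i).density a b p ≠ 0 := by
      by_contra! h
      exact hp (by simp [density, h])
    have hpe : p ∈ (C.data i).ext a b := by
      by_contra h
      exact hi (indicator_of_notMem h _)
    simp only [mem_iUnion, not_exists] at hp'
    have hj : p 0 ∉ C.jumps := by
      intro hj
      exact hp' (Sum.inr ⟨p 0, hj⟩) (mem_vert_image.2 ⟨rfl, mem_univ _⟩)
    have h1 : p 1 = (C.data i).L (p 0) := by
      have := hpe.2
      rwa [← (C.data i).L_eq_R_iff.2 (C.notMem_jumps hj i), uIcc_self] at this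
    refine mem_iUnion.2 ⟨i, mem_graphMap_image.2 ⟨?_, h1⟩⟩
    intro hmem
    obtain ⟨n, hn⟩ := mem_iUnion.1 hmem
    refine hp' (Sum.inl (e i, n)) (mem_graphMap_image.2 ?_)
    simp only [Equiv.symm_apply_apply]
    exact ⟨by simpa using hn, by rw [h1]; exact hEq i n hn⟩

/-- The rectifiable current of a chain. -/
theorem exists_rectTriple (a b : ℝ) : ∃ R : RectTriple a b,
    R.carrier = {p | C.density a b p ≠ 0} ∧ ∀ p, R.mult p • R.orient p = C.density a b p := by
  obtain ⟨κ, hκ, γ, A, hA, hγ, htan, hcov⟩ := C.exists_curves a b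
  have hm := C.measurable_density a b
  -- `none` stands for a constant curve over the empty set, so that an enumeration by `ℕ` exists
  -- even if there are no curves.
  obtain ⟨o, ho⟩ := exists_surjective_nat (Option κ)
  let R : RectTriple a b :=
    { carrier := {p | C.density a b p ≠ 0}
      mult := fun p => ‖C.density a b p‖
      orient := fun p => ‖C.density a b p‖⁻¹ • C.density a b p
      carrier_subset := fun p hp => by
        by_contra h
        exact hp (C.density_of_notMem_strip h)
      measurableSet_carrier := (hm (measurableSet_singleton 0)).compl
      measurable_mult := hm.norm
      mult_pos := fun p hp => norm_pos_iff.2 hp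
      integrableOn_mult := (C.integrable_density a b).norm.integrableOn
      measurable_orient := hm.norm.inv.smul hm
      norm_orient := fun p hp => by
        rw [norm_smul, norm_inv, norm_norm, inv_mul_cancel₀ (norm_ne_zero_iff.2 hp)]
      rectifiable := by
        refine ⟨fun n => (o n).elim (fun _ => 0) γ, fun n => (o n).elim ∅ A, ?_, ?_, ?_, ?_⟩
        · intro n
          change MeasurableSet ((o n).elim ∅ A)
          rcases o n with _ | k
          · exact MeasurableSet.empty
          · exact hA k
        · intro n
          change ∃ K, LipschitzWith K ((o n).elim (fun _ => 0) γ)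
          rcases o n with _ | k
          · exact ⟨0, LipschitzWith.const _⟩
          · exact hγ k
        · refine measure_mono_null (sdiff_subset_sdiff_right ?_) hcov
          refine iUnion_subset fun k => ?_
          obtain ⟨n, hn⟩ := ho (some k)
          refine subset_iUnion_of_subset n ?_
          change _ ⊆ (o n).elim (fun _ => 0) γ '' (o n).elim ∅ A
          rw [hn]; exact subset_rfl
        · intro n
          change ∀ᵐ s, s ∈ (o n).elim ∅ A → (o n).elim (fun _ => 0) γ s ∈
            {p | C.density a b p ≠ 0} → ∃ c : ℝ, deriv ((o n).elim (fun _ => 0) γ) s =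
            c • (‖C.density a b ((o n).elim (fun _ => 0) γ s)‖⁻¹ •
              C.density a b ((o n).elim (fun _ => 0) γ s))
          rcases o n with _ | k
          · exact Eventually.of_forall fun s hs => absurd hs (notMem_empty _)
          · filter_upwards [htan k] with s hs hsA hsc
            obtain ⟨m, hm⟩ := hs hsA
            have hsc' : C.density a b (γ k s) ≠ 0 := hsc
            have hm0 : m ≠ 0 := by rintro rfl; exact hsc' (by rw [hm, zero_smul])
            refine ⟨m⁻¹ * ‖C.density a b (γ k s)‖, ?_⟩
            change deriv (γ k) s = _ • (‖C.density a b (γ k s)‖⁻¹ • C.density a b (γ k s))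
            rw [smul_smul, mul_assoc, mul_inv_cancel₀ (norm_ne_zero_iff.2 hsc'), mul_one, hm,
              smul_smul, inv_mul_cancel₀ hm0, one_smul] }
  refine ⟨R, rfl, fun p => ?_⟩
  change ‖C.density a b p‖ • (‖C.density a b p‖⁻¹ • C.density a b p) = _
  by_cases h : C.density a b p = 0
  · simp [h]
  · rw [smul_smul, mul_inv_cancel₀ (norm_ne_zero_iff.2 h), one_smul]

end Chain

theorem RectTriple.integrable_density {a b : ℝ} (R : RectTriple a b) :
    Integrable (R.carrier.indicator fun p => R.mult p • R.orient p) μH[1] := by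
  rw [integrable_indicator_iff R.measurableSet_carrier]
  refine R.integrableOn_mult.mono'
    (R.measurable_mult.smul R.measurable_orient).aestronglyMeasurable ?_
  filter_upwards [ae_restrict_mem R.measurableSet_carrier] with p hp
  rw [norm_smul, R.norm_orient p hp, mul_one, Real.norm_eq_abs, abs_of_pos (R.mult_pos p hp)]

theorem RectTriple.toCurrent_eq {a b : ℝ} (R : RectTriple a b) (w : Form a b) :
    R.toCurrent w = ∫ p, w p (R.carrier.indicator (fun p => R.mult p • R.orient p) p) ∂μH[1] := by
  have e : (fun p => w p (R.carrier.indicator (fun p => R.mult p • R.orient p) p)) =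
      R.carrier.indicator fun p => w p (R.orient p) * R.mult p := by
    ext p
    by_cases hp : p ∈ R.carrier <;> simp [hp, mul_comm]
  rw [e, integral_indicator R.measurableSet_carrier, RectTriple.toCurrent]

namespace Chain

variable {ι : Type*} [Fintype ι] (C : Chain ι) {a b : ℝ} {T : FormFunctional a b}

/-- A current determines the product of multiplicity and orientation. Hence the flux is the same for
all triples, and the supremum in `lift` becomes one over integrals of `cross` against the density of
the chain. -/
theorem ae_density_eq (hT : C.Represents T) {R : RectTriple a b} (hR : R.toCurrent = T) :
    ∀ᵐ p ∂(μH[1] : Measure Plane),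
      R.carrier.indicator (fun p => R.mult p • R.orient p) p = C.density a b p := by
  refine ae_eq_of_forall_form R.integrable_density (C.integrable_density a b) (fun p hp => ?_)
    (fun p hp => C.density_of_notMem_strip hp) fun w => ?_
  · exact indicator_of_notMem (fun h => hp (R.carrier_subset h)) _
  · rw [← R.toCurrent_eq, hR, hT w]

theorem flux_eq (hT : C.Represents T) {R : RectTriple a b} (hR : R.toCurrent = T)
    (φ : Plane → Plane) : R.carrier.indicator (R.flux φ) =ᵐ[μH[1]]
      fun p => cross (φ p) (C.density a b p) := by
  filter_upwards [C.ae_density_eq hT hR] with p hp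
  rw [← hp]
  by_cases h : p ∈ R.carrier
  · rw [indicator_of_mem h, indicator_of_mem h, RectTriple.flux, inner_neg_hodge]
    simp [cross]; ring
  · rw [indicator_of_notMem h, indicator_of_notMem h, cross_zero]

theorem le_lift (hT : C.Represents T) {α β : ℝ} {g : ℝ → ℝ} {φ : Plane → Plane}
    (hφ : Admissible a b α β g φ)
    (hi : Integrable (fun p => cross (φ p) (C.density a b p)) μH[1]) :
    ((∫ p, cross (φ p) (C.density a b p) ∂μH[1] : ℝ) : EReal) ≤ lift a b α β g T := by
  obtain ⟨R, hRc, hR⟩ := C.exists_rectTriple a b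
  have hcur : R.toCurrent = T := by
    ext w
    rw [R.toCurrent_eq, hT w]
    congr 1
    ext p
    congr 1
    by_cases h : p ∈ R.carrier
    · rw [indicator_of_mem h, hR]
    · rw [indicator_of_notMem h]
      rw [hRc] at h
      exact (not_not.1 h).symm
  have hfl := C.flux_eq hT hcur φ
  have hint : IntegrableOn (R.flux φ) R.carrier μH[1] := by
    rw [← integrable_indicator_iff R.measurableSet_carrier]
    exact hi.congr hfl.symm
  have he : ∫ p, cross (φ p) (C.density a b p) ∂μH[1] = ∫ p in R.carrier, R.flux φ p ∂μH[1] := by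
    rw [← integral_indicator R.measurableSet_carrier]
    exact integral_congr_ae hfl.symm
  rw [he, lift]
  exact le_iSup_of_le R (le_iSup_of_le hcur (le_iSup_of_le φ (le_iSup_of_le hφ
    (le_iSup_of_le hint le_rfl))))

theorem lift_le (hT : C.Represents T) {α β : ℝ} {g : ℝ → ℝ} {c : EReal}
    (h : ∀ φ, Admissible a b α β g φ →
      Integrable (fun p => cross (φ p) (C.density a b p)) μH[1] →
      ((∫ p, cross (φ p) (C.density a b p) ∂μH[1] : ℝ) : EReal) ≤ c) :
    lift a b α β g T ≤ c := by
  refine iSup_le fun R => iSup_le fun hcur => iSup_le fun φ => iSup_le fun hφ => iSup_le fun hi => ?_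
  have hfl := C.flux_eq hT hcur φ
  rw [← integrable_indicator_iff R.measurableSet_carrier] at hi
  rw [← integral_indicator R.measurableSet_carrier, integral_congr_ae hfl]
  exact h φ hφ (hi.congr hfl)

theorem density_eq_zero_of_restrictEqZero (hT : C.Represents T) {A : Set ℝ} (hA : MeasurableSet A)
    (h : RestrictEqZero T {p | p 0 ∈ A}) :
    ∀ᵐ p ∂(μH[1] : Measure Plane), p 0 ∈ A → C.density a b p = 0 := by
  obtain ⟨R, hcur, hR⟩ := h
  have h0 : Measurable fun p : Plane => p 0 := by fun_prop
  have hAm : MeasurableSet {p : Plane | p 0 ∈ A} := h0 hA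
  have hd := C.ae_density_eq hT hcur
  have h1 : ∀ᵐ p ∂(μH[1] : Measure Plane), {p : Plane | p 0 ∈ A}.indicator
      (R.carrier.indicator fun p => R.mult p • R.orient p) p = (0 : Plane → Plane) p := by
    refine ae_eq_of_forall_form (a := a) (b := b) (R.integrable_density.indicator hAm)
      (integrable_zero _ _ _) (fun p hp => ?_) (fun _ _ => rfl) fun w => ?_
    · by_cases hpA : p ∈ {p : Plane | p 0 ∈ A}
      · rw [indicator_of_mem hpA]
        exact indicator_of_notMem (fun h => hp (R.carrier_subset h)) _
      · exact indicator_of_notMem hpA _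
    · have h2 := congrFun hR w
      simp only [Pi.zero_apply, map_zero, integral_zero]
      rw [RectTriple.restrict, ← integral_indicator (R.measurableSet_carrier.inter hAm)] at h2
      refine Eq.trans ?_ h2
      congr 1
      ext p
      by_cases hpA : p 0 ∈ A <;> by_cases hpc : p ∈ R.carrier <;>
        simp [indicator, hpA, hpc, mul_comm]
  filter_upwards [hd, h1] with p h2 h3 hpA
  rw [← h2]
  rwa [indicator_of_mem (show p ∈ {p : Plane | p 0 ∈ A} from hpA)] at h3

end Chain

/-! ### Slices -/

/-- The signed measure `∑ᵢ λᵢ δ_{zᵢ}`. -/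
def slice {ι : Type*} [Fintype ι] (c z : ι → ℝ) : ℝ →₀ ℝ := ∑ i, Finsupp.single (z i) (c i)

section Slice

variable {ι : Type*} [Fintype ι] (c : ι → ℝ)

open Classical in
theorem slice_apply (z : ι → ℝ) (t : ℝ) : slice c z t = ∑ i, if z i = t then c i else 0 := by
  simp [slice, Finsupp.finsetSum_apply, Finsupp.single_apply]

/-- Equal values are collected. Such a sum thus depends on the signed measure alone, in which graphs
may cancel, and not on the labelling of the graphs. -/
theorem sum_mul_eq (z : ι → ℝ) (h : ℝ → ℝ) :
    ∑ i, c i * h (z i) = ∑ t ∈ (slice c z).support, slice c z t * h t := by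
  have h1 : Finsupp.linearCombination ℝ h (slice c z) = ∑ i, c i * h (z i) := by
    simp [slice, map_sum, Finsupp.linearCombination_single]
  rw [← h1, Finsupp.linearCombination_apply, Finsupp.sum]
  rfl

theorem sum_mul_congr {z z' : ι → ℝ} (hz : slice c z = slice c z') (h : ℝ → ℝ) :
    ∑ i, c i * h (z i) = ∑ i, c i * h (z' i) := by
  rw [sum_mul_eq, sum_mul_eq, hz]

open Classical in
theorem slice_apply_eq_sum (z : ι → ℝ) (t : ℝ) :
    slice c z t = ∑ i, c i * (if z i = t then 1 else 0) := by
  rw [slice_apply]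
  exact Finset.sum_congr rfl fun i _ => by split_ifs <;> simp

theorem mem_range_of_slice_ne_zero {z : ι → ℝ} {t : ℝ} (h : slice c z t ≠ 0) : ∃ i, z i = t := by
  classical
  by_contra! hne
  exact h (by simp [slice_apply, hne])

open Classical in
theorem sum_neg_part_le (z : ι → ℝ) :
    ∑ i, c i * (if slice c z (z i) < 0 then 1 else 0) ≤ 0 := by
  rw [sum_mul_eq c z (fun t => if slice c z t < 0 then 1 else 0)]
  refine Finset.sum_nonpos fun t _ => ?_
  split_ifs with h
  · simpa using h.le
  · simp

open Classical in
theorem slice_nonneg_of_sum_neg_part (z : ι → ℝ)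
    (h : ∑ i, c i * (if slice c z (z i) < 0 then 1 else 0) = 0) : 0 ≤ slice c z := by
  rw [sum_mul_eq c z (fun t => if slice c z t < 0 then 1 else 0)] at h
  have hle : ∀ t ∈ (slice c z).support, slice c z t * (if slice c z t < 0 then 1 else 0) ≤ 0 := by
    intro t _
    split_ifs with h
    · simpa using h.le
    · simp
  rw [Finset.sum_eq_zero_iff_of_nonpos hle] at h
  intro t
  by_contra hlt
  have hlt' : slice c z t < 0 := not_le.1 hlt
  have := h t (by simpa using hlt'.ne)
  rw [if_pos hlt', mul_one] at this
  exact hlt'.ne this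

theorem slice_neg (z : ι → ℝ) : slice (fun i => -c i) z = -slice c z := by
  ext t
  classical
  simp only [slice_apply, Finsupp.neg_apply, ← Finset.sum_neg_distrib]
  exact Finset.sum_congr rfl fun i _ => by split_ifs <;> simp

end Slice

/-! ### Test fields -/

/-- Fields of class `K` that live on finitely many vertical lines and, elsewhere, have a first
component that is concentrated on countable sets. -/
structure TestField (a b α β : ℝ) (g : ℝ → ℝ) where
  /-- the abscissas of the vertical lines -/
  P : Finset ℝ
  /-- the first component on the vertical lines -/
  ψ : ℝ → ℝ → ℝ
  /-- a null set, over which the field vanishes -/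
  N : Set ℝ
  A : ℝ → ℝ → ℝ
  B : ℝ → ℝ → ℝ
  subset : ∀ y ∈ P, y ∈ Ioo a b
  measurable_ψ : ∀ y ∈ P, Measurable (ψ y)
  integrable_ψ : ∀ y ∈ P, ∀ s t, IntervalIntegrable (ψ y) volume s t
  abs_integral_le : ∀ y ∈ P, ∀ s t, |∫ r in s..t, ψ y r| ≤ α
  measurableSet_N : MeasurableSet N
  volume_N : volume N = 0
  measurable_A : Measurable (Function.uncurry A)
  measurable_B : Measurable (Function.uncurry B)
  countable_A : ∀ x, {t | A x t ≠ 0}.Countable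
  le_B : ∀ x ∈ Ioo a b, x ∉ N → ∀ t, A x t ^ 2 / 4 - β * (t - g x) ^ 2 ≤ B x t

namespace TestField

variable {a b α β : ℝ} {g : ℝ → ℝ} (F : TestField a b α β g)

open Classical in
/-- The vertical part of the first component. -/
def vertical (p : Plane) : ℝ := ∑ y ∈ F.P, if p 0 = y then F.ψ y (p 1) else 0

open Classical in
/-- The vector field of a test field. -/
def field (p : Plane) : Plane :=
  -- Over `P` the second component is the least one that is admissible when `β (t - g)²` is dropped;
  -- it never enters a flux, as `P` is null. Over the rest of `N` the field vanishes, so other jumps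
  -- contribute nothing.
  if p 0 ∈ F.P then !₂[F.vertical p, F.vertical p ^ 2 / 4]
  else if p 0 ∈ F.N then 0 else !₂[F.A (p 0) (p 1), F.B (p 0) (p 1)]

theorem vertical_of_mem {p : Plane} (hp : p 0 ∈ F.P) : F.vertical p = F.ψ (p 0) (p 1) := by
  classical
  simp [vertical, hp]

theorem measurable_field : Measurable F.field := by
  classical
  have h0 : Measurable fun p : Plane => p 0 := by fun_prop
  have h1 : Measurable fun p : Plane => p 1 := by fun_prop
  have hv : Measurable F.vertical := by
    unfold vertical
    refine Finset.measurable_fun_sum _ fun y hy => ?_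
    exact Measurable.ite (h0 (measurableSet_singleton y)) ((F.measurable_ψ y hy).comp h1)
      measurable_const
  unfold field
  refine Measurable.ite (h0 F.P.measurableSet) (measurable_plane_mk hv ((hv.pow_const 2).div_const 4))
    (Measurable.ite (h0 F.measurableSet_N) measurable_const ?_)
  exact measurable_plane_mk (F.measurable_A.comp (h0.prodMk h1)) (F.measurable_B.comp (h0.prodMk h1))

theorem field_mk_of_mem {x t : ℝ} (hx : x ∈ F.P) :
    F.field !₂[x, t] = !₂[F.ψ x t, F.ψ x t ^ 2 / 4] := by
  have h0 : (!₂[x, t] : Plane) 0 = x := by simp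
  have h1 : (!₂[x, t] : Plane) 1 = t := by simp
  rw [field, if_pos (by rwa [h0]), F.vertical_of_mem (by rwa [h0]), h0, h1]

theorem field_mk_of_mem_N {x t : ℝ} (hx : x ∉ F.P) (hx' : x ∈ F.N) : F.field !₂[x, t] = 0 := by
  have h0 : (!₂[x, t] : Plane) 0 = x := by simp
  rw [field, if_neg (by rwa [h0]), if_pos (by rwa [h0])]

theorem field_mk_of_notMem {x t : ℝ} (hx : x ∉ F.P) (hx' : x ∉ F.N) :
    F.field !₂[x, t] = !₂[F.A x t, F.B x t] := by
  have h0 : (!₂[x, t] : Plane) 0 = x := by simp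
  have h1 : (!₂[x, t] : Plane) 1 = t := by simp
  rw [field, if_neg (by rwa [h0]), if_neg (by rwa [h0]), h0, h1]

theorem admissible (hα : 0 ≤ α) (hβ : 0 ≤ β) : Admissible a b α β g F.field := by
  refine ⟨F.measurable_field, fun x hx t => ?_, fun x hx t₁ t₂ => ?_⟩
  · have hpos : 0 ≤ β * (t - g x) ^ 2 := by positivity
    by_cases hP : x ∈ F.P
    · rw [F.field_mk_of_mem hP]; simpa using hpos
    by_cases hN : x ∈ F.N
    · rw [F.field_mk_of_mem_N hP hN]; simpa using hpos
    · rw [F.field_mk_of_notMem hP hN]; simpa using F.le_B x hx hN t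
  · by_cases hP : x ∈ F.P
    · have : ∀ s, F.field !₂[x, s] 0 = F.ψ x s := fun s => by rw [F.field_mk_of_mem hP]; simp
      simp_rw [this]
      exact ⟨F.integrable_ψ x hP _ _, F.abs_integral_le x hP _ _⟩
    by_cases hN : x ∈ F.N
    · have : ∀ s, F.field !₂[x, s] 0 = 0 := fun s => by rw [F.field_mk_of_mem_N hP hN]; simp
      simp_rw [this]
      simpa using hα
    · have : ∀ s, F.field !₂[x, s] 0 = F.A x s := fun s => by
        rw [F.field_mk_of_notMem hP hN]; simp
      simp_rw [this]
      -- Here the countable support matters: all vertical integrals of the first component are zero,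
      -- whatever its values are.
      have hae : (fun _ => (0 : ℝ)) =ᵐ[volume] F.A x := by
        filter_upwards [measure_eq_zero_iff_ae_notMem.1 ((F.countable_A x).measure_zero volume)]
          with s hs
        exact (not_not.1 hs).symm
      constructor
      · exact (intervalIntegrable_const (c := (0 : ℝ))).congr_ae (ae_restrict_of_ae hae)
      · rw [intervalIntegral.integral_congr_ae (g := fun _ => (0 : ℝ))
          (by filter_upwards [hae] with s hs _ using hs.symm)]
        simpa using hα

/-- The flux of a test field through an extended graph. -/
def flux (D : SBVData) : ℝ :=
  (∫ x in Ioo a b, (F.A x (D.L x) * D.slope x - F.B x (D.L x))) +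
    ∑ y ∈ F.P, ∫ t in D.L y..D.R y, F.ψ y t

/-- The test field is integrable on the graph of `D`. -/
def IntegrableFor (D : SBVData) : Prop :=
  D.jumps ⊆ F.N ∧
    IntegrableOn (fun x => F.A x (D.L x) * D.slope x - F.B x (D.L x)) (Ioo a b)

variable {F}

theorem ae_notMem : ∀ᵐ x, x ∉ F.P ∧ x ∉ F.N := by
  filter_upwards [measure_eq_zero_iff_ae_notMem.1 F.volume_N,
    measure_eq_zero_iff_ae_notMem.1 (F.P.countable_toSet.measure_zero volume)] with x h1 h2
  exact ⟨h2, h1⟩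

theorem IntegrableFor.integrable_cross {D : SBVData} (h : F.IntegrableFor D) :
    Integrable (fun p => cross (F.field p) (D.density a b p)) μH[1] := by
  refine D.integrable_cross_of_finite a b F.measurable_field ?_ F.P ?_ ?_
  · refine h.2.congr (ae_restrict_of_ae ?_)
    filter_upwards [F.ae_notMem] with x hx
    rw [graphMap, F.field_mk_of_notMem hx.1 hx.2]
    simp
  · intro x hx hxP t
    rw [vert, F.field_mk_of_mem_N hxP (h.1 hx)]
    simp
  · intro x hx s t
    have : ∀ t, F.field (vert x t) 0 = F.ψ x t := fun t => by
      rw [vert, F.field_mk_of_mem hx]; simp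
    simp_rw [this]
    exact F.integrable_ψ x hx s t

theorem IntegrableFor.integral_cross {D : SBVData} (h : F.IntegrableFor D) :
    ∫ p, cross (F.field p) (D.density a b p) ∂μH[1] = F.flux D := by
  rw [D.integral_cross a b F.measurable_field h.integrable_cross, flux]
  congr 1
  · refine integral_congr_ae (ae_restrict_of_ae ?_)
    filter_upwards [F.ae_notMem] with x hx
    rw [graphMap, F.field_mk_of_notMem hx.1 hx.2]
    simp
  · rw [tsum_subtype (D.jumps ∩ Ioo a b) (fun x => ∫ t in D.L x..D.R x, F.field (vert x t) 0),
      tsum_eq_sum (s := F.P)]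
    · refine Finset.sum_congr rfl fun y hy => ?_
      have : ∀ t, F.field (vert y t) 0 = F.ψ y t := fun t => by
        rw [vert, F.field_mk_of_mem hy]; simp
      simp_rw [indicator, this]
      split_ifs with hmem
      · rfl
      · have hj : y ∉ D.jumps := fun hj => hmem ⟨hj, F.subset y hy⟩
        rw [D.L_eq_R_iff.2 hj, intervalIntegral.integral_same]
    · intro x hx
      by_cases hmem : x ∈ D.jumps ∩ Ioo a b
      · rw [indicator_of_mem hmem]
        have : ∀ t, F.field (vert x t) 0 = 0 := fun t => by
          rw [vert, F.field_mk_of_mem_N hx (h.1 hmem.1)]; simp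
        simp [this]
      · exact indicator_of_notMem hmem _

variable {ι : Type*} [Fintype ι] {C : Chain ι}

theorem integrable_cross_chain (h : ∀ i, F.IntegrableFor (C.data i)) :
    Integrable (fun p => cross (F.field p) (C.density a b p)) μH[1] := by
  simp only [Chain.density, cross_sum]
  exact integrable_finsetSum _ fun i _ => (h i).integrable_cross.const_mul _

theorem integral_cross_chain (h : ∀ i, F.IntegrableFor (C.data i)) :
    ∫ p, cross (F.field p) (C.density a b p) ∂μH[1] = ∑ i, C.coeff i * F.flux (C.data i) := by
  simp only [Chain.density, cross_sum]
  rw [integral_finsetSum _ fun i _ => (h i).integrable_cross.const_mul _]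
  refine Finset.sum_congr rfl fun i _ => ?_
  rw [integral_const_mul, (h i).integral_cross]

theorem sum_flux_le_lift (hα : 0 ≤ α) (hβ : 0 ≤ β) {T : FormFunctional a b} (hT : C.Represents T)
    (h : ∀ i, F.IntegrableFor (C.data i)) :
    ((∑ i, C.coeff i * F.flux (C.data i) : ℝ) : EReal) ≤ lift a b α β g T := by
  rw [← integral_cross_chain h]
  exact C.le_lift hT (F.admissible hα hβ) (integrable_cross_chain h)

theorem sum_flux_eq (h : ∀ i, F.IntegrableFor (C.data i)) :
    ∑ i, C.coeff i * F.flux (C.data i) =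
      (∫ x in Ioo a b, ∑ i, C.coeff i * (F.A x ((C.data i).L x) * (C.data i).slope x -
        F.B x ((C.data i).L x))) +
      ∑ y ∈ F.P, ∑ i, C.coeff i * ∫ t in (C.data i).L y..(C.data i).R y, F.ψ y t := by
  rw [integral_finsetSum _ fun i _ => (h i).2.const_mul _, Finset.sum_comm,
    ← Finset.sum_add_distrib]
  refine Finset.sum_congr rfl fun i _ => ?_
  rw [flux, mul_add, integral_const_mul, Finset.mul_sum]

end TestField

/-! ### Consequences of a finite lifted energy -/

/-- A function on a finite set with oscillation at most `α` is interpolated by a function with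
derivative `ψ`, and with oscillation at most `α`. -/
theorem exists_interpolation {α : ℝ} (hα : 0 ≤ α) (Z : Finset ℝ) (h : ℝ → ℝ)
    (hosc : ∀ s ∈ Z, ∀ t ∈ Z, h s - h t ≤ α) :
    ∃ ψ : ℝ → ℝ, Measurable ψ ∧ (∀ s t, IntervalIntegrable ψ volume s t) ∧
      (∀ s t, |∫ r in s..t, ψ r| ≤ α) ∧ ∀ s ∈ Z, ∀ t ∈ Z, ∫ r in s..t, ψ r = h t - h s := by
  rcases Z.eq_empty_or_nonempty with rfl | hZ
  · exact ⟨fun _ => 0, measurable_const, fun _ _ => intervalIntegrable_const, fun _ _ => by simpa using hα, by simp⟩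
  obtain ⟨z, hz, hmin⟩ := Z.exists_min_image h hZ
  -- The sum of all difference quotients on `Z` is a Lipschitz constant for `h` there.
  let K : ℝ := ∑ s ∈ Z, ∑ t ∈ Z, |h s - h t| / |s - t|
  have hK0 : 0 ≤ K := Finset.sum_nonneg fun s _ => Finset.sum_nonneg fun t _ => by positivity
  have hlip : LipschitzOnWith K.toNNReal h (Z : Set ℝ) := by
    refine LipschitzOnWith.of_dist_le_mul fun s hs t ht => ?_
    rw [Real.dist_eq, Real.dist_eq, Real.coe_toNNReal _ hK0]
    rcases eq_or_ne s t with rfl | hne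
    · simp
    · have hpos : 0 < |s - t| := abs_pos.2 (sub_ne_zero.2 hne)
      rw [← div_le_iff₀ hpos]
      calc |h s - h t| / |s - t| ≤ ∑ t ∈ Z, |h s - h t| / |s - t| :=
            Finset.single_le_sum (f := fun t => |h s - h t| / |s - t|)
              (fun t _ => by positivity) ht
        _ ≤ K := Finset.single_le_sum (f := fun s => ∑ t ∈ Z, |h s - h t| / |s - t|)
              (fun s _ => Finset.sum_nonneg fun t _ => by positivity) hs
  obtain ⟨f, hf, hfh⟩ := hlip.extend_real
  -- A Lipschitz extension, cut off to `[min h, min h + α]`: this leaves the values on `Z` unchanged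
  -- and forces the oscillation below `α`. Its derivative is `ψ`.
  let k : ℝ → ℝ := fun x => max (h z) (min (f x) (h z + α))
  have hk : LipschitzWith K.toNNReal k := (hf.min_const _).const_max _
  have hac : ∀ s t, AbsolutelyContinuousOnInterval k s t := fun s t =>
    hk.lipschitzOnWith.absolutelyContinuousOnInterval
  have hint : ∀ s t, ∫ r in s..t, deriv k r = k t - k s := fun s t => (hac s t).integral_deriv_eq_sub
  have hkb : ∀ x, h z ≤ k x ∧ k x ≤ h z + α := fun x =>
    ⟨le_max_left _ _, max_le (by linarith) (min_le_right _ _)⟩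
  have hkZ : ∀ s ∈ Z, k s = h s := by
    intro s hs
    have h1 := hmin s hs
    have h2 := hosc s hs z hz
    simp only [k]
    rw [← hfh hs, min_eq_left (by linarith), max_eq_right h1]
  refine ⟨deriv k, measurable_deriv _, fun s t => (hac s t).intervalIntegrable_deriv,
    fun s t => ?_, fun s hs t ht => ?_⟩
  · rw [hint, abs_le]
    constructor <;> linarith [(hkb s).1, (hkb s).2, (hkb t).1, (hkb t).2]
  · rw [hint, hkZ s hs, hkZ t ht]

/-- The fields that are built from `g` have to be Borel, and bounds for `g` are wanted at every
point. The null set where `g` and `G` differ goes into the set `N` of the test fields. -/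
theorem exists_bounded_measurable_rep {a b : ℝ} {g : ℝ → ℝ}
    (hg : MemLp g ⊤ (volume.restrict (Ioo a b))) :
    ∃ (G : ℝ → ℝ) (M : ℝ), Measurable G ∧ (∀ x, |G x| ≤ M) ∧
      ∀ᵐ x, x ∈ Ioo a b → g x = G x := by
  obtain ⟨f, hf, hfg⟩ := hg.1
  have hb := hg.2
  rw [eLpNorm_exponent_top] at hb
  obtain ⟨M, hM⟩ : ∃ M : ℝ, ∀ᵐ x ∂volume.restrict (Ioo a b), ‖g x‖ ≤ M := by
    refine ⟨(eLpNormEssSup g (volume.restrict (Ioo a b))).toReal, ?_⟩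
    filter_upwards [ae_le_eLpNormEssSup (f := g) (μ := volume.restrict (Ioo a b))] with x hx
    have := ENNReal.toReal_mono hb.ne hx
    simpa using this
  refine ⟨fun x => max (-|M|) (min (f x) |M|), |M|, measurable_const.max
    (hf.measurable.min measurable_const), fun x => ?_, ?_⟩
  · rw [abs_le]
    exact ⟨le_max_left _ _, max_le (by linarith [abs_nonneg M]) (min_le_right _ _)⟩
  · rw [← ae_restrict_iff' measurableSet_Ioo]
    filter_upwards [hfg, hM] with x h1 h2
    rw [h1, Real.norm_eq_abs] at h2
    have h3 := abs_le.1 (h2.trans (le_abs_self M))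
    rw [h1, min_eq_left h3.2, max_eq_right h3.1]

/-! ### Slices and common slopes of a chain -/

namespace Chain

variable {ι : Type*} [Fintype ι] (C : Chain ι)

/-- The left slice of a chain. -/
def sliceL (x : ℝ) : ℝ →₀ ℝ := slice C.coeff fun i => (C.data i).L x

/-- The right slice of a chain. -/
def sliceR (x : ℝ) : ℝ →₀ ℝ := slice C.coeff fun i => (C.data i).R x

theorem measurable_sliceL : Measurable (Function.uncurry fun x t => C.sliceL x t) := by
  classical
  have : (Function.uncurry fun x t => C.sliceL x t) =
      fun q : ℝ × ℝ => ∑ i, if (C.data i).L q.1 = q.2 then C.coeff i else 0 := by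
    ext q; simp [Function.uncurry, sliceL, slice_apply]
  rw [this]
  exact Finset.measurable_fun_sum _ fun i _ => Measurable.ite
    (measurableSet_eq_fun ((C.data i).measurable_L.comp measurable_fst) measurable_snd)
    measurable_const measurable_const

open Classical in
/-- The common slope of the graphs of a chain through the point `(x, t)`. -/
def slope (x t : ℝ) : ℝ :=
  -- A mean over the graphs through the point, which is jointly measurable; off the graphs it is `0
  -- / 0 = 0`, so it has finite support in `t`.
  (∑ i, if (C.data i).L x = t then (C.data i).slope x else 0) /
    ∑ i, if (C.data i).L x = t then 1 else 0

theorem measurable_slope : Measurable (Function.uncurry C.slope) := by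
  classical
  have hset : ∀ i, MeasurableSet {q : ℝ × ℝ | (C.data i).L q.1 = q.2} := fun i =>
    measurableSet_eq_fun ((C.data i).measurable_L.comp measurable_fst) measurable_snd
  have : Function.uncurry C.slope = fun q : ℝ × ℝ =>
      (∑ i, if (C.data i).L q.1 = q.2 then (C.data i).slope q.1 else 0) /
        ∑ i, if (C.data i).L q.1 = q.2 then 1 else 0 := by
    ext q; simp [Function.uncurry, slope]
  rw [this]
  exact (Finset.measurable_fun_sum _ fun i _ => Measurable.ite (hset i)
    ((C.data i).measurable_slope.comp measurable_fst) measurable_const).div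
    (Finset.measurable_fun_sum _ fun i _ => Measurable.ite (hset i) measurable_const
      measurable_const)

theorem countable_slope (x : ℝ) : {t | C.slope x t ≠ 0}.Countable := by
  refine (Set.finite_range fun i => (C.data i).L x).countable.mono fun t ht => ?_
  by_contra h
  simp only [mem_range, not_exists] at h
  exact ht (by simp [slope, h])

theorem ae_slope_L : ∀ᵐ x, ∀ i, C.slope x ((C.data i).L x) = (C.data i).slope x := by
  classical
  filter_upwards [C.ae_slope_eq] with x hx i
  have h1 : (∑ j, if (C.data j).L x = (C.data i).L x then (C.data j).slope x else 0) =
      (∑ j, if (C.data j).L x = (C.data i).L x then 1 else 0) * (C.data i).slope x := by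
    rw [Finset.sum_mul]
    refine Finset.sum_congr rfl fun j _ => ?_
    split_ifs with h
    · rw [hx j i h, one_mul]
    · rw [zero_mul]
  have h2 : (∑ j, if (C.data j).L x = (C.data i).L x then (1 : ℝ) else 0) ≠ 0 := by
    refine (Finset.sum_pos' (fun j _ => by split_ifs <;> simp) ⟨i, Finset.mem_univ _, by simp⟩).ne'
  rw [slope, h1, mul_div_cancel_left₀ _ h2]

/-- The null set over which the test fields for a chain vanish. -/
theorem exists_null_set {a b : ℝ} {g G : ℝ → ℝ} (hgG : ∀ᵐ x, x ∈ Ioo a b → g x = G x) :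
    ∃ N : Set ℝ, MeasurableSet N ∧ volume N = 0 ∧ (∀ i, (C.data i).jumps ⊆ N) ∧
      ∀ x ∈ Ioo a b, x ∉ N → g x = G x := by
  refine ⟨toMeasurable volume {x | ¬ (x ∈ Ioo a b → g x = G x)} ∪ C.jumps,
    (measurableSet_toMeasurable _ _).union C.countable_jumps.measurableSet,
    measure_union_null ?_ (C.countable_jumps.measure_zero _),
    fun i x hx => Or.inr (mem_iUnion.2 ⟨i, hx⟩), fun x hx hN => ?_⟩
  · rw [measure_toMeasurable]; exact hgG
  · by_contra hne
    exact hN (Or.inl (subset_toMeasurable _ _ fun h => hne (h hx)))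

/-! ### Finite lifted energy: positive slices and finitely many jumps -/

section

variable {a b α β : ℝ} {g : ℝ → ℝ}

open Classical in
/-- The field that detects negative multiplicities over `S`. -/
def negField (hβ : 0 ≤ β) (n : ℕ) {N S : Set ℝ} (hN : MeasurableSet N)
    (hN0 : volume N = 0) (hS : MeasurableSet S) : TestField a b α β g where
  P := ∅
  ψ := 0
  N := N
  A := 0
  B x t := if x ∈ S ∧ C.sliceL x t < 0 then n else 0
  subset := by simp
  measurable_ψ := by simp
  integrable_ψ := by simp
  abs_integral_le := by simp
  measurableSet_N := hN
  volume_N := hN0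
  measurable_A := measurable_const
  measurable_B := Measurable.ite ((measurable_fst hS).inter
    (C.measurable_sliceL measurableSet_Iio)) measurable_const measurable_const
  countable_A := by simp
  le_B x _ _ t := by
    have : 0 ≤ β * (t - g x) ^ 2 := by positivity
    simp only [Pi.zero_apply]
    split_ifs
    · have := n.cast_nonneg (α := ℝ); linarith
    · linarith

theorem negField_integrableFor (hβ : 0 ≤ β) (n : ℕ) {N S : Set ℝ}
    (hN : MeasurableSet N) (hN0 : volume N = 0) (hS : MeasurableSet S)
    (hNj : ∀ i, (C.data i).jumps ⊆ N) (i : ι) :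
    (C.negField hβ n hN hN0 hS : TestField a b α β g).IntegrableFor (C.data i) := by
  classical
  refine ⟨hNj i, ?_⟩
  refine Measure.integrableOn_of_bounded (M := n) (by simp) ?_ (Eventually.of_forall fun x => ?_)
  · have hB := (C.negField hβ n hN hN0 hS : TestField a b α β g).measurable_B
    have hA := (C.negField hβ n hN hN0 hS : TestField a b α β g).measurable_A
    have hp : Measurable fun x => (x, (C.data i).L x) := measurable_id.prodMk (C.data i).measurable_L
    exact (((hA.comp hp).mul (C.data i).measurable_slope).sub (hB.comp hp)).aestronglyMeasurable
  · simp only [negField, Pi.zero_apply, zero_mul, zero_sub, norm_neg]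
    split_ifs <;> simp

open Classical in
theorem negField_sum_flux (hβ : 0 ≤ β) (n : ℕ) {N S : Set ℝ}
    (hN : MeasurableSet N) (hN0 : volume N = 0) (hS : MeasurableSet S)
    (hNj : ∀ i, (C.data i).jumps ⊆ N) :
    ∑ i, C.coeff i * (C.negField hβ n hN hN0 hS : TestField a b α β g).flux (C.data i) =
      n * ∫ x in Ioo a b, -(if x ∈ S then ∑ i, C.coeff i *
        (if C.sliceL x ((C.data i).L x) < 0 then 1 else 0) else 0) := by
  rw [TestField.sum_flux_eq (C.negField_integrableFor hβ n hN hN0 hS hNj)]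
  simp only [negField, Pi.zero_apply, zero_mul, zero_sub, Finset.sum_empty, add_zero]
  rw [← integral_const_mul]
  congr 1
  ext x
  by_cases hx : x ∈ S
  · simp only [hx, true_and, if_true, Finset.mul_sum, ← Finset.sum_neg_distrib]
    refine Finset.sum_congr rfl fun i _ => ?_
    split_ifs <;> ring
  · simp [hx]

/-- The second component of a field enters the flux with a minus sign and is bounded below only.
Setting it to `n` on the negative part gives `n` times a fixed nonnegative integral, which must
vanish if these fluxes are bounded in `n`. -/
theorem sliceL_nonneg_of_integral_le (hβ : 0 ≤ β) {N S : Set ℝ}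
    (hN : MeasurableSet N) (hN0 : volume N = 0) (hS : MeasurableSet S)
    (hNj : ∀ i, (C.data i).jumps ⊆ N) {M : ℝ}
    (hM : ∀ n : ℕ, ∑ i, C.coeff i *
      (C.negField hβ n hN hN0 hS : TestField a b α β g).flux (C.data i) ≤ M) :
    ∀ᵐ x, x ∈ Ioo a b → x ∈ S → 0 ≤ C.sliceL x := by
  classical
  simp_rw [C.negField_sum_flux hβ _ hN hN0 hS hNj] at hM
  set f : ℝ → ℝ := fun x => -(if x ∈ S then ∑ i, C.coeff i *
        (if C.sliceL x ((C.data i).L x) < 0 then 1 else 0) else 0) with hf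
  have hf0 : ∀ x, 0 ≤ f x := by
    intro x
    simp only [hf]
    split_ifs
    · rw [neg_nonneg]; exact sum_neg_part_le _ _
    · simp
  have hle : ∫ x in Ioo a b, f x ≤ 0 := by
    by_contra hpos
    push Not at hpos
    obtain ⟨n, hn⟩ := exists_nat_gt (M / ∫ x in Ioo a b, f x)
    rw [div_lt_iff₀ hpos] at hn
    exact absurd (hM n) (not_le.2 hn)
  have hfi : IntegrableOn f (Ioo a b) := by
    have hm : Measurable f := by
      refine (Measurable.ite hS (Finset.measurable_fun_sum _ fun i _ => ?_) measurable_const).neg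
      refine measurable_const.mul (Measurable.ite ?_ measurable_const measurable_const)
      have hp : Measurable fun x => (x, (C.data i).L x) :=
        measurable_id.prodMk (C.data i).measurable_L
      exact (C.measurable_sliceL.comp hp) measurableSet_Iio
    refine Measure.integrableOn_of_bounded (M := ∑ i, |C.coeff i|) (by simp)
      hm.aestronglyMeasurable (Eventually.of_forall fun x => ?_)
    simp only [hf, norm_neg]
    split_ifs
    · refine (norm_sum_le _ _).trans (Finset.sum_le_sum fun i _ => ?_)
      rw [norm_mul, Real.norm_eq_abs]
      split_ifs <;> simp
    · simpa using Finset.sum_nonneg fun i _ => abs_nonneg (C.coeff i)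
  have hz := (setIntegral_eq_zero_iff_of_nonneg_ae (Eventually.of_forall hf0) hfi).1
    (le_antisymm hle (integral_nonneg hf0))
  rw [EventuallyEq, ae_restrict_iff' measurableSet_Ioo] at hz
  filter_upwards [hz] with x hx hxI hxS
  have h1 := hx hxI
  simp only [hf, if_pos hxS, Pi.zero_apply, neg_eq_zero] at h1
  exact slice_nonneg_of_sum_neg_part _ _ h1

/-- A lower bound for the nonzero differences of multiplicities. -/
theorem exists_gap (c : ι → ℝ) : ∃ δ : ℝ, 0 < δ ∧ (∀ z z' : ι → ℝ, ∀ t t',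
    slice c z t ≠ slice c z' t' → δ ≤ |slice c z t - slice c z' t'|) ∧
    ∀ z : ι → ℝ, ∀ t, 0 < slice c z t → δ ≤ slice c z t := by
  classical
  -- A multiplicity is the sum of the coefficients of a subfamily, so only finitely many values
  -- occur.
  let S : Finset ℝ := (Finset.univ : Finset (Finset ι)).image fun s => ∑ i ∈ s, c i
  have hmem : ∀ (z : ι → ℝ) t, slice c z t ∈ S := by
    intro z t
    rw [slice_apply, ← Finset.sum_filter]
    exact Finset.mem_image_of_mem _ (Finset.mem_univ _)
  have h0 : (0 : ℝ) ∈ S := Finset.mem_image.2 ⟨∅, Finset.mem_univ _, by simp⟩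
  -- The `1` keeps the set of gaps nonempty, so that it has a minimum.
  let E : Finset ℝ := insert 1 ((((S ×ˢ S).filter fun q => q.1 ≠ q.2)).image fun q => |q.1 - q.2|)
  have hE : ∀ e ∈ E, 0 < e := by
    intro e he
    rcases Finset.mem_insert.1 he with rfl | he
    · exact one_pos
    · obtain ⟨q, hq, rfl⟩ := Finset.mem_image.1 he
      exact abs_pos.2 (sub_ne_zero.2 (Finset.mem_filter.1 hq).2)
  have hEn : E.Nonempty := ⟨1, Finset.mem_insert_self _ _⟩
  have hgap : ∀ p ∈ S, ∀ q ∈ S, p ≠ q → E.min' hEn ≤ |p - q| := fun p hp q hq hne =>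
    Finset.min'_le _ _ (Finset.mem_insert_of_mem (Finset.mem_image.2
      ⟨(p, q), Finset.mem_filter.2 ⟨Finset.mem_product.2 ⟨hp, hq⟩, hne⟩, rfl⟩))
  refine ⟨E.min' hEn, hE _ (E.min'_mem hEn), fun z z' t t' h => hgap _ (hmem z t) _ (hmem z' t') h,
    fun z t h => ?_⟩
  have := hgap _ (hmem z t) 0 h0 h.ne'
  rwa [sub_zero, abs_of_pos h] at this

/-- The points at which the slice of a chain jumps. -/
def trueJumps : Set ℝ := {x | C.sliceL x ≠ C.sliceR x}

open Classical in
/-- The field on the vertical lines over a finite set. -/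
def vertField (hβ : 0 ≤ β) (P : Finset ℝ) (hP : ∀ y ∈ P, y ∈ Ioo a b)
    {N : Set ℝ} (hN : MeasurableSet N) (hN0 : volume N = 0) (ψ : ℝ → ℝ → ℝ)
    (h : ∀ y, Measurable (ψ y) ∧ (∀ s t, IntervalIntegrable (ψ y) volume s t) ∧
      (∀ s t, |∫ r in s..t, ψ y r| ≤ α)) : TestField a b α β g where
  P := P
  ψ := ψ
  N := N
  A := 0
  B := 0
  subset := hP
  measurable_ψ y _ := (h y).1
  integrable_ψ y _ := (h y).2.1
  abs_integral_le y _ := (h y).2.2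
  measurableSet_N := hN
  volume_N := hN0
  measurable_A := measurable_const
  measurable_B := measurable_const
  countable_A := by simp
  le_B x _ _ t := by
    have : 0 ≤ β * (t - g x) ^ 2 := by positivity
    simp; linarith

theorem vertField_sum_flux (hβ : 0 ≤ β) (P : Finset ℝ) (hP : ∀ y ∈ P, y ∈ Ioo a b)
    {N : Set ℝ} (hN : MeasurableSet N) (hN0 : volume N = 0) (ψ : ℝ → ℝ → ℝ)
    (h : ∀ y, Measurable (ψ y) ∧ (∀ s t, IntervalIntegrable (ψ y) volume s t) ∧
      (∀ s t, |∫ r in s..t, ψ y r| ≤ α)) (hNj : ∀ i, (C.data i).jumps ⊆ N) :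
    (∀ i, (vertField hβ P hP hN hN0 ψ h : TestField a b α β g).IntegrableFor (C.data i)) ∧
    ∑ i, C.coeff i * (vertField hβ P hP hN hN0 ψ h : TestField a b α β g).flux (C.data i) =
      ∑ y ∈ P, ∑ i, C.coeff i * ∫ t in (C.data i).L y..(C.data i).R y, ψ y t := by
  have hi : ∀ i, (vertField hβ P hP hN hN0 ψ h : TestField a b α β g).IntegrableFor
      (C.data i) := fun i => ⟨hNj i, by simp [vertField]⟩
  refine ⟨hi, ?_⟩
  rw [TestField.sum_flux_eq hi]
  simp [vertField]

/-- The values of a chain at a point. -/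
def values (y : ℝ) : Finset ℝ :=
  Finset.univ.image (fun i => (C.data i).L y) ∪ Finset.univ.image fun i => (C.data i).R y

theorem L_mem_values (y : ℝ) (i : ι) : (C.data i).L y ∈ C.values y :=
  Finset.mem_union_left _ (Finset.mem_image_of_mem _ (Finset.mem_univ i))

theorem R_mem_values (y : ℝ) (i : ι) : (C.data i).R y ∈ C.values y :=
  Finset.mem_union_right _ (Finset.mem_image_of_mem _ (Finset.mem_univ i))

/-- For every function with oscillation at most `α` there is an admissible field on a vertical line
whose flux is given by the increments of the function. -/
theorem exists_vertical (hα : 0 ≤ α) (y : ℝ) (h : ℝ → ℝ) (hosc : ∀ s t, h s - h t ≤ α) :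
    ∃ ψ : ℝ → ℝ, (Measurable ψ ∧ (∀ s t, IntervalIntegrable ψ volume s t) ∧
      (∀ s t, |∫ r in s..t, ψ r| ≤ α)) ∧
      ∀ i, ∫ t in (C.data i).L y..(C.data i).R y, ψ t = h ((C.data i).R y) - h ((C.data i).L y) := by
  obtain ⟨ψ, h1, h2, h3, h4⟩ := exists_interpolation hα (C.values y) h fun s _ t _ => hosc s t
  exact ⟨ψ, ⟨h1, h2, h3⟩, fun i => h4 _ (C.L_mem_values y i) _ (C.R_mem_values y i)⟩

/-- At a true jump the flux of a suitable vertical field is bounded below. -/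
theorem exists_vertical_of_trueJump (hα : 0 < α) {δ : ℝ} (hδ : ∀ z z' : ι → ℝ, ∀ t t',
    slice C.coeff z t ≠ slice C.coeff z' t' → δ ≤ |slice C.coeff z t - slice C.coeff z' t'|)
    {y : ℝ} (hy : y ∈ C.trueJumps) :
    ∃ ψ : ℝ → ℝ, (Measurable ψ ∧ (∀ s t, IntervalIntegrable ψ volume s t) ∧
      (∀ s t, |∫ r in s..t, ψ r| ≤ α)) ∧
      α * δ ≤ ∑ i, C.coeff i * ∫ t in (C.data i).L y..(C.data i).R y, ψ t := by
  classical
  obtain ⟨t, ht⟩ : ∃ t, C.sliceL y t ≠ C.sliceR y t := by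
    by_contra! h
    exact hy (Finsupp.ext h)
  have hgap := hδ _ _ t t ht
  have ind : ∀ (k : ℝ) (z : ι → ℝ), ∑ i, C.coeff i * (if z i = t then k else 0) =
      k * slice C.coeff z t := by
    intro k z
    rw [slice_apply, Finset.mul_sum]
    refine Finset.sum_congr rfl fun i _ => ?_
    split_ifs <;> ring
  rcases le_total (C.sliceL y t) (C.sliceR y t) with hle | hle <;>
    simp only [sliceL, sliceR] at hle
  -- The function `α` at `t` and `0` elsewhere has oscillation `α`, and its increments give `α`
  -- times the change of the multiplicity at `t`. The other case changes the sign.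
  · obtain ⟨ψ, h1, h2⟩ := C.exists_vertical hα.le y (fun s => if s = t then α else 0)
      (fun s r => by split_ifs <;> linarith)
    refine ⟨ψ, h1, ?_⟩
    simp_rw [h2, mul_sub, Finset.sum_sub_distrib]
    rw [ind, ind, ← mul_sub]
    refine mul_le_mul_of_nonneg_left (hgap.trans ?_) hα.le
    rw [abs_of_nonpos (sub_nonpos.2 hle)]
    exact le_of_eq (by ring)
  · obtain ⟨ψ, h1, h2⟩ := C.exists_vertical hα.le y (fun s => if s = t then -α else 0)
      (fun s r => by split_ifs <;> linarith)
    refine ⟨ψ, h1, ?_⟩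
    simp_rw [h2, mul_sub, Finset.sum_sub_distrib]
    rw [ind, ind, ← mul_sub, neg_mul, ← mul_neg]
    refine mul_le_mul_of_nonneg_left (hgap.trans ?_) hα.le
    rw [abs_of_nonneg (sub_nonneg.2 hle)]
    exact le_of_eq (by ring)

variable {T : FormFunctional a b} {G : ℝ → ℝ}

theorem ae_sliceL_nonneg (hα : 0 ≤ α) (hβ : 0 ≤ β) (hgG : ∀ᵐ x, x ∈ Ioo a b → g x = G x)
    (hT : C.Represents T) {M : ℝ} (hM : lift a b α β g T ≤ M) :
    ∀ᵐ x, x ∈ Ioo a b → 0 ≤ C.sliceL x := by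
  obtain ⟨N, hN, hN0, hNj, -⟩ := C.exists_null_set hgG
  have := C.sliceL_nonneg_of_integral_le (a := a) (b := b) (g := g) hβ hN hN0
    MeasurableSet.univ hNj (M := M) fun n => by
      have := TestField.sum_flux_le_lift hα hβ hT
        (C.negField_integrableFor (a := a) (b := b) (g := g) hβ n hN hN0 MeasurableSet.univ hNj)
      exact_mod_cast this.trans hM
  filter_upwards [this] with x hx hxI using hx hxI (mem_univ _)

/-- Vertical fields over different abscissas are chosen independently, so `n` true jumps force the
lifted energy to be at least `n * α * δ`, where `δ` is the least gap between multiplicities. -/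
theorem finite_trueJumps (hα : 0 < α) (hβ : 0 ≤ β) (hgG : ∀ᵐ x, x ∈ Ioo a b → g x = G x)
    (hT : C.Represents T) {M : ℝ} (hM : lift a b α β g T ≤ M) :
    (C.trueJumps ∩ Ioo a b).Finite := by
  classical
  obtain ⟨N, hN, hN0, hNj, -⟩ := C.exists_null_set hgG
  obtain ⟨δ, hδ0, hδ, -⟩ := exists_gap C.coeff
  by_contra hinf
  obtain ⟨n, hn⟩ := exists_nat_gt (M / (α * δ))
  obtain ⟨P, hP, hcard⟩ := (show (C.trueJumps ∩ Ioo a b).Infinite from hinf).exists_subset_card_eq n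
  have hex : ∀ y, ∃ ψ : ℝ → ℝ, (Measurable ψ ∧ (∀ s t, IntervalIntegrable ψ volume s t) ∧
      (∀ s t, |∫ r in s..t, ψ r| ≤ α)) ∧ (y ∈ C.trueJumps →
      α * δ ≤ ∑ i, C.coeff i * ∫ t in (C.data i).L y..(C.data i).R y, ψ t) := by
    intro y
    by_cases hy : y ∈ C.trueJumps
    · obtain ⟨ψ, h1, h2⟩ := C.exists_vertical_of_trueJump hα hδ hy
      exact ⟨ψ, h1, fun _ => h2⟩
    · exact ⟨fun _ => 0, ⟨measurable_const, fun _ _ => intervalIntegrable_const, fun _ _ => by simpa using hα.le⟩,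
        fun h => absurd h hy⟩
  choose ψ hψ1 hψ2 using hex
  obtain ⟨hi, hflux⟩ := C.vertField_sum_flux (a := a) (b := b) (g := g) hβ P
    (fun y hy => (hP hy).2) hN hN0 ψ hψ1 hNj
  have h1 := (TestField.sum_flux_le_lift hα.le hβ hT hi).trans hM
  rw [hflux] at h1
  have h2 : ∑ y ∈ P, ∑ i, C.coeff i * ∫ t in (C.data i).L y..(C.data i).R y, ψ y t ≤ M := by
    exact_mod_cast h1
  have h3 := Finset.card_nsmul_le_sum P _ (α * δ) fun y hy => hψ2 y (hP hy).1
  rw [hcard, nsmul_eq_mul] at h3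
  rw [div_lt_iff₀ (by positivity)] at hn
  linarith

end

end Chain

/-! ### Finite lifted energy: square integrable slopes -/

namespace Chain

variable {ι : Type*} [Fintype ι] (C : Chain ι) {a b α β : ℝ} {g G : ℝ → ℝ}

/-- The fields of the class `K` with the smallest possible second component. -/
def energyField (P : Finset ℝ) (hP : ∀ y ∈ P, y ∈ Ioo a b)
    {N : Set ℝ} (hN : MeasurableSet N) (hN0 : volume N = 0)
    (hgN : ∀ x ∈ Ioo a b, x ∉ N → g x = G x) (hG : Measurable G) (ψ : ℝ → ℝ → ℝ)
    (h : ∀ y, Measurable (ψ y) ∧ (∀ s t, IntervalIntegrable (ψ y) volume s t) ∧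
      (∀ s t, |∫ r in s..t, ψ y r| ≤ α)) {A : ℝ → ℝ → ℝ} (hA : Measurable (Function.uncurry A))
    (hA' : ∀ x, {t | A x t ≠ 0}.Countable) : TestField a b α β g where
  P := P
  ψ := ψ
  N := N
  A := A
  B x t := A x t ^ 2 / 4 - β * (t - G x) ^ 2
  subset := hP
  measurable_ψ y _ := (h y).1
  integrable_ψ y _ := (h y).2.1
  abs_integral_le y _ := (h y).2.2
  measurableSet_N := hN
  volume_N := hN0
  measurable_A := hA
  measurable_B := by
    have h1 : Measurable fun q : ℝ × ℝ => A q.1 q.2 := hA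
    have h2 : Measurable fun q : ℝ × ℝ => G q.1 := hG.comp measurable_fst
    change Measurable fun q : ℝ × ℝ => A q.1 q.2 ^ 2 / 4 - β * (q.2 - G q.1) ^ 2
    fun_prop
  countable_A := hA'
  le_B x hx hxN t := by rw [hgN x hx hxN]

theorem integrableOn_sq_sub (D : SBVData) (hG : Measurable G) {K : ℝ} (hK : ∀ x, |G x| ≤ K) :
    IntegrableOn (fun x => (D.L x - G x) ^ 2) (Ioo a b) := by
  refine Measure.integrableOn_of_bounded (M := (|D.base| + D.mass.real univ + K) ^ 2) (by simp)
    ((D.measurable_L.sub hG).pow_const 2).aestronglyMeasurable (Eventually.of_forall fun x => ?_)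
  rw [Real.norm_eq_abs, abs_of_nonneg (sq_nonneg _), ← sq_abs (D.L x - G x)]
  have := abs_sub (D.L x) (G x)
  have h1 := D.abs_L_le x
  have h2 := hK x
  gcongr
  linarith

theorem energyField_integrableFor {P : Finset ℝ} {hP : ∀ y ∈ P, y ∈ Ioo a b}
    {N : Set ℝ} {hN : MeasurableSet N} {hN0 : volume N = 0}
    {hgN : ∀ x ∈ Ioo a b, x ∉ N → g x = G x} {hG : Measurable G} {ψ : ℝ → ℝ → ℝ}
    {h : ∀ y, Measurable (ψ y) ∧ (∀ s t, IntervalIntegrable (ψ y) volume s t) ∧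
      (∀ s t, |∫ r in s..t, ψ y r| ≤ α)} {A : ℝ → ℝ → ℝ} {hA : Measurable (Function.uncurry A)}
    {hA' : ∀ x, {t | A x t ≠ 0}.Countable} {K : ℝ} (hK : ∀ x, |G x| ≤ K) {D : SBVData}
    (hNj : D.jumps ⊆ N)
    (hint : IntegrableOn (fun x => A x (D.L x) * D.slope x - A x (D.L x) ^ 2 / 4) (Ioo a b)) :
    (energyField P hP hN hN0 hgN hG ψ h hA hA' : TestField a b α β g).IntegrableFor D := by
  refine ⟨hNj, ?_⟩
  have := hint.add ((integrableOn_sq_sub (a := a) (b := b) D hG hK).const_mul β)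
  refine this.congr (Eventually.of_forall fun x => ?_)
  simp only [energyField, Pi.add_apply]
  ring

/-- Monotone convergence. The truncation acts on `p` because the test fields have to be bounded a
priori to have an integrable flux. -/
theorem integrableOn_of_truncations {s : Set ℝ} {f : ℝ → ℝ} {p : ℝ → ℝ}
    (hf : Measurable f) (hf0 : ∀ x, 0 ≤ f x) (hp : Measurable p) {M : ℝ}
    (hi : ∀ n : ℕ, IntegrableOn (fun x => if |p x| ≤ n then f x else 0) s)
    (hM : ∀ n : ℕ, ∫ x in s, (if |p x| ≤ n then f x else 0) ≤ M) : IntegrableOn f s := by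
  refine ⟨hf.aestronglyMeasurable, ?_⟩
  have hmono : ∀ᵐ x ∂volume.restrict s,
      Monotone fun n : ℕ => ENNReal.ofReal (if |p x| ≤ n then f x else 0) := by
    refine Eventually.of_forall fun x n m hnm => ENNReal.ofReal_le_ofReal ?_
    have : (n : ℝ) ≤ m := by exact_mod_cast hnm
    split_ifs with h1 h2
    · exact le_rfl
    · exact absurd (h1.trans this) h2
    · exact hf0 x
    · exact le_rfl
  have hlim := lintegral_tendsto_of_tendsto_of_monotone (μ := volume.restrict s)
    (f := fun (n : ℕ) x => ENNReal.ofReal (if |p x| ≤ n then f x else 0))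
    (F := fun x => ENNReal.ofReal (f x))
    (fun n => (Measurable.ite (measurableSet_le (by fun_prop) measurable_const) hf
      measurable_const).ennreal_ofReal.aemeasurable) hmono
    (Eventually.of_forall fun x => by
      obtain ⟨n, hn⟩ := exists_nat_ge |p x|
      refine tendsto_const_nhds.congr' ?_
      filter_upwards [eventually_ge_atTop n] with m hm
      have : (n : ℝ) ≤ m := by exact_mod_cast hm
      rw [if_pos (hn.trans this)])
  have hle : ∫⁻ x in s, ENNReal.ofReal (f x) ≤ ENNReal.ofReal M := by
    refine le_of_tendsto' hlim fun n => ?_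
    rw [← ofReal_integral_eq_lintegral_ofReal (hi n)
      (Eventually.of_forall fun x => by dsimp only; split_ifs; exacts [hf0 x, le_rfl])]
    exact ENNReal.ofReal_le_ofReal (hM n)
  rw [hasFiniteIntegral_iff_ofReal (Eventually.of_forall hf0)]
  exact hle.trans_lt ENNReal.ofReal_lt_top

theorem mul_le_sum_of_nonneg {c : ι → ℝ} {δ : ℝ} (hδ : ∀ z : ι → ℝ, ∀ t, 0 < slice c z t →
    δ ≤ slice c z t) {z : ι → ℝ} (hz : 0 ≤ slice c z) {h : ℝ → ℝ} (hh : ∀ t, 0 ≤ h t) {t : ℝ}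
    (ht : 0 < slice c z t) : δ * h t ≤ ∑ i, c i * h (z i) := by
  rw [sum_mul_eq]
  refine le_trans ?_ (Finset.single_le_sum (f := fun t => slice c z t * h t)
    (fun s _ => mul_nonneg (hz s) (hh s)) (Finsupp.mem_support_iff.2 ht.ne'))
  exact mul_le_mul_of_nonneg_right (hδ z t ht) (hh t)

open Classical in
/-- The slope of a chain on the part with positive multiplicity. -/
def posSlope (x t : ℝ) : ℝ := if 0 < C.sliceL x t then C.slope x t else 0

theorem measurable_posSlope : Measurable (Function.uncurry C.posSlope) := by
  have hset : MeasurableSet {q : ℝ × ℝ | 0 < C.sliceL q.1 q.2} :=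
    C.measurable_sliceL measurableSet_Ioi
  have h : Measurable fun q : ℝ × ℝ => C.slope q.1 q.2 := C.measurable_slope
  exact Measurable.ite hset h measurable_const

theorem measurable_posSlope_L (i : ι) : Measurable fun x => C.posSlope x ((C.data i).L x) := by
  have h : Measurable fun q : ℝ × ℝ => C.posSlope q.1 q.2 := C.measurable_posSlope
  have hp : Measurable fun x => (x, (C.data i).L x) := measurable_id.prodMk (C.data i).measurable_L
  have := h.comp hp
  exact this

theorem countable_posSlope (x : ℝ) : {t | C.posSlope x t ≠ 0}.Countable := by
  refine (C.countable_slope x).mono fun t ht => ?_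
  simp only [posSlope, mem_ofPred_eq] at ht ⊢
  split_ifs at ht with h
  · exact ht
  · exact absurd rfl ht

variable {T : FormFunctional a b}

/-- For `φˣ = 2 p` and `φᵗ = p² - β (t - G)²` the flux density is `p² + β (t - G)²` on a graph with
slope `p`. Positive multiplicities are at least `δ`, so the total flux of the truncated fields
controls each graph. Where the multiplicities cancel no bound is available, which is why `posSlope`
is used. -/
theorem integrableOn_posSlope_sq (hα : 0 ≤ α) (hβ : 0 ≤ β) (hG : Measurable G) {K : ℝ}
    (hK : ∀ x, |G x| ≤ K) (hgG : ∀ᵐ x, x ∈ Ioo a b → g x = G x)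
    (hT : C.Represents T) {M : ℝ} (hM : lift a b α β g T ≤ M) (i : ι) :
    IntegrableOn (fun x => C.posSlope x ((C.data i).L x) ^ 2) (Ioo a b) := by
  classical
  obtain ⟨N, hN, hN0, hNj, hNg⟩ := C.exists_null_set hgG
  obtain ⟨δ, hδ0, -, hδ⟩ := exists_gap C.coeff
  have hnn := C.ae_sliceL_nonneg hα hβ hgG hT hM
  let A : ℕ → ℝ → ℝ → ℝ := fun n x t => if |C.posSlope x t| ≤ n then 2 * C.posSlope x t else 0
  have hA : ∀ n, Measurable (Function.uncurry (A n)) := fun n => by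
    have h : Measurable fun q : ℝ × ℝ => C.posSlope q.1 q.2 := C.measurable_posSlope
    exact Measurable.ite (measurableSet_le h.abs measurable_const) (h.const_mul 2)
      measurable_const
  have hA' : ∀ n x, {t | A n x t ≠ 0}.Countable := fun n x =>
    (C.countable_posSlope x).mono fun t (ht : A n x t ≠ 0) (h0 : C.posSlope x t = 0) =>
      ht (by simp [A, h0])
  let F : ℕ → TestField a b α β g := fun n =>
    energyField (∅ : Finset ℝ) (by simp) hN hN0 hNg hG (fun _ _ => 0)
      (fun y => ⟨measurable_const, fun _ _ => intervalIntegrable_const, fun _ _ => by simpa⟩)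
      (hA n) (hA' n)
  have hsl : ∀ j, ∀ᵐ x, 0 < C.sliceL x ((C.data j).L x) →
      C.posSlope x ((C.data j).L x) = (C.data j).slope x := fun j => by
    filter_upwards [C.ae_slope_L] with x hx h
    rw [posSlope, if_pos h, hx]
  have hpt : ∀ n j, ∀ᵐ x, A n x ((C.data j).L x) * (C.data j).slope x -
      A n x ((C.data j).L x) ^ 2 / 4 =
      if |C.posSlope x ((C.data j).L x)| ≤ n then C.posSlope x ((C.data j).L x) ^ 2 else 0 := by
    intro n j
    filter_upwards [hsl j] with x hx
    by_cases hpos : 0 < C.sliceL x ((C.data j).L x)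
    · simp only [A]
      split_ifs
      · rw [hx hpos]; ring
      · ring
    · simp [A, posSlope, hpos]
  have htr : ∀ n j, IntegrableOn (fun x => if |C.posSlope x ((C.data j).L x)| ≤ (n : ℕ) then
      C.posSlope x ((C.data j).L x) ^ 2 else 0) (Ioo a b) := by
    intro n j
    refine Measure.integrableOn_of_bounded (M := (n : ℝ) ^ 2) (by simp)
      (Measurable.ite (measurableSet_le (C.measurable_posSlope_L j).abs measurable_const)
        ((C.measurable_posSlope_L j).pow_const 2) measurable_const).aestronglyMeasurable
      (Eventually.of_forall fun x => ?_)
    split_ifs with h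
    · rw [Real.norm_eq_abs, abs_pow]; gcongr
    · simp
  have hFi : ∀ n j, (F n).IntegrableFor (C.data j) := fun n j =>
    energyField_integrableFor hK (hNj j) ((htr n j).congr (ae_restrict_of_ae (by
      filter_upwards [hpt n j] with x hx using hx.symm)))
  let Q : ℝ := ∫ x in Ioo a b, ∑ j, C.coeff j * (β * ((C.data j).L x - G x) ^ 2)
  refine integrableOn_of_truncations ((C.measurable_posSlope_L i).pow_const 2)
    (fun x => sq_nonneg _) (C.measurable_posSlope_L i) (M := (M - Q) / δ) (fun n => htr n i)
    fun n => ?_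
  have h1 := (TestField.sum_flux_le_lift hα hβ hT (hFi n)).trans hM
  rw [TestField.sum_flux_eq (hFi n)] at h1
  have h1' := EReal.coe_le_coe_iff.1 h1
  simp only [F, energyField, Finset.sum_empty, add_zero] at h1'
  have hQi : IntegrableOn (fun x => ∑ j, C.coeff j * (β * ((C.data j).L x - G x) ^ 2))
      (Ioo a b) := integrable_finsetSum _ fun j _ =>
    ((integrableOn_sq_sub (C.data j) hG hK).const_mul β).const_mul _
  have hSi : IntegrableOn (fun x => ∑ j, C.coeff j * (if |C.posSlope x ((C.data j).L x)| ≤ (n : ℕ)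
      then C.posSlope x ((C.data j).L x) ^ 2 else 0)) (Ioo a b) :=
    integrable_finsetSum _ fun j _ => (htr n j).const_mul _
  rw [integral_congr_ae (g := fun x => (∑ j, C.coeff j * (if |C.posSlope x ((C.data j).L x)| ≤ n
      then C.posSlope x ((C.data j).L x) ^ 2 else 0)) +
      ∑ j, C.coeff j * (β * ((C.data j).L x - G x) ^ 2)), integral_add hSi hQi] at h1'
  swap
  · refine ae_restrict_of_ae ?_
    filter_upwards [ae_all_iff.2 (hpt n)] with x hx
    rw [← Finset.sum_add_distrib]
    refine Finset.sum_congr rfl fun j _ => ?_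
    rw [← mul_add, ← hx j]
    ring
  -- A single atom of a positive slice has weight at least `δ`, so `δ` times its term is below the
  -- full sum.
  rw [le_div_iff₀ hδ0, mul_comm, ← integral_const_mul]
  refine le_trans ?_ (le_sub_right_of_add_le h1')
  refine integral_mono_ae ((htr n i).const_mul δ) hSi ?_
  rw [EventuallyLE, ae_restrict_iff' measurableSet_Ioo]
  filter_upwards [hnn] with x hx hxI
  by_cases hpos : 0 < C.sliceL x ((C.data i).L x)
  · exact mul_le_sum_of_nonneg (z := fun j => (C.data j).L x) hδ (hx hxI)
      (h := fun t => if |C.posSlope x t| ≤ n then C.posSlope x t ^ 2 else 0)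
      (fun t => by split_ifs; exacts [sq_nonneg _, le_rfl]) hpos
  · have h0 : C.posSlope x ((C.data i).L x) = 0 := by simp [posSlope, hpos]
    rw [h0]
    simp only [ne_eq, OfNat.ofNat_ne_zero, not_false_eq_true, zero_pow, ite_self, mul_zero]
    rw [sum_mul_eq C.coeff (fun j => (C.data j).L x)
      (fun t => if |C.posSlope x t| ≤ n then C.posSlope x t ^ 2 else 0)]
    refine Finset.sum_nonneg fun t _ => mul_nonneg (hx hxI t) ?_
    split_ifs
    exacts [sq_nonneg _, le_rfl]

end Chain

/-! ### Quantiles of slices -/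

section Quantile

variable {ι : Type*} [Fintype ι] (c : ι → ℝ)

open Classical in
/-- The mass `∑_{zᵢ ≤ t} cᵢ`. -/
def cdf (z : ι → ℝ) (t : ℝ) : ℝ := ∑ i, c i * (if z i ≤ t then 1 else 0)

open Classical in
/-- The mass `∑_{zᵢ < t} cᵢ`. -/
def cdfLeft (z : ι → ℝ) (t : ℝ) : ℝ := ∑ i, c i * (if z i < t then 1 else 0)

/-- The sums of the coefficients over subsets. -/
def subsetSums : Finset ℝ := (Finset.univ : Finset (Finset ι)).image fun s => ∑ i ∈ s, c i

/-- `t` is the quantile of level `s` of the measure `∑ᵢ cᵢ δ_{zᵢ}`. -/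
def IsQuantile (s : ℝ) (z : ι → ℝ) (t : ℝ) : Prop := cdfLeft c z t < s ∧ s < cdf c z t

/-- The quantile of level `s` of the measure `∑ᵢ cᵢ δ_{zᵢ}`. -/
def quantile (s : ℝ) (z : ι → ℝ) : ℝ := Classical.epsilon (IsQuantile c s z)

variable {c}

theorem cdf_mem_subsetSums (z : ι → ℝ) (t : ℝ) : cdf c z t ∈ subsetSums c := by
  classical
  refine Finset.mem_image.2 ⟨Finset.univ.filter fun i => z i ≤ t, Finset.mem_univ _, ?_⟩
  simp [cdf, Finset.sum_filter]

theorem cdfLeft_mem_subsetSums (z : ι → ℝ) (t : ℝ) : cdfLeft c z t ∈ subsetSums c := by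
  classical
  refine Finset.mem_image.2 ⟨Finset.univ.filter fun i => z i < t, Finset.mem_univ _, ?_⟩
  simp [cdfLeft, Finset.sum_filter]

theorem sum_mul_mono {z : ι → ℝ} (hz : 0 ≤ slice c z) {h h' : ℝ → ℝ} (hh : ∀ t, h t ≤ h' t) :
    ∑ i, c i * h (z i) ≤ ∑ i, c i * h' (z i) := by
  rw [sum_mul_eq, sum_mul_eq]
  exact Finset.sum_le_sum fun t _ => mul_le_mul_of_nonneg_left (hh t) (hz t)

theorem cdf_le_cdfLeft {z : ι → ℝ} (hz : 0 ≤ slice c z) {t t' : ℝ} (h : t < t') :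
    cdf c z t ≤ cdfLeft c z t' := by
  classical
  refine sum_mul_mono hz (h := fun r => if r ≤ t then 1 else 0)
    (h' := fun r => if r < t' then 1 else 0) fun r => ?_
  split_ifs with h1 h2
  · exact le_rfl
  · exact absurd (h1.trans_lt h) h2
  · exact zero_le_one
  · exact le_rfl

theorem cdfLeft_nonneg {z : ι → ℝ} (hz : 0 ≤ slice c z) (t : ℝ) : 0 ≤ cdfLeft c z t := by
  classical
  have := sum_mul_mono hz (h := fun _ => 0) (h' := fun r => if r < t then 1 else 0) fun r => by
    split_ifs <;> simp
  simpa [cdfLeft] using this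

theorem cdf_le_sum {z : ι → ℝ} (hz : 0 ≤ slice c z) (t : ℝ) : cdf c z t ≤ ∑ i, c i := by
  classical
  have := sum_mul_mono hz (h := fun r => if r ≤ t then 1 else 0) (h' := fun _ => 1) fun r => by
    split_ifs <;> simp
  simpa [cdf] using this

theorem cdf_sub_cdfLeft (z : ι → ℝ) (t : ℝ) : cdf c z t - cdfLeft c z t = slice c z t := by
  classical
  rw [cdf, cdfLeft, slice_apply_eq_sum, ← Finset.sum_sub_distrib]
  refine Finset.sum_congr rfl fun i _ => ?_
  rcases lt_trichotomy (z i) t with h | h | h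
  · simp [h, h.le, h.ne]
  · simp [h]
  · simp [h.not_gt, h.not_ge, h.ne']

theorem cdf_congr {z z' : ι → ℝ} (h : slice c z = slice c z') : cdf c z = cdf c z' := by
  classical
  ext t
  exact sum_mul_congr c h fun r => if r ≤ t then 1 else 0

theorem cdfLeft_congr {z z' : ι → ℝ} (h : slice c z = slice c z') :
    cdfLeft c z = cdfLeft c z' := by
  classical
  ext t
  exact sum_mul_congr c h fun r => if r < t then 1 else 0

theorem quantile_congr {z z' : ι → ℝ} (h : slice c z = slice c z') (s : ℝ) :
    quantile c s z = quantile c s z' := by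
  have : IsQuantile c s z = IsQuantile c s z' := by
    ext t
    rw [IsQuantile, IsQuantile, cdf_congr h, cdfLeft_congr h]
  rw [quantile, quantile, this]

/-- The quantile is the least value at which the distribution function exceeds `s`. A level outside
`subsetSums` is never attained, so both inequalities are strict. No positivity is needed for
existence, only for uniqueness. -/
theorem exists_isQuantile {s : ℝ} (hs : s ∉ subsetSums c) (h0 : 0 < s) (hm : s < ∑ i, c i)
    (z : ι → ℝ) : ∃ t, IsQuantile c s z t := by
  classical
  have hne : (Finset.univ : Finset ι).Nonempty := by
    by_contra h
    rw [Finset.not_nonempty_iff_eq_empty] at h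
    rw [h, Finset.sum_empty] at hm
    exact absurd hm h0.not_gt
  let Z : Finset ℝ := Finset.univ.image z
  have hZ : ∀ i, z i ∈ Z := fun i => Finset.mem_image_of_mem _ (Finset.mem_univ i)
  have hZne : Z.Nonempty := hne.image z
  let Y : Finset ℝ := Z.filter fun t => s < cdf c z t
  have hY : Y.Nonempty := by
    refine ⟨Z.max' hZne, Finset.mem_filter.2 ⟨Z.max'_mem _, ?_⟩⟩
    have : cdf c z (Z.max' hZne) = ∑ i, c i :=
      Finset.sum_congr rfl fun i _ => by rw [if_pos (Z.le_max' _ (hZ i)), mul_one]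
    rwa [this]
  obtain ⟨t, ht, htmin⟩ : ∃ t ∈ Y, ∀ r ∈ Y, t ≤ r :=
    ⟨Y.min' hY, Y.min'_mem hY, fun r hr => Y.min'_le r hr⟩
  have htY := Finset.mem_filter.1 ht
  refine ⟨t, ?_, htY.2⟩
  by_contra hge
  have hlt : s < cdfLeft c z t :=
    lt_of_le_of_ne (not_lt.1 hge) fun h => hs (h ▸ cdfLeft_mem_subsetSums z t)
  let X : Finset ℝ := Z.filter fun r => r < t
  have hX : X.Nonempty := by
    by_contra h
    rw [Finset.not_nonempty_iff_eq_empty, Finset.filter_eq_empty_iff] at h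
    have : cdfLeft c z t = 0 :=
      Finset.sum_eq_zero fun i _ => by rw [if_neg (h (hZ i)), mul_zero]
    linarith
  have hXm := Finset.mem_filter.1 (X.max'_mem hX)
  have heq : cdf c z (X.max' hX) = cdfLeft c z t := by
    refine Finset.sum_congr rfl fun i _ => ?_
    by_cases h : z i < t
    · rw [if_pos h, if_pos (X.le_max' _ (Finset.mem_filter.2 ⟨hZ i, h⟩))]
    · rw [if_neg h, if_neg fun h' => h (h'.trans_lt hXm.2)]
  have := htmin _ (Finset.mem_filter.2 ⟨hXm.1, heq ▸ hlt⟩)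
  exact absurd hXm.2 this.not_gt

theorem IsQuantile.le {s : ℝ} {z : ι → ℝ} (hz : 0 ≤ slice c z) {t r : ℝ}
    (ht : s < cdf c z t) (hr : cdfLeft c z r < s) : r ≤ t := by
  by_contra h
  exact absurd (cdf_le_cdfLeft hz (not_le.1 h)) (not_le.2 (hr.trans ht))

theorem IsQuantile.eq {s : ℝ} {z : ι → ℝ} (hz : 0 ≤ slice c z) {t r : ℝ}
    (ht : IsQuantile c s z t) (hr : IsQuantile c s z r) : t = r :=
  le_antisymm (IsQuantile.le hz hr.2 ht.1) (IsQuantile.le hz ht.2 hr.1)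

theorem isQuantile_quantile {s : ℝ} (hs : s ∉ subsetSums c) (h0 : 0 < s) (hm : s < ∑ i, c i)
    (z : ι → ℝ) : IsQuantile c s z (quantile c s z) :=
  Classical.epsilon_spec (exists_isQuantile hs h0 hm z)

theorem IsQuantile.slice_pos {s : ℝ} {z : ι → ℝ} {t : ℝ} (h : IsQuantile c s z t) :
    0 < slice c z t := by
  rw [← cdf_sub_cdfLeft]
  linarith [h.1, h.2]

/-- The distribution functions are locally constant away from the atoms. -/
theorem exists_cdf_eq (z : ι → ℝ) (t : ℝ) {ε₀ : ℝ} (hε₀ : 0 < ε₀) : ∃ ε, 0 < ε ∧ ε ≤ ε₀ ∧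
    ∀ z' : ι → ℝ, (∀ i, |z' i - z i| < ε) →
      cdf c z' (t + ε) = cdf c z t ∧ cdfLeft c z' (t - ε) = cdfLeft c z t := by
  classical
  -- `η` is at most the distance of `t` to the other values. Perturbations smaller than `ε ≤ η / 2`
  -- neither bring another value into the window `[t - ε, t + ε]` nor take a value equal to `t` out
  -- of it.
  obtain ⟨η, hη0, hη⟩ : ∃ η > 0, ∀ i, z i ≠ t → η ≤ |z i - t| := by
    let E : Finset ℝ := insert 1 ((Finset.univ.filter fun i => z i ≠ t).image fun i => |z i - t|)
    have hE : E.Nonempty := ⟨1, Finset.mem_insert_self _ _⟩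
    refine ⟨E.min' hE, ?_, fun i hi => E.min'_le _ (Finset.mem_insert_of_mem
      (Finset.mem_image.2 ⟨i, Finset.mem_filter.2 ⟨Finset.mem_univ _, hi⟩, rfl⟩))⟩
    rcases Finset.mem_insert.1 (E.min'_mem hE) with h | h
    · rw [h]; exact one_pos
    · obtain ⟨i, hi, h⟩ := Finset.mem_image.1 h
      rw [← h]
      exact abs_pos.2 (sub_ne_zero.2 (Finset.mem_filter.1 hi).2)
  refine ⟨min ε₀ (η / 2), by positivity, min_le_left _ _, fun z' hz' => ⟨?_, ?_⟩⟩
  all_goals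
    set ε := min ε₀ (η / 2)
    have hε : ε ≤ η / 2 := min_le_right _ _
    have hε0 : 0 < ε := by positivity
    refine Finset.sum_congr rfl fun i _ => ?_
    have h1 := abs_lt.1 (hz' i)
    congr 1
    refine if_congr ?_ rfl rfl
    rcases lt_trichotomy (z i) t with h | h | h
  · exact ⟨fun _ => h.le, fun _ => by linarith⟩
  · exact ⟨fun _ => h.le, fun _ => by linarith⟩
  · have h2 := hη i h.ne'
    rw [abs_of_pos (sub_pos.2 h)] at h2
    constructor <;> intro <;> linarith
  · have h2 := hη i h.ne
    rw [abs_of_neg (sub_neg.2 h)] at h2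
    constructor <;> intro <;> linarith
  · constructor <;> intro <;> linarith
  · constructor <;> intro <;> linarith

/-- Atoms may split and merge in the limit, but the mass of a small window around `t` under a nearby
measure equals the atom of the limit at `t`. -/
theorem slice_nonneg_of_tendsto {X : Type*} {l : Filter X} {f : X → ι → ℝ} {z : ι → ℝ}
    (hf : Tendsto f l (𝓝 z)) (h : ∃ᶠ x in l, 0 ≤ slice c (f x)) : 0 ≤ slice c z := by
  intro t
  obtain ⟨ε, hε, -, hcdf⟩ := exists_cdf_eq (c := c) z t one_pos
  have hev : ∀ᶠ x in l, ∀ i, |f x i - z i| < ε := by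
    rw [eventually_all]
    intro i
    exact Metric.tendsto_nhds.1 ((tendsto_pi_nhds.1 hf) i) ε hε
  obtain ⟨x, hx, hx'⟩ := (h.and_eventually hev).exists
  obtain ⟨h1, h2⟩ := hcdf _ hx'
  have h3 := cdf_sub_cdfLeft (c := c) (f x) (t - ε)
  have h4 := cdf_le_cdfLeft hx (show t - ε < t + ε by linarith)
  have h5 := cdf_sub_cdfLeft (c := c) (f x) (t + ε)
  have h6 := cdf_sub_cdfLeft (c := c) z t
  have h7 : 0 ≤ slice c (f x) (t - ε) := hx _
  have h8 : 0 ≤ slice c (f x) (t + ε) := hx _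
  change 0 ≤ slice c z t
  linarith

/-- At the two ends of a small window around the limit quantile, the nearby distribution functions
have the values of the limit, which lie strictly below and above `s`; the quantile is caught in
between. -/
theorem tendsto_quantile {X : Type*} {l : Filter X} {f : X → ι → ℝ} {z : ι → ℝ}
    (hf : Tendsto f l (𝓝 z)) (h : ∀ᶠ x in l, 0 ≤ slice c (f x)) {s : ℝ}
    (hs : s ∉ subsetSums c) (h0 : 0 < s) (hm : s < ∑ i, c i) :
    Tendsto (fun x => quantile c s (f x)) l (𝓝 (quantile c s z)) := by
  rw [Metric.tendsto_nhds]
  intro ε₀ hε₀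
  have hq := isQuantile_quantile hs h0 hm z
  obtain ⟨ε, hε, hεε, hcdf⟩ := exists_cdf_eq (c := c) z (quantile c s z)
    (show 0 < ε₀ / 2 by positivity)
  have hev : ∀ᶠ x in l, ∀ i, |f x i - z i| < ε := by
    rw [eventually_all]
    intro i
    exact Metric.tendsto_nhds.1 ((tendsto_pi_nhds.1 hf) i) ε hε
  filter_upwards [h, hev] with x hx hx'
  obtain ⟨h1, h2⟩ := hcdf _ hx'
  have hq' := isQuantile_quantile hs h0 hm (f x)
  have h3 := IsQuantile.le hx (t := quantile c s z + ε) (by rw [h1]; exact hq.2) hq'.1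
  have h4 := IsQuantile.le hx (r := quantile c s z - ε) hq'.2 (by rw [h2]; exact hq.1)
  rw [Real.dist_eq, abs_lt]
  constructor <;> linarith

/-- The successor of `σ` in the finite set `S`. -/
def succIn (S : Finset ℝ) (σ : ℝ) : ℝ := sInf {r | r ∈ S ∧ σ < r}

theorem succIn_spec {S : Finset ℝ} {σ r : ℝ} (hr : r ∈ S) (h : σ < r) :
    succIn S σ ∈ S ∧ σ < succIn S σ ∧ ∀ r ∈ S, σ < r → succIn S σ ≤ r := by
  have hfin : {r | r ∈ S ∧ σ < r}.Finite := S.finite_toSet.subset fun r hr => hr.1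
  have hne : {r | r ∈ S ∧ σ < r}.Nonempty := ⟨r, hr, h⟩
  have hmem := hne.csInf_mem hfin
  exact ⟨hmem.1, hmem.2, fun r' hr' h' => csInf_le hfin.bddBelow ⟨hr', h'⟩⟩

/-- A telescoping sum over the consecutive gaps between `p` and `r`. -/
theorem sum_succIn_sub (S : Finset ℝ) {p r : ℝ} (hp : p ∈ S) (hr : r ∈ S) (hpr : p ≤ r) :
    ∑ σ ∈ S with p ≤ σ ∧ σ < r, (succIn S σ - σ) = r - p := by
  induction hn : (S.filter fun σ => p ≤ σ ∧ σ < r).card using Nat.strong_induction_on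
    generalizing p with
  | _ n ih =>
    rcases hpr.eq_or_lt with rfl | hlt
    · rw [Finset.filter_false_of_mem fun σ _ h => absurd h.2 h.1.not_gt]
      simp
    · obtain ⟨h1, h2, h3⟩ := succIn_spec hr hlt
      have heq : (S.filter fun σ => p ≤ σ ∧ σ < r) =
          insert p (S.filter fun σ => succIn S p ≤ σ ∧ σ < r) := by
        ext σ
        simp only [Finset.mem_filter, Finset.mem_insert]
        constructor
        · rintro ⟨hσ, hpσ, hσr⟩
          rcases hpσ.eq_or_lt with h | h
          · exact Or.inl h.symm
          · exact Or.inr ⟨hσ, h3 σ hσ h, hσr⟩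
        · rintro (rfl | ⟨hσ, hpσ, hσr⟩)
          · exact ⟨hp, le_rfl, hlt⟩
          · exact ⟨hσ, h2.le.trans hpσ, hσr⟩
      have hnot : p ∉ S.filter fun σ => succIn S p ≤ σ ∧ σ < r := fun h =>
        absurd (Finset.mem_filter.1 h).2.1 (not_le.2 h2)
      rw [heq, Finset.card_insert_of_notMem hnot] at hn
      rw [heq, Finset.sum_insert hnot, ih _ (by omega) h1 (h3 r hr hlt) rfl]
      ring

variable (c) in
/-- The measures `∑ᵢ cᵢ δ_{zᵢ}`, if positive, are recovered from their quantiles. -/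
theorem exists_levels : ∃ (J : Finset ℝ) (s w : ℝ → ℝ),
    (∀ σ ∈ J, 0 ≤ w σ ∧ s σ ∉ subsetSums c ∧ 0 < s σ ∧ s σ < ∑ i, c i) ∧
    ∀ z, 0 ≤ slice c z → ∀ h : ℝ → ℝ,
      ∑ σ ∈ J, w σ * h (quantile c (s σ) z) = ∑ i, c i * h (z i) := by
  classical
  set S := subsetSums c with hS
  have hmS : ∑ i, c i ∈ S := Finset.mem_image.2 ⟨Finset.univ, Finset.mem_univ _, rfl⟩
  have hJ : ∀ σ ∈ S.filter (fun σ => 0 ≤ σ ∧ σ < ∑ i, c i), 0 ≤ succIn S σ - σ ∧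
      (σ + succIn S σ) / 2 ∉ S ∧ 0 < (σ + succIn S σ) / 2 ∧ (σ + succIn S σ) / 2 < ∑ i, c i := by
    intro σ hσ
    obtain ⟨hσS, hσ0, hσm⟩ := Finset.mem_filter.1 hσ
    obtain ⟨h1, h2, h3⟩ := succIn_spec hmS hσm
    have h4 := h3 _ hmS hσm
    refine ⟨by linarith, fun h => ?_, by linarith, by linarith⟩
    have := h3 _ h (by linarith)
    linarith
  -- The quantile can change with the level only across elements of `S`. One level is taken in the
  -- middle of each gap of `S` between `0` and the total mass, with the length of the gap as weight.
  refine ⟨S.filter fun σ => 0 ≤ σ ∧ σ < ∑ i, c i, fun σ => (σ + succIn S σ) / 2,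
    fun σ => succIn S σ - σ, hJ, fun z hz h => ?_⟩
  rw [sum_mul_eq]
  have hq : ∀ σ ∈ S.filter (fun σ => 0 ≤ σ ∧ σ < ∑ i, c i),
      IsQuantile c ((σ + succIn S σ) / 2) z (quantile c ((σ + succIn S σ) / 2) z) := fun σ hσ =>
    isQuantile_quantile (hJ σ hσ).2.1 (hJ σ hσ).2.2.1 (hJ σ hσ).2.2.2 z
  -- The levels are grouped by their quantile `τ`. Those with a given `τ` fill the interval from
  -- `cdfLeft` to `cdf` at `τ`, so their weights add up to the atom at `τ`.
  rw [← Finset.sum_fiberwise_of_maps_to (s := S.filter fun σ => 0 ≤ σ ∧ σ < ∑ i, c i)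
    (t := (slice c z).support) (g := fun σ => quantile c ((σ + succIn S σ) / 2) z)
    fun σ hσ => Finsupp.mem_support_iff.2 (hq σ hσ).slice_pos.ne']
  refine Finset.sum_congr rfl fun τ hτ => ?_
  rw [Finset.sum_congr rfl (g := fun σ => (succIn S σ - σ) * h τ) fun σ hσ => by
    rw [(Finset.mem_filter.1 hσ).2], ← Finset.sum_mul]
  congr 1
  rw [← cdf_sub_cdfLeft, ← sum_succIn_sub S (cdfLeft_mem_subsetSums z τ) (cdf_mem_subsetSums z τ)
    (by linarith [cdf_sub_cdfLeft (c := c) z τ, show 0 ≤ slice c z τ from hz τ])]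
  refine Finset.sum_congr ?_ fun _ _ => rfl
  ext σ
  simp only [Finset.mem_filter]
  constructor
  · rintro ⟨⟨hσS, hσ0, hσm⟩, hqσ⟩
    have h1 := hq σ (Finset.mem_filter.2 ⟨hσS, hσ0, hσm⟩)
    rw [hqσ] at h1
    obtain ⟨h2, h3, h4⟩ := succIn_spec hmS hσm
    refine ⟨hσS, ?_, by linarith [h1.2]⟩
    by_contra hlt
    have := h4 _ (cdfLeft_mem_subsetSums z τ) (not_le.1 hlt)
    linarith [h1.1]
  · rintro ⟨hσS, h1, h2⟩
    have hmem : σ ∈ S.filter (fun σ => 0 ≤ σ ∧ σ < ∑ i, c i) := Finset.mem_filter.2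
      ⟨hσS, (cdfLeft_nonneg hz τ).trans h1, h2.trans_le (cdf_le_sum hz τ)⟩
    refine ⟨Finset.mem_filter.1 hmem, ?_⟩
    obtain ⟨h3, h4, h5⟩ := succIn_spec hmS (Finset.mem_filter.1 hmem).2.2
    have h6 := h5 _ (cdf_mem_subsetSums z τ) h2
    exact IsQuantile.eq hz (hq σ hmem) ⟨by linarith, by linarith⟩

end Quantile

/-! ### Strands -/

/-- Where `L` is differentiable this is the one-dimensional area inequality. The image of the
remaining null set is the projection of a part of the graph without length. -/
theorem volume_image_L_le (D : SBVData) {E : Set ℝ} (hE : MeasurableSet E) :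
    volume (D.L '' E) ≤ ∫⁻ x in E, ENNReal.ofReal |D.slope x| := by
  have hset : MeasurableSet {x | HasDerivAt D.L (D.slope x) x} := by
    have : {x | HasDerivAt D.L (D.slope x) x} =
        {x | DifferentiableAt ℝ D.L x} ∩ {x | deriv D.L x = D.slope x} := by
      ext x
      exact ⟨fun h => ⟨h.differentiableAt, h.deriv⟩, fun h => by
        have h2 : deriv D.L x = D.slope x := h.2
        change HasDerivAt D.L (D.slope x) x
        rw [← h2]
        exact DifferentiableAt.hasDerivAt h.1⟩
    rw [this]
    exact (measurableSet_of_differentiableAt ℝ D.L).inter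
      (measurableSet_eq_fun (measurable_deriv _) D.measurable_slope)
  set H := {x | HasDerivAt D.L (D.slope x) x} with hH
  have h1 : volume (D.L '' (E ∩ H)) ≤ ∫⁻ x in E, ENNReal.ofReal |D.slope x| := by
    refine (addHaar_image_le_lintegral_abs_det_fderiv volume (hE.inter hset)
      (f' := fun x => ContinuousLinearMap.toSpanSingleton ℝ (D.slope x))
      fun x hx => hx.2.hasFDerivAt.hasFDerivWithinAt).trans ?_
    refine le_trans (le_of_eq ?_) (lintegral_mono_set (inter_subset_left (t := H)))
    simp
  have h2 : volume (D.L '' (E \ H)) = 0 := by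
    have h0 : volume (E \ H) = 0 :=
      measure_mono_null (fun x hx => hx.2) D.ae_hasDerivAt
    have h3 := D.hausdorffMeasure_graphMap_image_null h0
    have hlip : LipschitzWith 1 (fun p : Plane => p 1) := LipschitzWith.of_dist_le_mul fun p q => by
      rw [Real.dist_eq, NNReal.coe_one, one_mul]
      exact abs_snd_sub_le_dist p q
    have h4 := hlip.hausdorffMeasure_image_le (d := 1) zero_le_one (graphMap D.L '' (E \ H))
    rw [h3, mul_zero, nonpos_iff_eq_zero, image_image, hausdorffMeasure_real] at h4
    simpa using h4
  rw [← inter_union_sdiff E H, image_union]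
  refine (measure_union_le _ _).trans ?_
  rw [h2, add_zero, inter_union_sdiff]
  exact h1

/-- A continuous selection of values of functions is as regular as these. -/
theorem abs_sub_le_of_selection {κ : Type*} [Fintype κ] (D : κ → SBVData) {V : ℝ → ℝ} {x y : ℝ}
    (hxy : x ≤ y) (hV : ContinuousOn V (Icc x y)) (hsel : ∀ r ∈ Ioo x y, ∃ i, V r = (D i).L r) :
    |V y - V x| ≤ ∫ r in x..y, ∑ i, |(D i).slope r| := by
  -- By the intermediate value theorem `V` attains everything between `V x` and `V y`, and its
  -- values are those of the given functions, up to the two end points. The increment is thus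
  -- bounded by the measure of their images.
  have hsub : uIcc (V x) (V y) ⊆ (⋃ i, (D i).L '' Ioo x y) ∪ {V x, V y} := by
    refine (intermediate_value_uIcc (by rwa [uIcc_of_le hxy])).trans ?_
    rw [uIcc_of_le hxy]
    rintro _ ⟨r, hr, rfl⟩
    rcases hr.1.eq_or_lt with rfl | h1
    · simp
    rcases hr.2.eq_or_lt with rfl | h2
    · simp
    obtain ⟨i, hi⟩ := hsel r ⟨h1, h2⟩
    exact Or.inl (mem_iUnion.2 ⟨i, r, ⟨h1, h2⟩, hi.symm⟩)
  have hint : ∀ i, IntegrableOn (fun r => |(D i).slope r|) (Ioo x y) := fun i =>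
    (D i).integrable_slope.abs.integrableOn
  have h1 : ENNReal.ofReal |V y - V x| ≤ ENNReal.ofReal (∫ r in Ioo x y, ∑ i, |(D i).slope r|) := by
    calc ENNReal.ofReal |V y - V x| = volume (uIcc (V x) (V y)) := by rw [Real.volume_interval]
      _ ≤ volume ((⋃ i, (D i).L '' Ioo x y) ∪ {V x, V y}) := measure_mono hsub
      _ ≤ (∑ i, volume ((D i).L '' Ioo x y)) + volume ({V x, V y} : Set ℝ) :=
          (measure_union_le _ _).trans (add_le_add_left (measure_iUnion_fintype_le _ _) _)
      _ = ∑ i, volume ((D i).L '' Ioo x y) := by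
          rw [(Set.toFinite {V x, V y}).measure_zero, add_zero]
      _ ≤ ∑ i, ENNReal.ofReal (∫ r in Ioo x y, |(D i).slope r|) := by
          refine Finset.sum_le_sum fun i _ => ?_
          rw [ofReal_integral_eq_lintegral_ofReal (hint i)
            (Eventually.of_forall fun r => abs_nonneg _)]
          exact volume_image_L_le (D i) measurableSet_Ioo
      _ = ENNReal.ofReal (∫ r in Ioo x y, ∑ i, |(D i).slope r|) := by
          rw [integral_finsetSum _ fun i _ => hint i, ENNReal.ofReal_sum_of_nonneg]
          exact fun i _ => integral_nonneg fun r => abs_nonneg _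
  rw [intervalIntegral.integral_of_le hxy, integral_Ioc_eq_integral_Ioo]
  exact (ENNReal.ofReal_le_ofReal_iff (integral_nonneg fun r =>
    Finset.sum_nonneg fun i _ => abs_nonneg _)).1 h1

/-- The increments of `V` are dominated by those of the primitive of the integrable function `∑
|slope|`. -/
theorem absolutelyContinuousOnInterval_of_selection {κ : Type*} [Fintype κ] (D : κ → SBVData)
    {V : ℝ → ℝ} {x₀ x₁ : ℝ} (h01 : x₀ ≤ x₁) (hV : ContinuousOn V (Icc x₀ x₁))
    (hsel : ∀ r ∈ Ioo x₀ x₁, ∃ i, V r = (D i).L r) : AbsolutelyContinuousOnInterval V x₀ x₁ := by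
  have hk : Integrable fun r => ∑ i, |(D i).slope r| :=
    integrable_finsetSum _ fun i _ => (D i).integrable_slope.abs
  have hac := (hk.intervalIntegrable (a := x₀) (b := x₁)).absolutelyContinuousOnInterval_intervalIntegral
    (c := x₀) left_mem_uIcc
  have key : ∀ p ∈ Icc x₀ x₁, ∀ q ∈ Icc x₀ x₁, p ≤ q → dist (V p) (V q) ≤
      dist (∫ r in x₀..p, ∑ i, |(D i).slope r|) (∫ r in x₀..q, ∑ i, |(D i).slope r|) := by
    intro p hp q hq hpq
    rw [dist_comm, Real.dist_eq, dist_comm, Real.dist_eq,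
      intervalIntegral.integral_interval_sub_left hk.intervalIntegrable hk.intervalIntegrable]
    refine le_trans ?_ (le_abs_self _)
    exact abs_sub_le_of_selection D hpq (hV.mono (Icc_subset_Icc hp.1 hq.2))
      fun r hr => hsel r ⟨hp.1.trans_lt hr.1, hr.2.trans_le hq.2⟩
  rw [absolutelyContinuousOnInterval_iff] at hac ⊢
  intro ε hε
  obtain ⟨δ, hδ, h⟩ := hac ε hε
  refine ⟨δ, hδ, fun E hE hEδ => lt_of_le_of_lt (Finset.sum_le_sum fun i hi => ?_) (h E hE hEδ)⟩
  have hm := hE.1 i hi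
  rw [uIcc_of_le h01] at hm
  rcases le_total (E.2 i).1 (E.2 i).2 with hle | hle
  · exact key _ hm.1 _ hm.2 hle
  · rw [dist_comm, dist_comm (∫ r in x₀.._, _)]
    exact key _ hm.2 _ hm.1 hle

/-! ### Decomposition of a positive chain into strands -/

namespace Chain

variable {ι : Type*} [Fintype ι] (C : Chain ι) {x₀ x₁ : ℝ}

/-- Positivity holds at points arbitrarily close to `x` from the left, and it passes to the left
limit. -/
theorem sliceL_nonneg_of_ae {x : ℝ} (h01 : x₀ < x)
    (h : ∀ᵐ y, y ∈ Ioo x₀ x → 0 ≤ C.sliceL y) : 0 ≤ C.sliceL x := by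
  refine slice_nonneg_of_tendsto (l := 𝓝[<] x) (f := fun y i => (C.data i).L y)
    (tendsto_pi_nhds.2 fun i => (C.data i).tendsto_L_left x) ?_
  intro hcon
  obtain ⟨y, hy, hcon⟩ := (mem_nhdsLT_iff_exists_Ioo_subset' h01).1 hcon
  have hpos : 0 < volume (Ioo (max x₀ y) x) := by simpa [h01] using hy
  refine hpos.ne' (measure_mono_null (fun r hr => ?_) h)
  intro hr'
  exact hcon ⟨(le_max_right _ _).trans_lt hr.1, hr.2⟩
    (hr' ⟨(le_max_left _ _).trans_lt hr.1, hr.2⟩)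

theorem sliceR_nonneg_of_ae {x : ℝ} (h01 : x < x₁)
    (h : ∀ᵐ y, y ∈ Ioo x x₁ → 0 ≤ C.sliceL y) : 0 ≤ C.sliceR x := by
  refine slice_nonneg_of_tendsto (l := 𝓝[>] x) (f := fun y i => (C.data i).L y)
    (tendsto_pi_nhds.2 fun i => (C.data i).tendsto_L_right x) ?_
  intro hcon
  obtain ⟨y, hy, hcon⟩ := (mem_nhdsGT_iff_exists_Ioo_subset' h01).1 hcon
  have hpos : 0 < volume (Ioo x (min x₁ y)) := by simpa [h01] using hy
  refine hpos.ne' (measure_mono_null (fun r hr => ?_) h)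
  intro hr'
  exact hcon ⟨hr.1, hr.2.trans_le (min_le_right _ _)⟩
    (hr' ⟨hr.1, hr.2.trans_le (min_le_left _ _)⟩)

/-- Between its jumps, a positive chain is a superposition of graphs of absolutely continuous
functions. -/
theorem exists_strand (h01 : x₀ < x₁) (hpos : ∀ᵐ x, x ∈ Ioo x₀ x₁ → 0 ≤ C.sliceL x)
    (hj : ∀ x ∈ Ioo x₀ x₁, x ∉ C.trueJumps) {s : ℝ} (hs : s ∉ subsetSums C.coeff) (h0 : 0 < s)
    (hm : s < ∑ i, C.coeff i) :
    ∃ v : ℝ → ℝ, Measurable v ∧ IntegrableOn v (Ioo x₀ x₁) ∧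
      (∀ x ∈ Ioc x₀ x₁, quantile C.coeff s (fun i => (C.data i).L x) =
        quantile C.coeff s (fun i => (C.data i).R x₀) + ∫ r in x₀..x, v r) ∧
      ∀ᵐ x, x ∈ Ioo x₀ x₁ → v x = C.posSlope x (quantile C.coeff s fun i => (C.data i).L x) := by
  classical
  -- The right values are used at `x₀`, so that the strand is continuous up to both ends of the
  -- closed interval.
  let Z : ℝ → ι → ℝ := fun x i => if x ≤ x₀ then (C.data i).R x else (C.data i).L x
  have hZ0 : Z x₀ = fun i => (C.data i).R x₀ := by ext i; simp [Z]
  have hZ : ∀ x, x₀ < x → Z x = fun i => (C.data i).L x := by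
    intro x hx; ext i; simp [Z, hx.not_ge]
  let V : ℝ → ℝ := fun x => quantile C.coeff s (Z x)
  have hnn : ∀ x ∈ Ioc x₀ x₁, 0 ≤ C.sliceL x := fun x hx => by
    refine C.sliceL_nonneg_of_ae hx.1 ?_
    filter_upwards [hpos] with y hy hy' using hy ⟨hy'.1, hy'.2.trans_le hx.2⟩
  have hleft : ∀ x ∈ Ioc x₀ x₁, Tendsto V (𝓝[<] x) (𝓝 (V x)) := by
    intro x hx
    have h1 : Tendsto (fun y i => (C.data i).L y) (𝓝[<] x) (𝓝 (Z x)) := by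
      rw [hZ x hx.1]
      exact tendsto_pi_nhds.2 fun i => (C.data i).tendsto_L_left x
    have hev : ∀ᶠ y in 𝓝[<] x, y ∈ Ioo x₀ x := Ioo_mem_nhdsLT hx.1
    refine (tendsto_quantile h1 ?_ hs h0 hm).congr' ?_
    · filter_upwards [hev] with y hy using hnn y ⟨hy.1, hy.2.le.trans hx.2⟩
    · filter_upwards [hev] with y hy
      simp only [V, hZ y hy.1]
  have hright : ∀ x ∈ Ico x₀ x₁, Tendsto V (𝓝[>] x) (𝓝 (V x)) := by
    intro x hx
    have h1 : Tendsto (fun y i => (C.data i).L y) (𝓝[>] x) (𝓝 fun i => (C.data i).R x) :=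
      tendsto_pi_nhds.2 fun i => (C.data i).tendsto_L_right x
    have h2 : V x = quantile C.coeff s fun i => (C.data i).R x := by
      rcases hx.1.eq_or_lt with rfl | hlt
      · simp only [V, hZ0]
      · simp only [V, hZ x hlt]
        -- Single graphs may jump at `x`, but the slices from both sides agree, and the quantile
        -- sees the slice only.
        exact quantile_congr (not_not.1 (hj x ⟨hlt, hx.2⟩)) s
    rw [h2]
    have hev : ∀ᶠ y in 𝓝[>] x, y ∈ Ioo x x₁ := Ioo_mem_nhdsGT hx.2
    refine (tendsto_quantile h1 ?_ hs h0 hm).congr' ?_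
    · filter_upwards [hev] with y hy using hnn y ⟨hx.1.trans_lt hy.1, hy.2.le⟩
    · filter_upwards [hev] with y hy
      simp only [V, hZ y (hx.1.trans_lt hy.1)]
  have hcont : ContinuousOn V (Icc x₀ x₁) := by
    intro x hx
    rcases hx.1.eq_or_lt with rfl | hlt
    · have := hright x₀ ⟨le_rfl, h01⟩
      exact (continuousWithinAt_Ioi_iff_Ici.1 this).mono Icc_subset_Ici_self
    rcases hx.2.eq_or_lt with rfl | hlt'
    · exact (continuousWithinAt_Iio_iff_Iic.1 (hleft x ⟨hlt, le_rfl⟩)).mono Icc_subset_Iic_self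
    · exact (continuousAt_iff_continuous_left'_right'.2
        ⟨hleft x ⟨hlt, hlt'.le⟩, hright x ⟨hlt.le, hlt'⟩⟩).continuousWithinAt
  have hatom : ∀ x, x₀ < x → 0 < C.sliceL x (V x) := by
    intro x hx
    have := (isQuantile_quantile hs h0 hm (Z x)).slice_pos
    simp only [V]
    rw [hZ x hx] at this ⊢
    exact this
  have hsel : ∀ x ∈ Ioo x₀ x₁, ∃ i, V x = (C.data i).L x := fun x hx => by
    obtain ⟨i, hi⟩ := mem_range_of_slice_ne_zero _ (hatom x hx.1).ne'
    exact ⟨i, hi.symm⟩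
  have hac := absolutelyContinuousOnInterval_of_selection C.data h01.le hcont hsel
  refine ⟨deriv V, measurable_deriv V, ?_, fun x hx => ?_, ?_⟩
  · exact ((intervalIntegrable_iff_integrableOn_Ioc_of_le h01.le).1
      hac.intervalIntegrable_deriv).mono_set Ioo_subset_Ioc_self
  · have h1 : AbsolutelyContinuousOnInterval V x₀ x := hac.mono (by
      rw [uIcc_of_le hx.1.le, uIcc_of_le h01.le]; exact Icc_subset_Icc_right hx.2)
    rw [h1.integral_deriv_eq_sub]
    simp only [V, hZ0, hZ x hx.1]
    ring
  · have h1 : ∀ i, ∀ᵐ x, V x = (C.data i).L x → ∀ m n, HasDerivAt V m x →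
        HasDerivAt (C.data i).L n x → m = n := fun i =>
      ae_hasDerivAt_eq_of_eqOn (s := {x | V x = (C.data i).L x}) fun x hx => hx
    filter_upwards [ae_all_iff.2 h1, hac.ae_differentiableAt,
      ae_all_iff.2 fun i => (C.data i).ae_hasDerivAt, C.ae_slope_L] with x hx1 hx2 hx3 hx4 hx
    obtain ⟨i, hi⟩ := hsel x hx
    have hd : HasDerivAt V (deriv V x) x := (hx2 (by
      rw [uIcc_of_le h01.le]; exact ⟨hx.1.le, hx.2.le⟩)).hasDerivAt
    have h2 : (quantile C.coeff s fun i => (C.data i).L x) = V x := by simp only [V, hZ x hx.1]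
    rw [h2, posSlope, if_pos (hatom x hx.1), hi, hx4 i]
    exact hx1 i hi _ _ hd (hx3 i)

end Chain

/-! ### Gluing -/

namespace SBVData

theorem inc_congr {D E : SBVData} {s : Set ℝ} (hs : MeasurableSet s)
    (h1 : ∀ r ∈ s, D.slope r = E.slope r) (h2 : ∀ r ∈ s, D.jump r = E.jump r) :
    D.inc s = E.inc s := by
  rw [inc, inc, setIntegral_congr_fun hs h1]
  congr 2
  exact indicator_congr h2

open Classical in
/-- The function that follows `D` on the left of `x`, jumps by `j` at `x`, and has the derivative
of `E` on the right of `x`. -/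
def glue (D E : SBVData) (x j : ℝ) : SBVData where
  base := D.base
  slope r := if r < x then D.slope r else E.slope r
  jump r := if r < x then D.jump r else if r = x then j else E.jump r
  measurable_slope := Measurable.ite measurableSet_Iio D.measurable_slope E.measurable_slope
  integrable_slope := by
    refine (D.integrable_slope.norm.add E.integrable_slope.norm).mono'
      (Measurable.ite measurableSet_Iio D.measurable_slope
        E.measurable_slope).aestronglyMeasurable (Eventually.of_forall fun r => ?_)
    have h1 := norm_nonneg (D.slope r)
    have h2 := norm_nonneg (E.slope r)
    simp only [Pi.add_apply]
    split_ifs <;> linarith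
  summable_jump := by
    have h3 : Summable fun r => if r = x then |j| else 0 :=
      summable_of_ne_finset_zero (s := {x}) fun r hr => if_neg (by simpa using hr)
    refine Summable.of_nonneg_of_le (fun r => abs_nonneg _) (fun r => ?_)
      ((D.summable_jump.add E.summable_jump).add h3)
    have h1 := abs_nonneg (D.jump r)
    have h2 := abs_nonneg (E.jump r)
    have h3 := abs_nonneg j
    split_ifs <;> linarith

section

variable (D E : SBVData) {x : ℝ} (j : ℝ)

theorem glue_slope_of_lt {r : ℝ} (h : r < x) : (D.glue E x j).slope r = D.slope r := if_pos h

theorem glue_slope_of_ge {r : ℝ} (h : x ≤ r) : (D.glue E x j).slope r = E.slope r :=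
  if_neg h.not_gt

theorem glue_jump_of_lt {r : ℝ} (h : r < x) : (D.glue E x j).jump r = D.jump r := if_pos h

theorem glue_jump_self : (D.glue E x j).jump x = j := by simp [glue]

theorem glue_jump_of_gt {r : ℝ} (h : x < r) : (D.glue E x j).jump r = E.jump r := by
  simp [glue, h.not_gt, h.ne']

theorem glue_L_of_le {r : ℝ} (h : r ≤ x) : (D.glue E x j).L r = D.L r := by
  rw [L, L, inc_congr measurableSet_Iio
    (fun q hq => glue_slope_of_lt D E j (lt_of_lt_of_le hq h))
    (fun q hq => glue_jump_of_lt D E j (lt_of_lt_of_le hq h))]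
  rfl

theorem glue_R_self : (D.glue E x j).R x = D.L x + j := by
  rw [R_eq, glue_L_of_le D E j le_rfl, glue_jump_self]

theorem glue_L_of_gt {r : ℝ} (h : x < r) :
    (D.glue E x j).L r = D.L x + j + (E.L r - E.R x) := by
  rw [← glue_R_self D E j, E.L_sub_R h, ← inc_congr (D := D.glue E x j) measurableSet_Ioo
    (fun q hq => glue_slope_of_ge D E j hq.1.le) (fun q hq => glue_jump_of_gt D E j hq.1),
    ← L_sub_R _ h]
  ring

end

/-- The bulk energy. -/
def bulk (D : SBVData) (β : ℝ) (G : ℝ → ℝ) (s : Set ℝ) : ℝ≥0∞ :=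
  ∫⁻ r in s, ENNReal.ofReal (D.slope r ^ 2 + β * (D.L r - G r) ^ 2)

/-- The number of jumps in a set. -/
def count (D : SBVData) (s : Set ℝ) : ℝ≥0∞ := ((D.jumps ∩ s).encard : ℝ≥0∞)

section

variable {D E : SBVData} {s t : Set ℝ}

theorem count_union (h : Disjoint s t) : D.count (s ∪ t) = D.count s + D.count t := by
  rw [count, inter_union_distrib_left, encard_union_eq
    (h.mono inter_subset_right inter_subset_right), ENat.toENNReal_add]
  rfl

theorem count_congr (h : ∀ r ∈ s, D.jump r = E.jump r) : D.count s = E.count s := by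
  rw [count, count]
  congr 2
  ext r
  simp only [jumps, mem_inter_iff, mem_ofPred_eq]
  exact and_congr_left fun hr => by rw [h r hr]

theorem count_eq_zero (h : ∀ r ∈ s, D.jump r = 0) : D.count s = 0 := by
  have : D.jumps ∩ s = ∅ := by
    ext r
    simp only [jumps, mem_inter_iff, mem_ofPred_eq, mem_empty_iff_false, iff_false, not_and]
    exact fun h1 h2 => h1 (h r h2)
  rw [count, this]
  simp

theorem count_singleton_le (x : ℝ) : D.count {x} ≤ 1 := by
  have : (D.jumps ∩ {x}).encard ≤ 1 := (encard_le_encard inter_subset_right).trans (by simp)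
  have h := ENat.toENNReal_le.2 this
  rwa [ENat.toENNReal_one] at h

theorem count_le_add {F : SBVData} (h : ∀ r ∈ s, F.jump r = D.jump r + E.jump r) :
    F.count s ≤ D.count s + E.count s := by
  rw [count, count, count, ← ENat.toENNReal_add, ENat.toENNReal_le]
  refine (encard_le_encard fun r hr => ?_).trans (encard_union_le _ _)
  by_cases h0 : D.jump r = 0
  · refine Or.inr ⟨fun h1 => hr.1 ?_, hr.2⟩
    rw [h r hr.2, h0, h1, add_zero]
  · exact Or.inl ⟨h0, hr.2⟩

theorem bulk_union {β : ℝ} {G : ℝ → ℝ} (ht : MeasurableSet t) (h : Disjoint s t) :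
    D.bulk β G (s ∪ t) = D.bulk β G s + D.bulk β G t := lintegral_union ht h

theorem bulk_congr {β : ℝ} {G : ℝ → ℝ} (hs : MeasurableSet s)
    (h1 : ∀ r ∈ s, D.slope r = E.slope r) (h2 : ∀ r ∈ s, D.L r = E.L r) :
    D.bulk β G s = E.bulk β G s :=
  setLIntegral_congr_fun hs fun r hr => by rw [h1 r hr, h2 r hr]

theorem bulk_congr_ae {β : ℝ} {G : ℝ → ℝ} (h : s =ᵐ[volume] t) :
    D.bulk β G s = D.bulk β G t := setLIntegral_congr h

end

/-- The function with the slope `v` on `(x, y)`. -/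
def ofSlope {v : ℝ → ℝ} (hv : Measurable v) {x y : ℝ} (hi : IntegrableOn v (Ioo x y)) : SBVData where
  base := 0
  slope := (Ioo x y).indicator v
  jump _ := 0
  measurable_slope := hv.indicator measurableSet_Ioo
  integrable_slope := (integrable_indicator_iff measurableSet_Ioo).2 hi
  summable_jump := by simp

theorem ofSlope_L_sub_R {v : ℝ → ℝ} (hv : Measurable v) {x y : ℝ} (hi : IntegrableOn v (Ioo x y))
    {r : ℝ} (hr : r ∈ Ioc x y) : (ofSlope hv hi).L r - (ofSlope hv hi).R x = ∫ q in x..r, v q := by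
  rw [L_sub_R _ hr.1, inc, intervalIntegral.integral_of_le hr.1.le, integral_Ioc_eq_integral_Ioo]
  have h1 : ∫ q in Ioo x r, (ofSlope hv hi).slope q = ∫ q in Ioo x r, v q :=
    setIntegral_congr_fun measurableSet_Ioo fun q hq =>
      indicator_of_mem (show q ∈ Ioo x y from ⟨hq.1, hq.2.trans_le hr.2⟩) v
  rw [h1]
  simp [ofSlope]

end SBVData

theorem IsRep.energy_eq_bulk {a b : ℝ} {u : ℝ → ℝ} {D : SBVData} (h : IsRep a b u D) {α β : ℝ}
    (hβ : 0 ≤ β) {g G : ℝ → ℝ} (hgG : ∀ᵐ x, x ∈ Ioo a b → g x = G x) :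
    energy a b α β g u = D.bulk β G (Ioo a b) + ENNReal.ofReal α * D.count (Ioo a b) := by
  rw [h.energy_eq, SBVData.bulk, SBVData.count]
  congr 1
  rw [← lintegral_const_mul' _ _ ENNReal.ofReal_ne_top,
    ← lintegral_add_left (D.measurable_slope.pow_const 2).ennreal_ofReal]
  refine setLIntegral_congr_fun_ae measurableSet_Ioo ?_
  filter_upwards [hgG] with x hx hxI
  rw [hx hxI, ENNReal.ofReal_add (sq_nonneg _) (by positivity), ENNReal.ofReal_mul hβ]

/-! ### The value function -/

/-- The cost of the path with initial value `s` and with velocity `v`. -/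
def pathCost (β : ℝ) (G : ℝ → ℝ) (x y s : ℝ) (v : ℝ → ℝ) : ℝ≥0∞ :=
  ∫⁻ r in Ioo x y, ENNReal.ofReal (v r ^ 2 + β * (s + (∫ q in x..r, v q) - G r) ^ 2)

/-- The point `(x, t)` can be reached from `(a', s₀)` at the cost `k` by a path with finitely many
jumps. -/
inductive Reach (a' b' α β : ℝ) (G : ℝ → ℝ) (s₀ : ℝ) : ℝ → ℝ → ℝ≥0∞ → Prop
  | start : Reach a' b' α β G s₀ a' s₀ 0
  | jump {x t : ℝ} {k : ℝ≥0∞} (t' : ℝ) (h : Reach a' b' α β G s₀ x t k) :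
      Reach a' b' α β G s₀ x t' (k + ENNReal.ofReal α)
  | move {x t y : ℝ} {k : ℝ≥0∞} {v : ℝ → ℝ} (h : Reach a' b' α β G s₀ x t k) (hxy : x < y)
      (hy : y ≤ b') (hv : Measurable v) (hi : IntegrableOn v (Ioo x y)) :
      Reach a' b' α β G s₀ y (t + ∫ q in x..y, v q) (k + pathCost β G x y t v)

namespace Reach

variable {a' b' α β : ℝ} {G : ℝ → ℝ}

/-- A path that reaches a point is realized by a competitor. -/
theorem exists_competitor (hab : a' ≤ b') {U : SBVData} {x t : ℝ} {k : ℝ≥0∞}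
    (h : Reach a' b' α β G (U.R a') x t k) : x ∈ Icc a' b' ∧ ∃ D : SBVData,
      (∀ r < a', D.slope r = U.slope r) ∧ (∀ r < a', D.jump r = U.jump r) ∧
      (∀ r ≤ a', D.L r = U.L r) ∧ D.R x = t ∧
      D.bulk β G (Ioo a' x) + ENNReal.ofReal α * D.count (Icc a' x) ≤
        k + ENNReal.ofReal α * U.count {a'} := by
  induction h with
  -- The path starts from the right value of `U`. A jump of `U` at `a'` is counted on the left-hand
  -- side without being a part of the path, whence the last term of the bound.
  | start =>
    refine ⟨⟨le_rfl, hab⟩, U, fun _ _ => rfl, fun _ _ => rfl, fun _ _ => rfl, rfl, ?_⟩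
    simp [SBVData.bulk]
  | @jump x t k t' _ ih =>
    obtain ⟨hx, D, h1, h2, h3, h4, h5⟩ := ih
    -- The new jump is merged with the one that `D` already has at `x`; this raises the number of
    -- jumps by at most one.
    refine ⟨hx, D.glue D x (D.jump x + (t' - t)), fun r hr => ?_, fun r hr => ?_, fun r hr => ?_,
      ?_, ?_⟩
    · rw [SBVData.glue_slope_of_lt _ _ _ (hr.trans_le hx.1), h1 r hr]
    · rw [SBVData.glue_jump_of_lt _ _ _ (hr.trans_le hx.1), h2 r hr]
    · rw [SBVData.glue_L_of_le _ _ _ (hr.trans hx.1), h3 r hr]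
    · rw [SBVData.glue_R_self]
      rw [D.R_eq] at h4
      linarith
    · have e1 : ∀ E : SBVData, E.count (Icc a' x) = E.count (Ico a' x) + E.count {x} := fun E => by
        rw [← SBVData.count_union (by simp), union_comm, singleton_union, Ico_insert_right hx.1]
      rw [SBVData.bulk_congr (E := D) measurableSet_Ioo
        (fun r hr => SBVData.glue_slope_of_lt _ _ _ hr.2)
        (fun r hr => SBVData.glue_L_of_le _ _ _ hr.2.le), e1, SBVData.count_congr (E := D)
        (s := Ico a' x) (fun r hr => SBVData.glue_jump_of_lt _ _ _ hr.2), mul_add, ← add_assoc,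
        add_right_comm k]
      refine add_le_add ?_ ?_
      · refine le_trans ?_ h5
        gcongr
        rw [e1]
        exact le_self_add
      · calc _ ≤ ENNReal.ofReal α * 1 := by gcongr; exact SBVData.count_singleton_le x
          _ = _ := mul_one _
  | @move x t y k v _ hxy hy hv hi ih =>
    obtain ⟨hx, D, h1, h2, h3, h4, h5⟩ := ih
    set E := SBVData.ofSlope hv hi with hE
    have hL : ∀ r ∈ Ioc x y, (D.glue E x (D.jump x)).L r = t + ∫ q in x..r, v q := by
      intro r hr
      rw [SBVData.glue_L_of_gt _ _ _ hr.1, SBVData.ofSlope_L_sub_R hv hi hr, ← D.R_eq, h4]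
    have hj0 : ∀ r, x < r → (D.glue E x (D.jump x)).jump r = 0 := fun r hr => by
      rw [SBVData.glue_jump_of_gt _ _ _ hr]; rfl
    refine ⟨⟨hx.1.trans hxy.le, hy⟩, D.glue E x (D.jump x), fun r hr => ?_, fun r hr => ?_,
      fun r hr => ?_, ?_, ?_⟩
    · rw [SBVData.glue_slope_of_lt _ _ _ (hr.trans_le hx.1), h1 r hr]
    · rw [SBVData.glue_jump_of_lt _ _ _ (hr.trans_le hx.1), h2 r hr]
    · rw [SBVData.glue_L_of_le _ _ _ (hr.trans hx.1), h3 r hr]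
    · rw [SBVData.R_eq, hL y ⟨hxy, le_rfl⟩, hj0 y hxy, add_zero]
    · have e1 : (D.glue E x (D.jump x)).count (Icc a' y) = D.count (Icc a' x) := by
        rw [← Icc_union_Ioc_eq_Icc hx.1 hxy.le, SBVData.count_union
          (Set.disjoint_left.2 fun r hr hr' => absurd hr.2 (not_le.2 hr'.1)),
          SBVData.count_eq_zero (s := Ioc x y) fun r hr => hj0 r hr.1, add_zero]
        refine SBVData.count_congr fun r hr => ?_
        rcases hr.2.eq_or_lt with rfl | hlt
        · rw [SBVData.glue_jump_self]
        · rw [SBVData.glue_jump_of_lt _ _ _ hlt]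
      have e2 : (D.glue E x (D.jump x)).bulk β G (Ioo a' y) =
          D.bulk β G (Ioo a' x) + pathCost β G x y t v := by
        have : Ioo a' y =ᵐ[volume] (Ioo a' x ∪ Ioo x y : Set ℝ) := by
          rcases hx.1.eq_or_lt with rfl | hlt
          · exact ae_eq_set.2 ⟨by simp, by simp⟩
          · rw [← Ioc_union_Ioo_eq_Ioo hlt.le hxy]
            exact Ioo_ae_eq_Ioc.symm.union (EventuallyEq.refl _ _)
        rw [SBVData.bulk_congr_ae this, SBVData.bulk_union measurableSet_Ioo
          (Set.disjoint_left.2 fun r hr hr' => absurd hr.2 hr'.1.not_gt)]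
        congr 1
        · exact SBVData.bulk_congr measurableSet_Ioo
            (fun r hr => SBVData.glue_slope_of_lt _ _ _ hr.2)
            (fun r hr => SBVData.glue_L_of_le _ _ _ hr.2.le)
        · refine setLIntegral_congr_fun measurableSet_Ioo fun r hr => ?_
          have : E.slope r = v r := indicator_of_mem hr v
          rw [SBVData.glue_slope_of_ge _ _ _ hr.1.le, this, hL r ⟨hr.1, hr.2.le⟩]
      rw [e1, e2, add_right_comm, add_right_comm k]
      gcongr

/-- By minimality, no path from `(a', uʳ(a'))` to `(b', uˡ(b'))` is cheaper than the graph of `u`. -/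
theorem energy_le {a b : ℝ} (haa' : a < a') (hab' : a' < b') (hbb' : b' < b) (hβ : 0 ≤ β)
    {g u : ℝ → ℝ} (hgG : ∀ᵐ x, x ∈ Ioo a b → g x = G x)
    (hmin : IsDirichletMinimizer a b a' b' α β g u) (hfin : energy a b α β g u < ⊤)
    {U : SBVData} (hU : IsRep a b u U) {k : ℝ≥0∞}
    (h : Reach a' b' α β G (U.R a') b' (U.L b') k) :
    U.bulk β G (Ioo a' b') + ENNReal.ofReal α * U.count (Ioo a' b') ≤ k := by
  obtain ⟨-, D, h1, h2, h3, h4, h5⟩ := h.exists_competitor hab'.le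
  -- The competitor continues with `U` after `b'`. As `D.R b' = U.L b'`, adding `U.jump b'` to the
  -- jump of `D` makes the right values at `b'` agree.
  set E := D.glue U b' (D.jump b' + U.jump b') with hE
  have hER : E.R b' = U.R b' := by
    rw [SBVData.glue_R_self, ← add_assoc, ← D.R_eq, h4, ← U.R_eq]
  have hEr : ∀ r, b' < r → E.L r = U.L r := fun r hr => by
    rw [SBVData.glue_L_of_gt _ _ _ hr, ← SBVData.glue_R_self D U, ← hE, hER]; ring
  have hEl : ∀ r ≤ b', E.L r = D.L r := fun r hr => SBVData.glue_L_of_le _ _ _ hr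
  have hrep : IsRep a b E.L E := Eventually.of_forall fun x _ => rfl
  have hle := hmin.2 E.L hrep.isSBV (by
    have hb : ∀ᵐ x : ℝ, x ≠ b' := by
      simp [ae_iff]
    filter_upwards [hU, hb] with x hx hxb hxI
    rw [hx hxI.1]
    by_cases hxa : x ≤ a'
    · rw [hEl x (hxa.trans hab'.le), h3 x hxa]
    · have : b' ≤ x := by
        by_contra hlt
        exact hxI.2 ⟨not_le.1 hxa, not_le.1 hlt⟩
      rw [hEr x (lt_of_le_of_ne this (Ne.symm hxb))])
  rw [hU.energy_eq_bulk hβ hgG] at hle hfin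
  rw [hrep.energy_eq_bulk hβ hgG] at hle
  have hbulk : ∀ F : SBVData, F.bulk β G (Ioo a b) =
      F.bulk β G (Ioo a a') + F.bulk β G (Ioo a' b') + F.bulk β G (Ioo b' b) := by
    intro F
    rw [← Ioo_union_Ico_eq_Ioo haa' (hab'.trans hbb').le, ← Ico_union_Ico_eq_Ico hab'.le hbb'.le,
      SBVData.bulk_union (measurableSet_Ico.union measurableSet_Ico)
        (Set.disjoint_left.2 fun r hr hr' => hr'.elim (fun h => absurd hr.2 h.1.not_gt)
          (fun h => absurd hr.2 (hab'.le.trans h.1).not_gt)),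
      SBVData.bulk_union measurableSet_Ico
        (Set.disjoint_left.2 fun r hr hr' => absurd hr.2 hr'.1.not_gt),
      SBVData.bulk_congr_ae (s := Ico a' b') Ioo_ae_eq_Ico.symm,
      SBVData.bulk_congr_ae (s := Ico b' b) Ioo_ae_eq_Ico.symm, add_assoc]
  have hcount : ∀ F : SBVData, F.count (Ioo a b) =
      F.count (Ioo a a') + F.count (Icc a' b') + F.count (Ioo b' b) := by
    intro F
    rw [← Ioo_union_Ico_eq_Ioo haa' (hab'.trans hbb').le, ← Icc_union_Ioo_eq_Ico hab'.le hbb',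
      SBVData.count_union (Set.disjoint_left.2 fun r hr hr' => hr'.elim
        (fun h => absurd hr.2 h.1.not_gt) (fun h => absurd hr.2 (hab'.le.trans h.1.le).not_gt)),
      SBVData.count_union (Set.disjoint_left.2 fun r hr hr' => absurd hr.2 (not_le.2 hr'.1)),
      add_assoc]
  have hcount' : ∀ F : SBVData, F.count (Icc a' b') = F.count (Ico a' b') + F.count {b'} := fun F => by
    rw [← SBVData.count_union (by simp), union_comm, singleton_union, Ico_insert_right hab'.le]
  have hcount'' : U.count (Ico a' b') = U.count {a'} + U.count (Ioo a' b') := by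
    rw [← SBVData.count_union (by simp), singleton_union, Ioo_insert_left hab']
  have hb1 : E.bulk β G (Ioo a a') = U.bulk β G (Ioo a a') :=
    SBVData.bulk_congr measurableSet_Ioo
      (fun r hr => by rw [SBVData.glue_slope_of_lt _ _ _ (hr.2.trans hab'), h1 r hr.2])
      (fun r hr => by rw [hEl r (hr.2.le.trans hab'.le), h3 r hr.2.le])
  have hb2 : E.bulk β G (Ioo a' b') = D.bulk β G (Ioo a' b') :=
    SBVData.bulk_congr measurableSet_Ioo
      (fun r hr => SBVData.glue_slope_of_lt _ _ _ hr.2) (fun r hr => hEl r hr.2.le)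
  have hb3 : E.bulk β G (Ioo b' b) = U.bulk β G (Ioo b' b) :=
    SBVData.bulk_congr measurableSet_Ioo
      (fun r hr => SBVData.glue_slope_of_ge _ _ _ hr.1.le) (fun r hr => hEr r hr.1)
  have hc1 : E.count (Ioo a a') = U.count (Ioo a a') := SBVData.count_congr fun r hr => by
    rw [SBVData.glue_jump_of_lt _ _ _ (hr.2.trans hab'), h2 r hr.2]
  have hc2 : E.count (Icc a' b') ≤ D.count (Icc a' b') + U.count {b'} := by
    -- The merged jump at `b'` can be nonzero only if `D` or `U` jumps there.
    rw [hcount', hcount', add_assoc, SBVData.count_congr (E := D) (s := Ico a' b') fun r hr =>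
      SBVData.glue_jump_of_lt _ _ _ hr.2]
    gcongr
    refine SBVData.count_le_add fun r hr => ?_
    rw [mem_singleton_iff] at hr
    rw [hr, SBVData.glue_jump_self]
  have hc3 : E.count (Ioo b' b) = U.count (Ioo b' b) := SBVData.count_congr fun r hr =>
    SBVData.glue_jump_of_gt _ _ _ hr.1
  rw [hbulk E, hcount E, hb1, hb2, hb3, hc1, hc3] at hle
  rw [hbulk U, hcount U, hcount' U, hcount''] at hle hfin
  set κ := ENNReal.ofReal α
  -- All terms common to the energies of `u` and of the competitor, including the jumps of `u` at
  -- `a'` and `b'`. They are finite and can be cancelled.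
  set O := U.bulk β G (Ioo a a') + U.bulk β G (Ioo b' b) + κ * U.count (Ioo a a') +
    κ * U.count {a'} + κ * U.count {b'} + κ * U.count (Ioo b' b) with hO
  have hOtop : O ≠ ⊤ := by
    refine ne_top_of_le_ne_top hfin.ne (le_trans (le_self_add
      (b := U.bulk β G (Ioo a' b') + κ * U.count (Ioo a' b'))) (le_of_eq ?_))
    rw [hO]
    ring
  refine ENNReal.le_of_add_le_add_left hOtop ?_
  calc O + (U.bulk β G (Ioo a' b') + κ * U.count (Ioo a' b')) = _ := by rw [hO]; ring
    _ ≤ _ := hle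
    _ ≤ U.bulk β G (Ioo a a') + D.bulk β G (Ioo a' b') + U.bulk β G (Ioo b' b) +
        κ * (U.count (Ioo a a') + (D.count (Icc a' b') + U.count {b'}) + U.count (Ioo b' b)) := by
      gcongr
    _ = U.bulk β G (Ioo a a') + U.bulk β G (Ioo b' b) + κ * U.count (Ioo a a') +
        κ * U.count {b'} + κ * U.count (Ioo b' b) +
        (D.bulk β G (Ioo a' b') + κ * D.count (Icc a' b')) := by ring
    _ ≤ U.bulk β G (Ioo a a') + U.bulk β G (Ioo b' b) + κ * U.count (Ioo a a') +
        κ * U.count {b'} + κ * U.count (Ioo b' b) + (k + κ * U.count {a'}) := by gcongr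
    _ = O + k := by rw [hO]; ring

end Reach

/-- The least cost of reaching a point. -/
def value (a' b' α β : ℝ) (G : ℝ → ℝ) (s₀ x t : ℝ) : ℝ≥0∞ :=
  ⨅ (k : ℝ≥0∞) (_ : Reach a' b' α β G s₀ x t k), k

section Value

variable {a' b' α β : ℝ} {G : ℝ → ℝ} {s₀ : ℝ}

theorem value_le {x t : ℝ} {k : ℝ≥0∞} (h : Reach a' b' α β G s₀ x t k) :
    value a' b' α β G s₀ x t ≤ k := iInf₂_le k h

theorem value_jump_le (x t t' : ℝ) :
    value a' b' α β G s₀ x t' ≤ value a' b' α β G s₀ x t + ENNReal.ofReal α := by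
  rw [value, value, ENNReal.iInf_add]
  refine le_iInf fun k => ?_
  rw [ENNReal.iInf_add]
  exact le_iInf fun h => value_le (h.jump t')

theorem value_move_le {x y t : ℝ} {v : ℝ → ℝ} (hxy : x < y) (hy : y ≤ b') (hv : Measurable v)
    (hi : IntegrableOn v (Ioo x y)) :
    value a' b' α β G s₀ y (t + ∫ q in x..y, v q) ≤
      value a' b' α β G s₀ x t + pathCost β G x y t v := by
  rw [value, value, ENNReal.iInf_add]
  refine le_iInf fun k => ?_
  rw [ENNReal.iInf_add]
  exact le_iInf fun h => value_le (h.move hxy hy hv hi)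

theorem value_start : value a' b' α β G s₀ a' s₀ = 0 := le_antisymm (value_le .start) bot_le

/-- The path that stays at `s₀` has finite cost because `G` is bounded, and one jump then leads to
any `t`. -/
theorem value_lt_top {K : ℝ} (hK : ∀ x, |G x| ≤ K) (hβ : 0 ≤ β) {x : ℝ} (hx : x ∈ Icc a' b')
    (t : ℝ) : value a' b' α β G s₀ x t < ⊤ := by
  have h1 : value a' b' α β G s₀ x s₀ < ⊤ := by
    rcases hx.1.eq_or_lt with rfl | hlt
    · rw [value_start]; exact ENNReal.zero_lt_top
    · have := value_move_le (α := α) (β := β) (G := G) (s₀ := s₀) (t := s₀) (a' := a') (v := fun _ => 0)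
        hlt hx.2 measurable_const (by simp)
      rw [value_start, intervalIntegral.integral_zero, add_zero, zero_add] at this
      refine this.trans_lt ?_
      refine lt_of_le_of_lt (setLIntegral_mono' measurableSet_Ioo
        (g := fun _ => ENNReal.ofReal (β * (|s₀| + K) ^ 2)) fun r _ => ENNReal.ofReal_le_ofReal ?_) ?_
      · have h2 : (s₀ - G r) ^ 2 ≤ (|s₀| + K) ^ 2 := by
          rw [← sq_abs]
          have := abs_sub s₀ (G r)
          have := hK r
          gcongr
          linarith
        simp only [intervalIntegral.integral_zero, add_zero]
        nlinarith
      · rw [setLIntegral_const]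
        exact ENNReal.mul_lt_top ENNReal.ofReal_lt_top (by simp)
  exact (value_jump_le x s₀ t).trans_lt (ENNReal.add_lt_top.2 ⟨h1, ENNReal.ofReal_lt_top⟩)

end Value

/-! ### Transport of the value function along chains -/

/-- The properties of the value function that are used below. -/
structure IsValue (a' b' α β : ℝ) (G : ℝ → ℝ) (W : ℝ → ℝ → ℝ) : Prop where
  jump : ∀ x ∈ Icc a' b', ∀ t t', W x t' - W x t ≤ α
  move : ∀ x ∈ Icc a' b', ∀ y ∈ Icc a' b', x < y → ∀ (t : ℝ) (v : ℝ → ℝ), Measurable v →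
    IntegrableOn v (Ioo x y) →
    IntegrableOn (fun r => v r ^ 2 + β * (t + (∫ q in x..r, v q) - G r) ^ 2) (Ioo x y) →
    W y (t + ∫ q in x..y, v q) - W x t ≤
      ∫ r in Ioo x y, (v r ^ 2 + β * (t + (∫ q in x..r, v q) - G r) ^ 2)

theorem isValue_value {a' b' α β s₀ K : ℝ} {G : ℝ → ℝ} (hK : ∀ x, |G x| ≤ K) (hα : 0 ≤ α)
    (hβ : 0 ≤ β) :
    IsValue a' b' α β G fun x t => (value a' b' α β G s₀ x t).toReal := by
  have hfin : ∀ x ∈ Icc a' b', ∀ t, value a' b' α β G s₀ x t ≠ ⊤ := fun x hx t =>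
    (value_lt_top hK hβ hx t).ne
  constructor
  · intro x hx t t'
    have h1 := ENNReal.toReal_mono (ENNReal.add_ne_top.2 ⟨hfin x hx t, ENNReal.ofReal_ne_top⟩)
      (value_jump_le (a' := a') (b' := b') (α := α) (β := β) (G := G) (s₀ := s₀) x t t')
    rw [ENNReal.toReal_add (hfin x hx t) ENNReal.ofReal_ne_top, ENNReal.toReal_ofReal hα] at h1
    linarith
  · intro x hx y hy hxy t v hv hi hcost
    have hnn : ∀ r, 0 ≤ v r ^ 2 + β * (t + (∫ q in x..r, v q) - G r) ^ 2 := fun r => by positivity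
    have h0 : pathCost β G x y t v =
        ENNReal.ofReal (∫ r in Ioo x y, (v r ^ 2 + β * (t + (∫ q in x..r, v q) - G r) ^ 2)) := by
      rw [ofReal_integral_eq_lintegral_ofReal hcost (Eventually.of_forall hnn)]
      rfl
    have h1 := value_move_le (a' := a') (α := α) (β := β) (G := G) (s₀ := s₀) (t := t) hxy hy.2 hv hi
    rw [h0] at h1
    have h2 := ENNReal.toReal_mono (ENNReal.add_ne_top.2 ⟨hfin x hx t, ENNReal.ofReal_ne_top⟩) h1
    rw [ENNReal.toReal_add (hfin x hx t) ENNReal.ofReal_ne_top,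
      ENNReal.toReal_ofReal (integral_nonneg hnn)] at h2
    linarith

theorem integrableOn_primitive_sq {x y t K : ℝ} {v G : ℝ → ℝ} (hv : Measurable v)
    (hi : IntegrableOn v (Ioo x y)) (hG : Measurable G) (hK : ∀ r, |G r| ≤ K) :
    IntegrableOn (fun r => (t + (∫ q in x..r, v q) - G r) ^ 2) (Ioo x y) := by
  set E := SBVData.ofSlope hv hi
  have h := Chain.integrableOn_sq_sub (a := x) (b := y) E (G := fun r => G r - (t - E.R x))
    (hG.sub_const _) (K := K + |t - E.R x|) fun r => (abs_sub _ _).trans (by gcongr; exact hK r)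
  refine h.congr_fun (fun r hr => ?_) measurableSet_Ioo
  have := SBVData.ofSlope_L_sub_R hv hi (r := r) ⟨hr.1, hr.2.le⟩
  change (E.L r - (G r - (t - E.R x))) ^ 2 = _
  rw [← this]
  ring

namespace Chain

variable {ι : Type*} [Fintype ι] (C : Chain ι) {a' b' α β K : ℝ} {G : ℝ → ℝ} {W : ℝ → ℝ → ℝ}

/-- The chain is a weighted sum of quantile strands, each of which is an admissible path; the
inequality for `W` along the strands is summed, and the weights turn sums over strands back into
sums over the slices. Square integrability of the velocity of a strand follows from that of all
positive slopes, as it is always one of them. -/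
theorem transport_of_no_jumps (hW : IsValue a' b' α β G W) (hG : Measurable G)
    (hK : ∀ x, |G x| ≤ K) {x₀ x₁ : ℝ} (hx₀ : x₀ ∈ Icc a' b') (hx₁ : x₁ ∈ Icc a' b')
    (h01 : x₀ < x₁) (hpos : ∀ᵐ x, x ∈ Ioo x₀ x₁ → 0 ≤ C.sliceL x)
    (hj : ∀ x ∈ Ioo x₀ x₁, x ∉ C.trueJumps)
    (hint : ∀ i, IntegrableOn (fun x => C.posSlope x ((C.data i).L x) ^ 2) (Ioo x₀ x₁)) :
    ∑ i, C.coeff i * W x₁ ((C.data i).L x₁) - ∑ i, C.coeff i * W x₀ ((C.data i).R x₀) ≤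
      ∑ i, C.coeff i * ∫ x in Ioo x₀ x₁,
        (C.posSlope x ((C.data i).L x) ^ 2 + β * ((C.data i).L x - G x) ^ 2) := by
  classical
  obtain ⟨J, s, w, hJ, hlev⟩ := exists_levels C.coeff
  let q : ℝ → ℝ → ℝ := fun σ x => quantile C.coeff (s σ) fun i => (C.data i).L x
  let e : ℝ → ℝ → ℝ := fun x t => C.posSlope x t ^ 2 + β * (t - G x) ^ 2
  have hL : 0 ≤ C.sliceL x₁ := C.sliceL_nonneg_of_ae h01 hpos
  have hR : 0 ≤ C.sliceR x₀ := C.sliceR_nonneg_of_ae h01 hpos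
  have hei : ∀ i, IntegrableOn (fun x => e x ((C.data i).L x)) (Ioo x₀ x₁) := fun i =>
    (hint i).add ((integrableOn_sq_sub (C.data i) hG hK).const_mul β)
  have key : ∀ σ ∈ J, IntegrableOn (fun x => e x (q σ x)) (Ioo x₀ x₁) ∧
      W x₁ (q σ x₁) - W x₀ (quantile C.coeff (s σ) fun i => (C.data i).R x₀) ≤
        ∫ x in Ioo x₀ x₁, e x (q σ x) := by
    intro σ hσ
    obtain ⟨v, hv, hvi, hpath, hslope⟩ := C.exists_strand h01 hpos hj (hJ σ hσ).2.1 (hJ σ hσ).2.2.1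
      (hJ σ hσ).2.2.2
    set t := quantile C.coeff (s σ) fun i => (C.data i).R x₀
    have hmem : ∀ x, ∃ i, (C.data i).L x = q σ x := fun x =>
      mem_range_of_slice_ne_zero _ (isQuantile_quantile (hJ σ hσ).2.1 (hJ σ hσ).2.2.1
        (hJ σ hσ).2.2.2 _).slice_pos.ne'
    have hsq : IntegrableOn (fun x => v x ^ 2) (Ioo x₀ x₁) := by
      refine Integrable.mono' (integrable_finsetSum Finset.univ fun i _ => hint i)
        (hv.pow_const 2).aestronglyMeasurable ?_
      rw [ae_restrict_iff' measurableSet_Ioo]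
      filter_upwards [hslope] with x hx hxI
      obtain ⟨i, hi⟩ := hmem x
      rw [hx hxI, Real.norm_eq_abs, abs_of_nonneg (sq_nonneg _)]
      change C.posSlope x (q σ x) ^ 2 ≤ _
      rw [← hi]
      exact Finset.single_le_sum (f := fun i => C.posSlope x ((C.data i).L x) ^ 2)
        (fun j _ => sq_nonneg _) (Finset.mem_univ i)
    have hcost : IntegrableOn (fun r => v r ^ 2 + β * (t + (∫ q in x₀..r, v q) - G r) ^ 2)
        (Ioo x₀ x₁) := hsq.add ((integrableOn_primitive_sq hv hvi hG hK).const_mul β)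
    have hae : (fun r => v r ^ 2 + β * (t + (∫ q in x₀..r, v q) - G r) ^ 2)
        =ᵐ[volume.restrict (Ioo x₀ x₁)] fun x => e x (q σ x) := by
      rw [EventuallyEq, ae_restrict_iff' measurableSet_Ioo]
      filter_upwards [hslope] with x hx hxI
      rw [hx hxI, ← hpath x ⟨hxI.1, hxI.2.le⟩]
    refine ⟨hcost.congr hae, ?_⟩
    rw [← integral_congr_ae hae]
    have := hW.move x₀ hx₀ x₁ hx₁ h01 t v hv hvi hcost
    rwa [← hpath x₁ ⟨h01, le_rfl⟩] at this
  have h1 := hlev _ hL (W x₁)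
  have h2 := hlev _ hR (W x₀)
  rw [← h1, ← h2, ← Finset.sum_sub_distrib]
  calc ∑ σ ∈ J, (w σ * W x₁ (q σ x₁) -
        w σ * W x₀ (quantile C.coeff (s σ) fun i => (C.data i).R x₀))
      ≤ ∑ σ ∈ J, w σ * ∫ x in Ioo x₀ x₁, e x (q σ x) := by
        refine Finset.sum_le_sum fun σ hσ => ?_
        rw [← mul_sub]
        exact mul_le_mul_of_nonneg_left (key σ hσ).2 (hJ σ hσ).1
    _ = ∫ x in Ioo x₀ x₁, ∑ σ ∈ J, w σ * e x (q σ x) := by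
        rw [integral_finsetSum _ fun σ hσ => (key σ hσ).1.const_mul _]
        exact Finset.sum_congr rfl fun σ _ => (integral_const_mul _ _).symm
    _ = ∫ x in Ioo x₀ x₁, ∑ i, C.coeff i * e x ((C.data i).L x) := by
        refine setIntegral_congr_ae measurableSet_Ioo ?_
        filter_upwards [hpos] with x hx hxI
        exact hlev _ (hx hxI) (e x)
    _ = ∑ i, C.coeff i * ∫ x in Ioo x₀ x₁, e x ((C.data i).L x) := by
        rw [integral_finsetSum _ fun i _ => (hei i).const_mul _]
        exact Finset.sum_congr rfl fun i _ => integral_const_mul _ _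

/-- Induction on the number of jump points in the interval: cutting at one of them leaves the
difference of the values of `W` on its two sides. -/
theorem transport (hW : IsValue a' b' α β G W) (hG : Measurable G)
    (hK : ∀ x, |G x| ≤ K) {x₀ x₁ : ℝ} (hx₀ : x₀ ∈ Icc a' b') (hx₁ : x₁ ∈ Icc a' b')
    (h01 : x₀ < x₁) (hpos : ∀ᵐ x, x ∈ Ioo x₀ x₁ → 0 ≤ C.sliceL x) (P : Finset ℝ)
    (hj : ∀ x ∈ Ioo x₀ x₁, x ∈ C.trueJumps → x ∈ P)
    (hint : ∀ i, IntegrableOn (fun x => C.posSlope x ((C.data i).L x) ^ 2) (Ioo x₀ x₁)) :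
    ∑ i, C.coeff i * W x₁ ((C.data i).L x₁) - ∑ i, C.coeff i * W x₀ ((C.data i).R x₀) ≤
      (∑ i, C.coeff i * ∫ x in Ioo x₀ x₁,
        (C.posSlope x ((C.data i).L x) ^ 2 + β * ((C.data i).L x - G x) ^ 2)) +
      ∑ y ∈ P with y ∈ Ioo x₀ x₁, ∑ i, C.coeff i *
        (W y ((C.data i).R y) - W y ((C.data i).L y)) := by
  classical
  induction hn : (P.filter fun y => y ∈ Ioo x₀ x₁).card using Nat.strong_induction_on
    generalizing x₀ x₁ with
  | _ n ih =>
    rcases (P.filter fun y => y ∈ Ioo x₀ x₁).eq_empty_or_nonempty with hemp | ⟨y, hy⟩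
    · rw [hemp, Finset.sum_empty, add_zero]
      refine C.transport_of_no_jumps hW hG hK hx₀ hx₁ h01 hpos (fun x hx hxj => ?_) hint
      have : x ∈ P.filter fun y => y ∈ Ioo x₀ x₁ := Finset.mem_filter.2 ⟨hj x hx hxj, hx⟩
      rw [hemp] at this
      exact absurd this (Finset.notMem_empty x)
    · have hyI := (Finset.mem_filter.1 hy).2
      have hya : y ∈ Icc a' b' := ⟨hx₀.1.trans hyI.1.le, hyI.2.le.trans hx₁.2⟩
      have s1 : Ioo x₀ y ⊆ Ioo x₀ x₁ := Ioo_subset_Ioo_right hyI.2.le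
      have s2 : Ioo y x₁ ⊆ Ioo x₀ x₁ := Ioo_subset_Ioo_left hyI.1.le
      have heq : (P.filter fun y => y ∈ Ioo x₀ x₁) = insert y
          ((P.filter fun r => r ∈ Ioo x₀ y) ∪ P.filter fun r => r ∈ Ioo y x₁) := by
        ext r
        simp only [Finset.mem_filter, Finset.mem_insert, Finset.mem_union]
        constructor
        · rintro ⟨hr, hrI⟩
          rcases lt_trichotomy r y with h | h | h
          · exact Or.inr (Or.inl ⟨hr, hrI.1, h⟩)
          · exact Or.inl h
          · exact Or.inr (Or.inr ⟨hr, h, hrI.2⟩)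
        · rintro (rfl | ⟨hr, h⟩ | ⟨hr, h⟩)
          · exact Finset.mem_filter.1 hy
          · exact ⟨hr, s1 h⟩
          · exact ⟨hr, s2 h⟩
      have hdisj : Disjoint (P.filter fun r => r ∈ Ioo x₀ y) (P.filter fun r => r ∈ Ioo y x₁) := by
        rw [Finset.disjoint_left]
        intro r h1 h2
        exact absurd (Finset.mem_filter.1 h1).2.2 (Finset.mem_filter.1 h2).2.1.not_gt
      have hnot : y ∉ (P.filter fun r => r ∈ Ioo x₀ y) ∪ P.filter fun r => r ∈ Ioo y x₁ := by
        simp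
      rw [heq, Finset.card_insert_of_notMem hnot, Finset.card_union_of_disjoint hdisj] at hn
      have h1 := ih _ (by omega) hx₀ hya hyI.1 (by
        filter_upwards [hpos] with x hx hxI using hx (s1 hxI)) (fun x hx => hj x (s1 hx))
        (fun i => (hint i).mono_set s1) rfl
      have h2 := ih _ (by omega) hya hx₁ hyI.2 (by
        filter_upwards [hpos] with x hx hxI using hx (s2 hxI)) (fun x hx => hj x (s2 hx))
        (fun i => (hint i).mono_set s2) rfl
      have hsplit : ∀ i, ∫ x in Ioo x₀ x₁,
          (C.posSlope x ((C.data i).L x) ^ 2 + β * ((C.data i).L x - G x) ^ 2) =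
          (∫ x in Ioo x₀ y,
            (C.posSlope x ((C.data i).L x) ^ 2 + β * ((C.data i).L x - G x) ^ 2)) +
          ∫ x in Ioo y x₁,
            (C.posSlope x ((C.data i).L x) ^ 2 + β * ((C.data i).L x - G x) ^ 2) := by
        intro i
        have hei : IntegrableOn (fun x => C.posSlope x ((C.data i).L x) ^ 2 +
            β * ((C.data i).L x - G x) ^ 2) (Ioo x₀ x₁) :=
          (hint i).add ((integrableOn_sq_sub (C.data i) hG hK).const_mul β)
        have hae : Ioo x₀ x₁ =ᵐ[volume] (Ioo x₀ y ∪ Ioo y x₁ : Set ℝ) := by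
          rw [← Ioc_union_Ioo_eq_Ioo hyI.1.le hyI.2]
          exact Ioo_ae_eq_Ioc.symm.union (EventuallyEq.refl _ _)
        rw [setIntegral_congr_set hae, setIntegral_union (Set.disjoint_left.2 fun r hr hr' =>
          absurd hr.2 hr'.1.not_gt) measurableSet_Ioo (hei.mono_set s1) (hei.mono_set s2)]
      simp_rw [hsplit, mul_add, Finset.sum_add_distrib]
      rw [heq, Finset.sum_insert hnot, Finset.sum_union hdisj]
      have h3 : ∑ i, C.coeff i * (W y ((C.data i).R y) - W y ((C.data i).L y)) =
          ∑ i, C.coeff i * W y ((C.data i).R y) - ∑ i, C.coeff i * W y ((C.data i).L y) := by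
        simp only [mul_sub, Finset.sum_sub_distrib]
      linarith

end Chain

/-! ### The calibration -/

open Classical in
/-- The first component of the calibration, on the graph of `U`. -/
def graphField (U : SBVData) (x t : ℝ) : ℝ := if t = U.L x then 2 * U.slope x else 0

theorem measurable_graphField (U : SBVData) : Measurable (Function.uncurry (graphField U)) := by
  have h1 : MeasurableSet {q : ℝ × ℝ | q.2 = U.L q.1} :=
    measurableSet_eq_fun measurable_snd (U.measurable_L.comp measurable_fst)
  have h2 : Measurable fun q : ℝ × ℝ => 2 * U.slope q.1 :=
    (U.measurable_slope.comp measurable_fst).const_mul 2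
  exact Measurable.ite h1 h2 measurable_const

theorem countable_graphField (U : SBVData) (x : ℝ) : {t | graphField U x t ≠ 0}.Countable := by
  refine (Set.countable_singleton (U.L x)).mono fun t (ht : graphField U x t ≠ 0) => ?_
  by_contra h
  exact ht (if_neg h)

open Classical in
theorem ae_graphField (U D : SBVData) : ∀ᵐ x, graphField U x (D.L x) * D.slope x -
    graphField U x (D.L x) ^ 2 / 4 = if D.L x = U.L x then U.slope x ^ 2 else 0 := by
  filter_upwards [D.ae_slope_eq U] with x hx
  rw [graphField]
  split_ifs with h
  · rw [hx h]; ring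
  · ring

/-- The calibration as a functional of the data of a function. -/
def calib (a b a' b' β : ℝ) (G : ℝ → ℝ) (U : SBVData) (P : Finset ℝ) (ψ W : ℝ → ℝ → ℝ)
    (D : SBVData) : ℝ :=
  (∫ x in Ioo a b \ Ioo a' b', (graphField U x (D.L x) * D.slope x -
    (graphField U x (D.L x) ^ 2 / 4 - β * (D.L x - G x) ^ 2))) +
  ∑ y ∈ P, (∫ t in D.L y..D.R y, ψ y t) + (W b' (D.L b') - W a' (D.R a'))

theorem integrableOn_calib {a b a' b' β K : ℝ} {G : ℝ → ℝ} {U : SBVData}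
    (hU : IntegrableOn (fun x => U.slope x ^ 2) (Ioo a b)) (hG : Measurable G)
    (hK : ∀ x, |G x| ≤ K) (D : SBVData) :
    IntegrableOn (fun x => graphField U x (D.L x) * D.slope x -
      (graphField U x (D.L x) ^ 2 / 4 - β * (D.L x - G x) ^ 2)) (Ioo a b \ Ioo a' b') := by
  classical
  have h1 : IntegrableOn (fun x => if D.L x = U.L x then U.slope x ^ 2 else 0) (Ioo a b) := by
    refine Integrable.mono' hU (Measurable.ite (measurableSet_eq_fun D.measurable_L U.measurable_L)
      (U.measurable_slope.pow_const 2) measurable_const).aestronglyMeasurable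
      (Eventually.of_forall fun x => ?_)
    split_ifs
    · rw [Real.norm_eq_abs, abs_of_nonneg (sq_nonneg _)]
    · simpa using sq_nonneg _
  have h2 := (h1.add ((Chain.integrableOn_sq_sub (a := a) (b := b) D hG hK).const_mul β)).mono_set
    (sdiff_subset (t := Ioo a' b'))
  refine h2.congr (ae_restrict_of_ae ?_)
  filter_upwards [ae_graphField U D] with x hx
  simp only [Pi.add_apply]
  rw [← hx]
  ring

namespace Chain

variable {ι : Type*} [Fintype ι] (C : Chain ι) {a b a' b' α β K : ℝ} {g G : ℝ → ℝ}
  {W : ℝ → ℝ → ℝ} {U : SBVData} {P : Finset ℝ} {ψ : ℝ → ℝ → ℝ} {T : FormFunctional a b}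

/-- The test field depends on the chain. Outside `I'` it is the fixed field of `calib`; inside it
has first component `2 * posSlope`, and over the true jumps its vertical fluxes are the increments
of `W`. Its flux is at most `M`. -/
theorem sum_calib_le (haa' : a < a') (hab' : a' < b') (hbb' : b' < b) (hα : 0 < α) (hβ : 0 ≤ β)
    (hG : Measurable G) (hK : ∀ x, |G x| ≤ K) (hgG : ∀ᵐ x, x ∈ Ioo a b → g x = G x)
    (hW : IsValue a' b' α β G W) (hU : IntegrableOn (fun x => U.slope x ^ 2) (Ioo a b))
    (hP : ∀ y ∈ P, y ∈ Ioo a b \ Ioo a' b')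
    (hψ : ∀ y, Measurable (ψ y) ∧ (∀ s t, IntervalIntegrable (ψ y) volume s t) ∧
      (∀ s t, |∫ r in s..t, ψ y r| ≤ α))
    (hT : C.Represents T) {M : ℝ} (hM : lift a b α β g T ≤ M) :
    ∑ i, C.coeff i * calib a b a' b' β G U P ψ W (C.data i) ≤ M := by
  classical
  have hI : Ioo a' b' ⊆ Ioo a b := Ioo_subset_Ioo haa'.le hbb'.le
  obtain ⟨N, hN, hN0, hNj, hNg⟩ := C.exists_null_set hgG
  have hpos := C.ae_sliceL_nonneg hα.le hβ hgG hT hM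
  have hfin : (C.trueJumps ∩ Ioo a' b').Finite :=
    (C.finite_trueJumps hα hβ hgG hT hM).subset (inter_subset_inter_right _ hI)
  have hint := C.integrableOn_posSlope_sq hα.le hβ hG hK hgG hT hM
  let P₁ : Finset ℝ := hfin.toFinset
  have hP₁ : ∀ y ∈ P₁, y ∈ Ioo a' b' := fun y hy => ((Set.Finite.mem_toFinset _).1 hy).2
  have hdisj : Disjoint P₁ P := Finset.disjoint_left.2 fun y h1 h2 => (hP y h2).2 (hP₁ y h1)
  have hex : ∀ y, ∃ χ : ℝ → ℝ, (Measurable χ ∧ (∀ s t, IntervalIntegrable χ volume s t) ∧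
      (∀ s t, |∫ r in s..t, χ r| ≤ α)) ∧ (y ∉ Ioo a' b' → χ = ψ y) ∧
      (y ∈ Ioo a' b' → ∀ i, ∫ t in (C.data i).L y..(C.data i).R y, χ t =
        W y ((C.data i).R y) - W y ((C.data i).L y)) := by
    intro y
    by_cases hy : y ∈ Ioo a' b'
    · obtain ⟨χ, h1, h2⟩ := C.exists_vertical hα.le y (W y)
        (fun s t => hW.jump y (Ioo_subset_Icc_self hy) t s)
      exact ⟨χ, h1, fun h => absurd hy h, fun _ => h2⟩
    · exact ⟨ψ y, hψ y, fun _ => rfl, fun h => absurd h hy⟩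
  choose χ hχ hχψ hχW using hex
  let A : ℝ → ℝ → ℝ := fun x t => if x ∈ Ioo a' b' then 2 * C.posSlope x t else graphField U x t
  have hA : Measurable (Function.uncurry A) := by
    have h1 : Measurable fun q : ℝ × ℝ => C.posSlope q.1 q.2 := C.measurable_posSlope
    have h2 : Measurable fun q : ℝ × ℝ => graphField U q.1 q.2 := measurable_graphField U
    exact Measurable.ite (measurable_fst measurableSet_Ioo) (h1.const_mul 2) h2
  have hA' : ∀ x, {t | A x t ≠ 0}.Countable := by
    intro x
    by_cases hx : x ∈ Ioo a' b'
    · refine (C.countable_posSlope x).mono fun t (ht : A x t ≠ 0) (h0 : C.posSlope x t = 0) =>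
        ht (by simp only [A]; rw [if_pos hx, h0, mul_zero])
    · refine (countable_graphField U x).mono fun t (ht : A x t ≠ 0) (h0 : graphField U x t = 0) =>
        ht (by simp only [A]; rw [if_neg hx, h0])
  let F : TestField a b α β g := energyField (P₁ ∪ P)
    (fun y hy => (Finset.mem_union.1 hy).elim (fun h => hI (hP₁ y h)) fun h => (hP y h).1)
    hN hN0 hNg hG χ hχ hA hA'
  have hin : ∀ i, ∀ᵐ x, x ∈ Ioo a' b' → A x ((C.data i).L x) * (C.data i).slope x -
      A x ((C.data i).L x) ^ 2 / 4 = C.posSlope x ((C.data i).L x) ^ 2 := by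
    intro i
    filter_upwards [C.ae_slope_L] with x hx hxI
    simp only [A, if_pos hxI]
    by_cases hp : 0 < C.sliceL x ((C.data i).L x)
    · rw [posSlope, if_pos hp, hx i]; ring
    · rw [posSlope, if_neg hp]; ring
  have hfi : ∀ i, IntegrableOn (fun x => A x ((C.data i).L x) * (C.data i).slope x -
      A x ((C.data i).L x) ^ 2 / 4) (Ioo a b) := by
    intro i
    have hp : Measurable fun x => (x, (C.data i).L x) :=
      measurable_id.prodMk (C.data i).measurable_L
    have hAm : Measurable fun x => A x ((C.data i).L x) := by
      have := hA.comp hp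
      exact this
    refine Integrable.mono' ((hint i).add hU) ((hAm.mul (C.data i).measurable_slope).sub
      ((hAm.pow_const 2).div_const 4)).aestronglyMeasurable (ae_restrict_of_ae ?_)
    filter_upwards [hin i, ae_graphField U (C.data i)] with x h1 h2
    have n1 := sq_nonneg (C.posSlope x ((C.data i).L x))
    have n2 := sq_nonneg (U.slope x)
    simp only [Pi.add_apply]
    by_cases hx : x ∈ Ioo a' b'
    · rw [h1 hx, Real.norm_eq_abs, abs_of_nonneg n1]; linarith
    · simp only [A, if_neg hx]
      rw [h2]
      split_ifs
      · rw [Real.norm_eq_abs, abs_of_nonneg n2]; linarith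
      · rw [norm_zero]; linarith
  have hFi : ∀ i, F.IntegrableFor (C.data i) := fun i =>
    energyField_integrableFor hK (hNj i) (hfi i)
  have hle : ∑ i, C.coeff i * F.flux (C.data i) ≤ M :=
    EReal.coe_le_coe_iff.1 ((TestField.sum_flux_le_lift hα.le hβ hT hFi).trans hM)
  have hflux : ∀ i, F.flux (C.data i) = calib a b a' b' β G U P ψ W (C.data i) +
      ((∫ x in Ioo a' b', (C.posSlope x ((C.data i).L x) ^ 2 + β * ((C.data i).L x - G x) ^ 2)) +
        ∑ y ∈ P₁, (W y ((C.data i).R y) - W y ((C.data i).L y)) -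
        (W b' ((C.data i).L b') - W a' ((C.data i).R a'))) := by
    intro i
    have e1 : ∑ y ∈ P₁, (∫ t in (C.data i).L y..(C.data i).R y, χ y t) =
        ∑ y ∈ P₁, (W y ((C.data i).R y) - W y ((C.data i).L y)) :=
      Finset.sum_congr rfl fun y hy => hχW y (hP₁ y hy) i
    have e2 : ∑ y ∈ P, (∫ t in (C.data i).L y..(C.data i).R y, χ y t) =
        ∑ y ∈ P, (∫ t in (C.data i).L y..(C.data i).R y, ψ y t) :=
      Finset.sum_congr rfl fun y hy => by rw [hχψ y (hP y hy).2]
    have e3 : ∫ x in Ioo a' b', (A x ((C.data i).L x) * (C.data i).slope x -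
        (A x ((C.data i).L x) ^ 2 / 4 - β * ((C.data i).L x - G x) ^ 2)) =
        ∫ x in Ioo a' b', (C.posSlope x ((C.data i).L x) ^ 2 +
          β * ((C.data i).L x - G x) ^ 2) := by
      refine setIntegral_congr_ae measurableSet_Ioo ?_
      filter_upwards [hin i] with x hx hxI
      rw [← hx hxI]; ring
    have e4 : ∫ x in Ioo a b \ Ioo a' b', (A x ((C.data i).L x) * (C.data i).slope x -
        (A x ((C.data i).L x) ^ 2 / 4 - β * ((C.data i).L x - G x) ^ 2)) =
        ∫ x in Ioo a b \ Ioo a' b', (graphField U x ((C.data i).L x) * (C.data i).slope x -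
        (graphField U x ((C.data i).L x) ^ 2 / 4 - β * ((C.data i).L x - G x) ^ 2)) := by
      refine setIntegral_congr_fun (measurableSet_Ioo.diff measurableSet_Ioo) fun x hx => ?_
      simp only [A, if_neg hx.2]
    have e5 := integral_inter_add_sdiff (μ := volume) (s := Ioo a b) (t := Ioo a' b')
      measurableSet_Ioo (hFi i).2
    rw [inter_eq_right.2 hI] at e5
    rw [TestField.flux, calib, ← e5]
    simp only [F, energyField]
    rw [Finset.sum_union hdisj, e1, e2, e3, e4]
    ring
  have htr := C.transport hW hG hK (left_mem_Icc.2 hab'.le) (right_mem_Icc.2 hab'.le) hab' (by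
    filter_upwards [hpos] with x hx hxI using hx (hI hxI)) P₁
    (fun x hx hxj => (Set.Finite.mem_toFinset _).2 ⟨hxj, hx⟩) (fun i => (hint i).mono_set hI)
  rw [Finset.filter_true_of_mem hP₁, Finset.sum_comm] at htr
  simp only [hflux, mul_add, mul_sub, Finset.sum_add_distrib, Finset.sum_sub_distrib,
    Finset.mul_sum] at hle htr ⊢
  linarith

theorem sum_calib_le_lift (haa' : a < a') (hab' : a' < b') (hbb' : b' < b) (hα : 0 < α)
    (hβ : 0 ≤ β) (hG : Measurable G) (hK : ∀ x, |G x| ≤ K)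
    (hgG : ∀ᵐ x, x ∈ Ioo a b → g x = G x)
    (hW : IsValue a' b' α β G W) (hU : IntegrableOn (fun x => U.slope x ^ 2) (Ioo a b))
    (hP : ∀ y ∈ P, y ∈ Ioo a b \ Ioo a' b')
    (hψ : ∀ y, Measurable (ψ y) ∧ (∀ s t, IntervalIntegrable (ψ y) volume s t) ∧
      (∀ s t, |∫ r in s..t, ψ y r| ≤ α)) (hT : C.Represents T) :
    ((∑ i, C.coeff i * calib a b a' b' β G U P ψ W (C.data i) : ℝ) : EReal) ≤
      lift a b α β g T := by
  rw [← EReal.le_of_forall_lt_iff_le]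
  exact fun M hM => EReal.coe_le_coe_iff.2
    (C.sum_calib_le haa' hab' hbb' hα hβ hG hK hgG hW hU hP hψ hT hM.le)

end Chain

/-! ### Currents that vanish outside the inner strip -/

theorem plane_zero : (!₂[0, 0] : Plane) = 0 := by
  ext i; fin_cases i <;> simp

namespace Chain

variable {ι : Type*} [Fintype ι] (C : Chain ι) {a b : ℝ}

/-- The opposite chain. -/
def neg : Chain ι := ⟨fun i => -C.coeff i, C.data⟩

theorem density_neg (p : Plane) : C.neg.density a b p = -C.density a b p := by
  simp [density, neg]

theorem sliceL_neg (x : ℝ) : C.neg.sliceL x = -C.sliceL x := slice_neg _ _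

theorem sliceR_neg (x : ℝ) : C.neg.sliceR x = -C.sliceR x := slice_neg _ _

variable {C} {A : Set ℝ}

theorem sum_flux_eq_zero (h0 : ∀ᵐ p ∂(μH[1] : Measure Plane), p 0 ∈ A → C.density a b p = 0)
    {α β : ℝ} {g : ℝ → ℝ} {F : TestField a b α β g} (hF : ∀ i, F.IntegrableFor (C.data i))
    (hS : ∀ p, p 0 ∉ A → F.field p = 0) : ∑ i, C.coeff i * F.flux (C.data i) = 0 := by
  rw [← TestField.integral_cross_chain hF]
  refine integral_eq_zero_of_ae ?_
  filter_upwards [h0] with p hp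
  by_cases hpA : p 0 ∈ A
  · rw [hp hpA, cross_zero]; rfl
  · rw [hS p hpA]; simp [cross]

/-- The fields that detect negative multiplicities over `A` vanish elsewhere, so they have no flux
through the chain. -/
theorem ae_sliceL_nonneg_of_density_eq_zero (hA : MeasurableSet A)
    (h0 : ∀ᵐ p ∂(μH[1] : Measure Plane), p 0 ∈ A → C.density a b p = 0) :
    ∀ᵐ x, x ∈ Ioo a b → x ∈ A → 0 ≤ C.sliceL x := by
  have hN := C.countable_jumps.measurableSet
  have hN0 := C.countable_jumps.measure_zero volume
  have hNj : ∀ i, (C.data i).jumps ⊆ C.jumps := fun i => subset_iUnion (fun i => (C.data i).jumps) i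
  -- The energy plays no role here; its parameters are set to simple values to have test fields at
  -- hand.
  refine C.sliceL_nonneg_of_integral_le (a := a) (b := b) (α := 1) (β := 0) (g := 0) le_rfl hN hN0
    hA hNj (M := 0) fun n => le_of_eq (sum_flux_eq_zero h0
      (C.negField_integrableFor (α := 1) (g := 0) le_rfl n hN hN0 hA hNj) fun p hp => ?_)
  simp only [TestField.field, negField, hp, false_and, if_false, Pi.zero_apply, plane_zero,
    Finset.notMem_empty]
  exact ite_self 0

/-- A true jump over `y` would be seen by a field that lives on the vertical line over `y` alone. -/
theorem sliceL_eq_sliceR_of_density_eq_zero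
    (h0 : ∀ᵐ p ∂(μH[1] : Measure Plane), p 0 ∈ A → C.density a b p = 0) {y : ℝ} (hy : y ∈ A)
    (hyI : y ∈ Ioo a b) : C.sliceL y = C.sliceR y := by
  by_contra hne
  obtain ⟨δ, hδ0, hδ, -⟩ := exists_gap C.coeff
  obtain ⟨ψ, hψ, hle⟩ := C.exists_vertical_of_trueJump one_pos hδ hne
  have hN := C.countable_jumps.measurableSet
  have hN0 := C.countable_jumps.measure_zero volume
  have hNj : ∀ i, (C.data i).jumps ⊆ C.jumps := fun i => subset_iUnion (fun i => (C.data i).jumps) i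
  obtain ⟨hi, hflux⟩ := C.vertField_sum_flux (a := a) (b := b) (α := 1) (β := 0) (g := 0) le_rfl {y}
    (by simpa using hyI) hN hN0 (fun _ => ψ) (fun _ => hψ) hNj
  rw [sum_flux_eq_zero h0 hi fun p hp => ?_, Finset.sum_singleton] at hflux
  · linarith
  · have hpy : p 0 ≠ y := fun h => hp (h ▸ hy)
    simp only [TestField.field, vertField, Finset.mem_singleton, hpy, if_false, Pi.zero_apply,
      plane_zero]
    exact ite_self 0

/-- The density of the opposite chain vanishes as well, so the slices are both nonnegative and
nonpositive. One-sided limits extend this to the end points of intervals. -/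
theorem sliceL_eq_zero_of_density_eq_zero (hA : MeasurableSet A)
    (h0 : ∀ᵐ p ∂(μH[1] : Measure Plane), p 0 ∈ A → C.density a b p = 0) :
    (∀ᵐ x, x ∈ Ioo a b → x ∈ A → C.sliceL x = 0) ∧
    (∀ x y, x < y → Ioo x y ⊆ A ∩ Ioo a b → C.sliceL y = 0 ∧ C.sliceR x = 0) := by
  have h0' : ∀ᵐ p ∂(μH[1] : Measure Plane), p 0 ∈ A → C.neg.density a b p = 0 := by
    filter_upwards [h0] with p hp hpA
    rw [density_neg, hp hpA, neg_zero]
  have h1 := ae_sliceL_nonneg_of_density_eq_zero hA h0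
  have h2 := ae_sliceL_nonneg_of_density_eq_zero hA h0'
  constructor
  · filter_upwards [h1, h2] with x h1 h2 hx hxA
    have h3 := h2 hx hxA
    rw [sliceL_neg] at h3
    exact le_antisymm (neg_nonneg.1 h3) (h1 hx hxA)
  · intro x y hxy hsub
    have h3 : ∀ᵐ r, r ∈ Ioo x y → 0 ≤ C.sliceL r := by
      filter_upwards [h1] with r hr hrI using hr (hsub hrI).2 (hsub hrI).1
    have h4 : ∀ᵐ r, r ∈ Ioo x y → 0 ≤ C.neg.sliceL r := by
      filter_upwards [h2] with r hr hrI using hr (hsub hrI).2 (hsub hrI).1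
    have h5 := C.neg.sliceL_nonneg_of_ae hxy h4
    have h6 := C.neg.sliceR_nonneg_of_ae hxy h4
    rw [sliceL_neg] at h5
    rw [sliceR_neg] at h6
    exact ⟨le_antisymm (neg_nonneg.1 h5) (C.sliceL_nonneg_of_ae hxy h3),
      le_antisymm (neg_nonneg.1 h6) (C.sliceR_nonneg_of_ae hxy h3)⟩

theorem sum_mul_eq_zero {c z : ι → ℝ} (h : slice c z = 0) (f : ℝ → ℝ) :
    ∑ i, c i * f (z i) = 0 := by
  rw [sum_mul_eq, h]
  simp

/-- Each term of `calib` is a function of a slice. The slices vanish almost everywhere over `I \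
I'`; at the points of `P` the left and right slices agree, and the primitive of `ψ` has no
increment. The points `a'` and `b'` belong to `I \ I'`: no jump of the slice occurs there, and its
limit from outside `I'` is zero. -/
theorem sum_calib_eq_zero {a' b' α β K : ℝ} {G : ℝ → ℝ} {W : ℝ → ℝ → ℝ} {U : SBVData}
    {P : Finset ℝ} {ψ : ℝ → ℝ → ℝ} (haa' : a < a') (hab' : a' < b') (hbb' : b' < b)
    (hG : Measurable G) (hK : ∀ x, |G x| ≤ K)
    (hU : IntegrableOn (fun x => U.slope x ^ 2) (Ioo a b))
    (hP : ∀ y ∈ P, y ∈ Ioo a b \ Ioo a' b')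
    (hψ : ∀ y, Measurable (ψ y) ∧ (∀ s t, IntervalIntegrable (ψ y) volume s t) ∧
      (∀ s t, |∫ r in s..t, ψ y r| ≤ α))
    (h0 : ∀ᵐ p ∂(μH[1] : Measure Plane), p 0 ∈ Ioo a b \ Ioo a' b' → C.density a b p = 0) :
    ∑ i, C.coeff i * calib a b a' b' β G U P ψ W (C.data i) = 0 := by
  have hA : MeasurableSet (Ioo a b \ Ioo a' b') := measurableSet_Ioo.diff measurableSet_Ioo
  obtain ⟨hz, hz'⟩ := sliceL_eq_zero_of_density_eq_zero hA h0
  have haI : a' ∈ Ioo a b := ⟨haa', hab'.trans hbb'⟩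
  have hbI : b' ∈ Ioo a b := ⟨haa'.trans hab', hbb'⟩
  have ha : C.sliceR a' = 0 := by
    rw [← sliceL_eq_sliceR_of_density_eq_zero h0 ⟨haI, fun h => lt_irrefl _ h.1⟩ haI]
    refine (hz' a a' haa' fun r hr => ?_).1
    have : r ∈ Ioo a b := ⟨hr.1, hr.2.trans haI.2⟩
    exact ⟨⟨this, fun h => absurd hr.2 h.1.not_gt⟩, this⟩
  have hb : C.sliceL b' = 0 := by
    rw [sliceL_eq_sliceR_of_density_eq_zero h0 ⟨hbI, fun h => lt_irrefl _ h.2⟩ hbI]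
    refine (hz' b' b hbb' fun r hr => ?_).2
    have : r ∈ Ioo a b := ⟨hbI.1.trans hr.1, hr.2⟩
    exact ⟨⟨this, fun h => absurd hr.1 h.2.not_gt⟩, this⟩
  simp only [calib, mul_add, mul_sub, Finset.sum_add_distrib, Finset.sum_sub_distrib,
    Finset.mul_sum]
  rw [sum_mul_eq_zero hb (W b'), sum_mul_eq_zero ha (W a'), Finset.sum_comm]
  have e1 : ∑ y ∈ P, ∑ i, C.coeff i * ∫ t in (C.data i).L y..(C.data i).R y, ψ y t = 0 := by
    refine Finset.sum_eq_zero fun y hy => ?_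
    have h1 : ∀ i, ∫ t in (C.data i).L y..(C.data i).R y, ψ y t =
        (∫ t in 0..(C.data i).R y, ψ y t) - ∫ t in 0..(C.data i).L y, ψ y t := fun i =>
      (intervalIntegral.integral_interval_sub_left ((hψ y).2.1 _ _) ((hψ y).2.1 _ _)).symm
    simp_rw [h1, mul_sub, Finset.sum_sub_distrib]
    rw [sub_eq_zero]
    exact (sum_mul_congr C.coeff (sliceL_eq_sliceR_of_density_eq_zero h0 (hP y hy) (hP y hy).1)
      fun r => ∫ t in 0..r, ψ y t).symm
  have e2 : ∑ i, C.coeff i * ∫ x in Ioo a b \ Ioo a' b',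
      (graphField U x ((C.data i).L x) * (C.data i).slope x -
      (graphField U x ((C.data i).L x) ^ 2 / 4 - β * ((C.data i).L x - G x) ^ 2)) = 0 := by
    simp_rw [← integral_const_mul]
    rw [← integral_finsetSum _ fun i _ => (integrableOn_calib hU hG hK (C.data i)).const_mul _]
    refine integral_eq_zero_of_ae ?_
    rw [EventuallyEq, ae_restrict_iff' hA]
    filter_upwards [hz, C.ae_slope_L] with x h1 h2 hx
    have h3 := sum_mul_eq_zero (h1 hx.1 hx) fun t => graphField U x t * C.slope x t -
      (graphField U x t ^ 2 / 4 - β * (t - G x) ^ 2)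
    simp only [h2] at h3
    exact h3
  rw [e1, e2]
  simp

end Chain

/-! ### The energy of the minimizer -/

section Energy

variable {a b a' b' α β K : ℝ} {g G u : ℝ → ℝ} {U : SBVData}

theorem SBVData.count_eq_ncard {D : SBVData} {s : Set ℝ} (h : (D.jumps ∩ s).Finite) :
    D.count s = ENNReal.ofReal ((D.jumps ∩ s).ncard : ℝ) := by
  rw [SBVData.count, ← h.cast_ncard_eq]
  simp

theorem SBVData.bulk_eq_ofReal {D : SBVData} {s : Set ℝ} (hβ : 0 ≤ β)
    (h : IntegrableOn (fun x => D.slope x ^ 2 + β * (D.L x - G x) ^ 2) s) :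
    D.bulk β G s = ENNReal.ofReal (∫ x in s, (D.slope x ^ 2 + β * (D.L x - G x) ^ 2)) := by
  rw [ofReal_integral_eq_lintegral_ofReal h (Eventually.of_forall fun x => by positivity)]
  rfl

theorem IsRep.finite_jumps (h : IsRep a b u U) (hα : 0 < α) (hfin : energy a b α β g u < ⊤) :
    (U.jumps ∩ Ioo a b).Finite := by
  rw [h.energy_eq] at hfin
  have h1 := (ENNReal.add_lt_top.1 hfin).2
  by_contra hinf
  have : (U.jumps ∩ Ioo a b).encard = ⊤ := Set.Infinite.encard_eq hinf
  rw [this] at h1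
  simp [hα] at h1

theorem IsRep.integrableOn_slope_sq (h : IsRep a b u U) (hfin : energy a b α β g u < ⊤) :
    IntegrableOn (fun x => U.slope x ^ 2) (Ioo a b) := by
  rw [h.energy_eq] at hfin
  have h1 := (ENNReal.add_lt_top.1 (ENNReal.add_lt_top.1 hfin).1).1
  refine ⟨(U.measurable_slope.pow_const 2).aestronglyMeasurable, ?_⟩
  rwa [hasFiniteIntegral_iff_ofReal (Eventually.of_forall fun x => sq_nonneg _)]

theorem IsRep.energy_eq_ofReal (h : IsRep a b u U) (hα : 0 < α) (hβ : 0 ≤ β) (hG : Measurable G)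
    (hK : ∀ x, |G x| ≤ K) (hgG : ∀ᵐ x, x ∈ Ioo a b → g x = G x)
    (hfin : energy a b α β g u < ⊤) :
    energy a b α β g u = ENNReal.ofReal
      ((∫ x in Ioo a b, (U.slope x ^ 2 + β * (U.L x - G x) ^ 2)) +
        α * (U.jumps ∩ Ioo a b).ncard) := by
  have h1 : IntegrableOn (fun x => U.slope x ^ 2 + β * (U.L x - G x) ^ 2) (Ioo a b) :=
    (h.integrableOn_slope_sq hfin).add ((Chain.integrableOn_sq_sub U hG hK).const_mul β)
  rw [h.energy_eq_bulk hβ hgG, SBVData.bulk_eq_ofReal hβ h1,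
    SBVData.count_eq_ncard (h.finite_jumps hα hfin), ← ENNReal.ofReal_mul hα.le,
    ← ENNReal.ofReal_add (integral_nonneg fun x => by positivity) (by positivity)]

/-- The chain of a single graph. -/
def SBVData.toChain (D : SBVData) : Chain Unit := ⟨fun _ => 1, fun _ => D⟩

theorem IsRep.represents (h : IsRep a b u U) : U.toChain.Represents (graphCurrent a b u) := by
  have := U.toChain.represents_sum (a := a) (b := b) (u := fun _ => u) fun _ => h
  simpa [SBVData.toChain] using this

/-- With `q = φˣ` and `p = u'`, admissibility and `q p - q² / 4 ≤ p²` bound the flux density by the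
energy density, and each jump contributes at most `α`. -/
theorem IsRep.lift_le_energy (h : IsRep a b u U) (hα : 0 < α) (hG : Measurable G)
    (hK : ∀ x, |G x| ≤ K) (hgG : ∀ᵐ x, x ∈ Ioo a b → g x = G x)
    (hfin : energy a b α β g u < ⊤) :
    lift a b α β g (graphCurrent a b u) ≤
      (((∫ x in Ioo a b, (U.slope x ^ 2 + β * (U.L x - G x) ^ 2)) +
        α * (U.jumps ∩ Ioo a b).ncard : ℝ) : EReal) := by
  have hj := h.finite_jumps hα hfin
  have hi : IntegrableOn (fun x => U.slope x ^ 2 + β * (U.L x - G x) ^ 2) (Ioo a b) :=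
    (h.integrableOn_slope_sq hfin).add ((Chain.integrableOn_sq_sub U hG hK).const_mul β)
  refine U.toChain.lift_le h.represents fun φ hφ hint => EReal.coe_le_coe_iff.2 ?_
  have hd : U.toChain.density a b = U.density a b := by
    ext p
    simp [Chain.density, SBVData.toChain]
  rw [hd] at hint ⊢
  rw [U.integral_cross a b hφ.1 hint]
  refine add_le_add ?_ ?_
  · refine integral_mono_ae ((U.integrable_cross_iff a b hφ.1).1 hint).1 hi ?_
    rw [EventuallyLE, ae_restrict_iff' measurableSet_Ioo]
    filter_upwards [hgG] with x hx hxI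
    have h1 := hφ.2.1 x hxI (U.L x)
    rw [hx hxI] at h1
    change φ !₂[x, U.L x] 0 * U.slope x - φ !₂[x, U.L x] 1 ≤ _
    nlinarith [sq_nonneg (φ !₂[x, U.L x] 0 / 2 - U.slope x)]
  · have : Fintype ↥(U.jumps ∩ Ioo a b) := hj.fintype
    rw [tsum_fintype]
    calc ∑ x : ↥(U.jumps ∩ Ioo a b), ∫ t in U.L x..U.R x, φ (vert x t) 0
        ≤ ∑ x : ↥(U.jumps ∩ Ioo a b), α := Finset.sum_le_sum fun x _ =>
          (le_abs_self _).trans (hφ.2.2 x x.2.2 _ _).2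
      _ = α * (U.jumps ∩ Ioo a b).ncard := by
          rw [Finset.sum_const, nsmul_eq_mul, Finset.card_univ, ← Nat.card_eq_fintype_card,
            Nat.card_coe_set_eq, mul_comm]

/-- The vertical field that is calibrated by the jumps of `U`. -/
theorem exists_jumpField (hα : 0 ≤ α) (U : SBVData) : ∃ ψ : ℝ → ℝ → ℝ,
    (∀ y, Measurable (ψ y) ∧ (∀ s t, IntervalIntegrable (ψ y) volume s t) ∧
      (∀ s t, |∫ r in s..t, ψ y r| ≤ α)) ∧
    ∀ y ∈ U.jumps, ∫ t in U.L y..U.R y, ψ y t = α := by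
  classical
  have h : ∀ y, ∃ χ : ℝ → ℝ, (Measurable χ ∧ (∀ s t, IntervalIntegrable χ volume s t) ∧
      (∀ s t, |∫ r in s..t, χ r| ≤ α)) ∧ (y ∈ U.jumps → ∫ t in U.L y..U.R y, χ t = α) := by
    intro y
    obtain ⟨χ, h1, h2, h3, h4⟩ := exists_interpolation hα {U.L y, U.R y}
      (fun t => if t = U.R y then α else 0) fun s _ t _ => by split_ifs <;> linarith
    refine ⟨χ, ⟨h1, h2, h3⟩, fun hy => ?_⟩
    have hne : U.L y ≠ U.R y := fun h => U.L_eq_R_iff.1 h hy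
    rw [h4 _ (by simp) _ (by simp), if_pos rfl, if_neg hne, sub_zero]
  choose ψ h1 h2 using h
  exact ⟨ψ, h1, h2⟩

/-- Outside `I'` the choices `φˣ = 2 u'` and `ψ` turn the flux into exactly the energy of `u`.
Inside, `W(a', uʳ(a')) = 0`, and `W(b', uˡ(b'))` is at least the energy of `u` by minimality. -/
theorem energy_le_calib (haa' : a < a') (hab' : a' < b') (hbb' : b' < b) (hα : 0 < α)
    (hβ : 0 ≤ β) (hG : Measurable G) (hK : ∀ x, |G x| ≤ K)
    (hgG : ∀ᵐ x, x ∈ Ioo a b → g x = G x) (hU : IsRep a b u U)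
    (hmin : IsDirichletMinimizer a b a' b' α β g u) (hfin : energy a b α β g u < ⊤)
    {P : Finset ℝ} (hP : (P : Set ℝ) = U.jumps ∩ (Ioo a b \ Ioo a' b')) {ψ : ℝ → ℝ → ℝ}
    (hψ : ∀ y ∈ U.jumps, ∫ t in U.L y..U.R y, ψ y t = α) :
    (∫ x in Ioo a b, (U.slope x ^ 2 + β * (U.L x - G x) ^ 2)) + α * (U.jumps ∩ Ioo a b).ncard ≤
      calib a b a' b' β G U P ψ (fun x t => (value a' b' α β G (U.R a') x t).toReal) U := by
  have hI : Ioo a' b' ⊆ Ioo a b := Ioo_subset_Ioo haa'.le hbb'.le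
  have hj := hU.finite_jumps hα hfin
  have hj' : (U.jumps ∩ Ioo a' b').Finite := hj.subset (inter_subset_inter_right _ hI)
  have hi : IntegrableOn (fun x => U.slope x ^ 2 + β * (U.L x - G x) ^ 2) (Ioo a b) :=
    (hU.integrableOn_slope_sq hfin).add ((Chain.integrableOn_sq_sub U hG hK).const_mul β)
  have e1 : ∫ x in Ioo a b \ Ioo a' b', (graphField U x (U.L x) * U.slope x -
      (graphField U x (U.L x) ^ 2 / 4 - β * (U.L x - G x) ^ 2)) =
      ∫ x in Ioo a b \ Ioo a' b', (U.slope x ^ 2 + β * (U.L x - G x) ^ 2) := by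
    refine integral_congr_ae (Eventually.of_forall fun x => ?_)
    simp only [graphField, if_true]
    ring
  have e2 : ∑ y ∈ P, (∫ t in U.L y..U.R y, ψ y t) = α * (U.jumps ∩ (Ioo a b \ Ioo a' b')).ncard := by
    rw [Finset.sum_congr rfl fun y hy => hψ y (by
      have : y ∈ (P : Set ℝ) := hy
      rw [hP] at this
      exact this.1), Finset.sum_const, nsmul_eq_mul, ← hP, Set.ncard_coe_finset, mul_comm]
  have e3 : ((U.jumps ∩ Ioo a b).ncard : ℝ) = (U.jumps ∩ (Ioo a b \ Ioo a' b')).ncard +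
      (U.jumps ∩ Ioo a' b').ncard := by
    have : U.jumps ∩ Ioo a b = (U.jumps ∩ (Ioo a b \ Ioo a' b')) ∪ (U.jumps ∩ Ioo a' b') := by
      rw [← inter_union_distrib_left, sdiff_union_self, union_eq_left.2 hI]
    rw [this, Set.ncard_union_eq (Set.disjoint_left.2 fun y h1 h2 => h1.2.2 h2.2)
      (hj.subset (inter_subset_inter_right _ sdiff_subset)) hj']
    push_cast
    rfl
  have e4 := integral_inter_add_sdiff (μ := volume) (s := Ioo a b) (t := Ioo a' b')
    measurableSet_Ioo hi
  rw [inter_eq_right.2 hI] at e4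
  have e5 : (∫ x in Ioo a' b', (U.slope x ^ 2 + β * (U.L x - G x) ^ 2)) +
      α * (U.jumps ∩ Ioo a' b').ncard ≤ (value a' b' α β G (U.R a') b' (U.L b')).toReal := by
    rw [← ENNReal.ofReal_le_iff_le_toReal (value_lt_top hK hβ (right_mem_Icc.2 hab'.le) _).ne,
      ENNReal.ofReal_add (integral_nonneg fun x => by positivity) (by positivity),
      ENNReal.ofReal_mul hα.le, ← SBVData.count_eq_ncard hj',
      ← SBVData.bulk_eq_ofReal hβ (hi.mono_set hI)]
    exact le_iInf₂ fun k hk => hk.energy_le haa' hab' hbb' hβ hgG hmin hfin hU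
  rw [calib, e1, e2, value_start, ENNReal.toReal_zero, e3, ← e4]
  linarith

end Energy

/-- The empty chain represents the zero current. This bound makes the calibration independent of the
representation of a current. -/
theorem lift_zero_le (a b α β : ℝ) (g : ℝ → ℝ) : lift a b α β g 0 ≤ 0 := by
  let C : Chain Empty := ⟨Empty.elim, Empty.elim⟩
  have hC : C.Represents (0 : FormFunctional a b) := fun w => by simp [Chain.density]
  refine C.lift_le hC fun φ _ _ => le_of_eq ?_
  simp [Chain.density, cross_zero]

end MumfordShah

end


/-! ### Assembling the calibration -/

open MumfordShah in
theorem mainTheorem3 (a b a' b' α β : ℝ) (haa' : a < a') (hab' : a' < b') (hbb' : b' < b)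
    (hα : 0 < α) (hβ : 0 ≤ β) (g : ℝ → ℝ)
    (hg : MeasureTheory.MemLp g ⊤ (MeasureTheory.volume.restrict (Set.Ioo a b)))
    (u : ℝ → ℝ) (hu : MumfordShah.IsSBV a b u)
    (hmin : MumfordShah.IsDirichletMinimizer a b a' b' α β g u)
    (hfin : MumfordShah.energy a b α β g u < ⊤) :
    ∃ ξ : MumfordShah.graphSpan a b →ₗ[ℝ] ℝ,
      MumfordShah.IsCalibration a b a' b' α β g u hu ξ := by
  classical
  obtain ⟨G, K, hG, hK, hgG⟩ := exists_bounded_measurable_rep hg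
  choose rep hrep using fun v : {v : ℝ → ℝ // IsSBV a b v} => v.2.exists_isRep
  let u₀ : {v : ℝ → ℝ // IsSBV a b v} := ⟨u, hu⟩
  let U : SBVData := rep u₀
  have hU : IsRep a b u U := (hrep u₀).1
  obtain ⟨ψ, hψ, hψα⟩ := exists_jumpField hα.le U
  have hj : (U.jumps ∩ (Ioo a b \ Ioo a' b')).Finite :=
    (hU.finite_jumps hα hfin).subset (inter_subset_inter_right _ sdiff_subset)
  let P : Finset ℝ := hj.toFinset
  have hP : (P : Set ℝ) = U.jumps ∩ (Ioo a b \ Ioo a' b') := hj.coe_toFinset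
  have hP' : ∀ y ∈ P, y ∈ Ioo a b \ Ioo a' b' := fun y hy => (hj.mem_toFinset.1 hy).2
  let W : ℝ → ℝ → ℝ := fun x t => (value a' b' α β G (U.R a') x t).toReal
  have hW : IsValue a' b' α β G W := isValue_value hK hα.le hβ
  have hUsq := hU.integrableOn_slope_sq hfin
  -- `calib` is a function of data and not of currents, so it is first extended to formal
  -- combinations of functions; `Λ` sends these to currents.
  let Λ : ({v : ℝ → ℝ // IsSBV a b v} →₀ ℝ) →ₗ[ℝ] graphSpan a b :=
    Finsupp.linearCombination ℝ fun v => graphElem a b v.1 v.2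
  let Ξ : ({v : ℝ → ℝ // IsSBV a b v} →₀ ℝ) →ₗ[ℝ] ℝ :=
    Finsupp.linearCombination ℝ fun v => calib a b a' b' β G U P ψ W (rep v)
  let C : ∀ f : {v : ℝ → ℝ // IsSBV a b v} →₀ ℝ, Chain f.support := fun f =>
    ⟨fun i => f i, fun i => rep i⟩
  have hC : ∀ f, (C f).Represents (Λ f : FormFunctional a b) := by
    intro f
    have h1 := (C f).represents_sum (a := a) (b := b) (u := fun i => i.1.1) fun i => (hrep i).1
    have h2 : (Λ f : FormFunctional a b) = ∑ i : f.support, (C f).coeff i • graphCurrent a b i.1.1 := by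
      simp only [Λ, Finsupp.linearCombination_apply, Finsupp.sum, C]
      rw [Finset.sum_coe_sort f.support (fun i => f i • graphCurrent a b i.1)]
      simp [graphElem]
    rwa [h2]
  have hΞ : ∀ f, Ξ f = ∑ i, (C f).coeff i * calib a b a' b' β G U P ψ W ((C f).data i) := by
    intro f
    simp only [Ξ, Finsupp.linearCombination_apply, Finsupp.sum, C, smul_eq_mul]
    rw [Finset.sum_coe_sort f.support (fun i => f i * calib a b a' b' β G U P ψ W (rep i))]
  have hle : ∀ f, ((Ξ f : ℝ) : EReal) ≤ lift a b α β g (Λ f) := by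
    intro f
    rw [hΞ]
    exact (C f).sum_calib_le_lift haa' hab' hbb' hα hβ hG hK hgG hW hUsq hP' hψ (hC f)
  -- Well-definedness: a formal combination that represents zero has `Ξ ≤ 0` by the calibration
  -- inequality, and so has its opposite.
  have hker : ∀ f, Λ f = 0 → Ξ f = 0 := by
    have hnp : ∀ f, Λ f = 0 → Ξ f ≤ 0 := fun f hf => by
      have := hle f
      rw [hf] at this
      exact_mod_cast this.trans (lift_zero_le a b α β g)
    intro f hf
    have h1 := hnp (-f) (by rw [map_neg, hf, neg_zero])
    rw [map_neg] at h1
    linarith [hnp f hf]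
  have hsurj : LinearMap.range Λ = ⊤ := by
    rw [Finsupp.range_linearCombination, eq_top_iff]
    rintro ⟨T, hT⟩ -
    refine Submodule.span_induction (p := fun T hT => (⟨T, hT⟩ : graphSpan a b) ∈
      Submodule.span ℝ (range fun v : {v : ℝ → ℝ // IsSBV a b v} => graphElem a b v.1 v.2))
      ?_ ?_ ?_ ?_ hT
    · rintro _ ⟨v, hv, rfl⟩
      exact Submodule.subset_span ⟨⟨v, hv⟩, rfl⟩
    · exact Submodule.zero_mem _
    · intro x y hx hy h1 h2
      exact Submodule.add_mem _ h1 h2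
    · intro c x hx h1
      exact Submodule.smul_mem _ c h1
  -- A linear section of `Λ` turns `Ξ` into a functional on currents; by `hker` its choice does not
  -- matter.
  obtain ⟨σ, hσ⟩ := LinearMap.exists_rightInverse_of_surjective Λ hsurj
  have hσ' : ∀ T, Λ (σ T) = T := fun T => LinearMap.congr_fun hσ T
  have hξ : ∀ f, Ξ (σ (Λ f)) = Ξ f := fun f => by
    rw [← sub_eq_zero, ← map_sub]
    exact hker _ (by rw [map_sub, hσ', sub_self])
  have hu1 : Λ (Finsupp.single u₀ 1) = graphElem a b u hu := by
    simp [Λ, u₀]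
  have hu2 : Ξ (Finsupp.single u₀ 1) = calib a b a' b' β G U P ψ W U := by
    simp [Ξ, U]
  have h1 := energy_le_calib haa' hab' hbb' hα hβ hG hK hgG hU hmin hfin hP hψα
  have h2 := hU.lift_le_energy hα hG hK hgG hfin
  have h3 : (((Ξ ∘ₗ σ) (graphElem a b u hu) : ℝ) : EReal) ≤ lift a b α β g (graphCurrent a b u) := by
    have := hle (σ (graphElem a b u hu))
    rwa [hσ'] at this
  have h4 : (Ξ ∘ₗ σ) (graphElem a b u hu) = calib a b a' b' β G U P ψ W U := by
    rw [LinearMap.comp_apply, ← hu1, hξ, hu2]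
  have h5 : (energy a b α β g u : EReal) =
      (((∫ x in Ioo a b, (U.slope x ^ 2 + β * (U.L x - G x) ^ 2)) +
        α * (U.jumps ∩ Ioo a b).ncard : ℝ) : EReal) := by
    rw [hU.energy_eq_ofReal hα hβ hG hK hgG hfin, EReal.coe_ennreal_ofReal, max_eq_left]
    have : 0 ≤ ∫ x in Ioo a b, (U.slope x ^ 2 + β * (U.L x - G x) ^ 2) :=
      integral_nonneg fun x => by positivity
    positivity
  rw [h4] at h3
  have h6 := (EReal.coe_le_coe_iff.2 h1)
  -- The first condition closes the circle `F(u) ≤ ξ(Γ_u) ≤ Ĝ(Γ_u) ≤ F(u)`.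
  refine ⟨Ξ ∘ₗ σ, ⟨?_, ?_⟩, fun T hT => ?_, fun T => ?_⟩
  · rw [h4]
    exact le_antisymm h3 (h2.trans h6)
  · rw [h5]
    exact le_antisymm h2 (h6.trans h3)
  · rw [LinearMap.comp_apply, hΞ]
    refine Chain.sum_calib_eq_zero haa' hab' hbb' hG hK hUsq hP' hψ ?_
    refine (C (σ T)).density_eq_zero_of_restrictEqZero (hC (σ T))
      (measurableSet_Ioo.diff measurableSet_Ioo) ?_
    rwa [hσ']
  · have := hle (σ T)
    rwa [hσ'] at this
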